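/- For a set function $f\colon 2^V\to\mathbb R$ on a finite set $V$ let $\arg\min f=\{Y\subseteq V: f(Y)\le f(Y')\ \forall\, Y'\subseteq V\}$; $f$ is submodular if $f(X)+f(Y)\ge f(X\cup Y)+f(X\cap Y)$ for all $X,Y\subseteq V$. **Robust Submodular Minimizer.** Given a finite set $V$, submodular functions $f_1,\dots,f_k\colon 2^V\to\mathbb R$ and $d\in\mathbb N$, find a set $X\subseteq V$ such that for each $i\in[k]$ there is $Y_i\in\mathcal L_i:=\arg\min f_i$ with $|X\mathbin{\triangle}Y_i|\le d$, or detect that no such set exists. **Anchored Submodular Minimizer.** Given in addition a set $Y_0\subseteq V$ and an integer $0\le d_0\le d$, find a set $X$ that moreover satisfies $|X\mathbin{\triangle}Y_0|\le d_0$, or detect that no such set exists. Each $f_i$ is given through a compact representation of $\mathcal L_i$: a partition of $V$ into blocks $U_0,U_1,\dots,U_b,U_\infty$, of which only $U_0$ and $U_\infty$ may be empty, together with an acyclic directed graph on $\{U_0,\dots,U_b\}$ whose unique sink is $U_0$, such that every set in $\mathcal L_i$ contains $U_0$, is disjoint from $U_\infty$ and is a union of blocks, and such that for each set $Z$ of vertices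 of the graph with $U_0\in Z$, no edge leaves $Z$ if and only if $\bigcup_{U_j\in Z}U_j\in\mathcal L_i$. Let $n$ denote the length of the input (the number of words that list $V$, $k$, $d$, the compact representations and, where present, $Y_0$ and $d_0$), and count time as steps of a random access machine with addition, subtraction and comparison of natural numbers as unit-cost operations. **Theorem.** 1. There are an algorithm, a constant $c$ and a computable function $g$ such that the algorithm solves every instance of Robust Submodular Minimizer with $k\ge1$ in at most $|\mathcal L_1|\cdot g(d)\cdot n^c$ time. 2. Consequently, Robust Submodular Minimizer is fixed-parameter tractable with parameter $d$ on instances in which some function has polynomially many minimizers: for every polynomial $q$ there are an algorithm, a constant $c$ and a computable function $g$ such that the algorithm solves every instance in which $|\mathcal L_i|\le q(n)$ for some $i\in[k]$ in at most $g(d)\cdot n^c$ time. 3. Anchored Submodular Minimizer is fixed-parameter tractable with parameter $d$: there are an algorithm, a constant $c$ and a computable function $g$ such that the algorithm solves every instance in at most $g(d)\cdot n^c$ time. -/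

import Mathlib

namespace RobustSubmodular

/-! ### Random access machine

Programs work on natural numbers, which are stored in scalar variables and in arrays. A program
mentions only finitely many variables and arrays, by fixed names; array cells are addressed by
computed indices. Arithmetic is addition and truncated subtraction, and every elementary operation
takes one step. -/

/-- Arithmetic expressions. -/
inductive Expr : Type
  | lit (n : ℕ) : Expr
  | var (x : ℕ) : Expr
  | get (a : ℕ) (e : Expr) : Expr
  | add (e₁ e₂ : Expr) : Expr
  | sub (e₁ e₂ : Expr) : Expr

/-- Programs. -/
inductive Prog : Type
  | skip : Prog
  | assign (x : ℕ) (e : Expr) : Prog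
  | store (a : ℕ) (e₁ e₂ : Expr) : Prog
  | seq (p q : Prog) : Prog
  | ite (e : Expr) (p q : Prog) : Prog
  | while (e : Expr) (p : Prog) : Prog

/-- A memory state: the values of the scalar variables, and the contents of the arrays. -/
structure State : Type where
  var : ℕ → ℕ
  arr : ℕ → ℕ → ℕ

/-- Value of an expression. -/
def Expr.eval (s : State) : Expr → ℕ
  | .lit n => n
  | .var x => s.var x
  | .get a e => s.arr a (e.eval s)
  | .add e₁ e₂ => e₁.eval s + e₂.eval s
  | .sub e₁ e₂ => e₁.eval s - e₂.eval s

/-- Number of elementary operations needed to evaluate an expression. -/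
def Expr.cost : Expr → ℕ
  | .lit _ => 1
  | .var _ => 1
  | .get _ e => e.cost + 1
  | .add e₁ e₂ => e₁.cost + e₂.cost + 1
  | .sub e₁ e₂ => e₁.cost + e₂.cost + 1

/-- Write the value `w` into the variable `x`. -/
def State.setVar (s : State) (x w : ℕ) : State :=
  { s with var := Function.update s.var x w }

/-- Write the value `w` into the cell of the array `a` with index `i`. -/
def State.setArr (s : State) (a i w : ℕ) : State :=
  { s with arr := Function.update s.arr a (Function.update (s.arr a) i w) }

/-- `Exec p s t s'`: the program `p`, started in the state `s`, halts after exactly `t` steps in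
the state `s'`. A test succeeds when its value is nonzero. -/
inductive Exec : Prog → State → ℕ → State → Prop
  | skip (s : State) : Exec .skip s 1 s
  | assign (x : ℕ) (e : Expr) (s : State) :
      Exec (.assign x e) s (e.cost + 1) (s.setVar x (e.eval s))
  | store (a : ℕ) (e₁ e₂ : Expr) (s : State) :
      Exec (.store a e₁ e₂) s (e₁.cost + e₂.cost + 1) (s.setArr a (e₁.eval s) (e₂.eval s))
  | seq {p q : Prog} {s s' s'' : State} {t t' : ℕ} (h : Exec p s t s') (h' : Exec q s' t' s'') :
      Exec (.seq p q) s (t + t') s''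
  | ite_true {e : Expr} {p q : Prog} {s s' : State} {t : ℕ} (he : e.eval s ≠ 0)
      (h : Exec p s t s') : Exec (.ite e p q) s (e.cost + 1 + t) s'
  | ite_false {e : Expr} {p q : Prog} {s s' : State} {t : ℕ} (he : e.eval s = 0)
      (h : Exec q s t s') : Exec (.ite e p q) s (e.cost + 1 + t) s'
  | while_true {e : Expr} {p : Prog} {s s' s'' : State} {t t' : ℕ} (he : e.eval s ≠ 0)
      (h : Exec p s t s') (h' : Exec (.while e p) s' t' s'') :
      Exec (.while e p) s (e.cost + 1 + t + t') s''
  | while_false {e : Expr} {p : Prog} {s : State} (he : e.eval s = 0) :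
      Exec (.while e p) s (e.cost + 1) s

/-- The initial state: variable `0` holds the length of the input, array `0` holds the input, and
everything else is zero. -/
def initState (input : List ℕ) : State where
  var x := if x = 0 then input.length else 0
  arr a i := if a = 0 then input.getD i 0 else 0

/-- The program `p`, started on `input`, halts after at most `T` steps and solves the task of
finding a set `X ⊆ {0, …, m - 1}` with the property `Sol`, or detecting that there is none: it
halts either with `1` in variable `0` and the characteristic vector of such a set in array `0`, or
with `0` in variable `0`, in which case no such set exists. -/
def SolvesWithin (p : Prog) (input : List ℕ) {m : ℕ} (Sol : Finset (Fin m) → Prop) (T : ℕ) :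
    Prop :=
  ∃ (t : ℕ) (s : State), Exec p (initState input) t s ∧ t ≤ T ∧
    ((s.var 0 = 1 ∧ ∃ X : Finset (Fin m), Sol X ∧
        ∀ v : Fin m, s.arr 0 (v : ℕ) = if v ∈ X then 1 else 0) ∨
      (s.var 0 = 0 ∧ ¬ ∃ X : Finset (Fin m), Sol X))

/-! ### Submodular functions and compact representations -/

/-- Submodular set functions. -/
def IsSubmodular {V : Type*} [DecidableEq V] (f : Finset V → ℝ) : Prop :=
  ∀ X Y : Finset V, f (X ∪ Y) + f (X ∩ Y) ≤ f X + f Y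

/-- The family `arg min f` of minimizers of a set function. -/
def minimizers {V : Type*} (f : Finset V → ℝ) : Set (Finset V) :=
  {Y | ∀ Y' : Finset V, f Y ≤ f Y'}

/-- A compact representation of a family `L` of subsets of `V`: a partition of `V` into blocks
`U 0, U 1, …, U b` and `U ∞`, of which only `U 0` and `U ∞` may be empty, and an acyclic directed
graph on `U 0, …, U b`. The index `b + 1` stands for `∞`. -/
structure CompactRep {V : Type*} [Fintype V] [DecidableEq V] (L : Set (Finset V)) where
  /-- the number of blocks other than `U 0` and `U ∞` -/
  b : ℕ
  /-- the index of the block that contains a given element -/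
  block : V → Fin (b + 2)
  /-- the edges of the graph -/
  edge : Fin (b + 1) → Fin (b + 1) → Bool
  block_nonempty : ∀ j : Fin (b + 1), j ≠ 0 → ∃ v, block v = j.castSucc
  /-- every member of `L` contains `U 0` -/
  mem_of_zero : ∀ X ∈ L, ∀ v, block v = 0 → v ∈ X
  /-- every member of `L` is disjoint from `U ∞` -/
  notMem_of_last : ∀ X ∈ L, ∀ v, block v = Fin.last (b + 1) → v ∉ X
  /-- every member of `L` is the union of `U 0` with some of the `U j` -/
  eq_union : ∀ X ∈ L, ∃ J : Finset (Fin (b + 1)), 0 ∈ J ∧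
    X = Finset.univ.filter (fun v => ∃ j ∈ J, block v = j.castSucc)
  acyclic : ∀ j, ¬ Relation.TransGen (fun i i' => edge i i' = true) j j
  /-- `U 0` is the unique sink -/
  sink_iff : ∀ j, (∀ j', edge j j' = false) ↔ j = 0
  /-- a set of vertices of the graph that contains `U 0` has no outgoing edge if and only if its
  union belongs to `L` -/
  closed_iff : ∀ Z : Finset (Fin (b + 1)), 0 ∈ Z →
    ((∀ j ∈ Z, ∀ j', edge j j' = true → j' ∈ Z) ↔
      Finset.univ.filter (fun v => ∃ j ∈ Z, block v = j.castSucc) ∈ L)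

/-- A compact representation as a list of numbers: `b`, the block index of every element, and the
adjacency matrix of the graph, row by row. -/
def CompactRep.encode {m : ℕ} {L : Set (Finset (Fin m))} (R : CompactRep L) : List ℕ :=
  R.b :: (List.ofFn (fun v : Fin m => (R.block v : ℕ)) ++
    (List.ofFn fun j : Fin (R.b + 1) =>
      List.ofFn fun j' : Fin (R.b + 1) => if R.edge j j' = true then 1 else 0).flatten)

/-! ### The problems -/

/-- An instance of Robust Submodular Minimizer with ground set `{0, …, m - 1}`, in which the
submodular functions are given through compact representations of their families of minimizers. -/
structure RSMInstance where
  m : ℕ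
  k : ℕ
  f : Fin k → Finset (Fin m) → ℝ
  submodular : ∀ i, IsSubmodular (f i)
  rep : ∀ i, CompactRep (minimizers (f i))
  d : ℕ

/-- The solutions of an instance of Robust Submodular Minimizer. -/
def RSMInstance.IsSolution (I : RSMInstance) (X : Finset (Fin I.m)) : Prop :=
  ∀ i, ∃ Y ∈ minimizers (I.f i), (symmDiff X Y).card ≤ I.d

/-- The input that encodes an instance of Robust Submodular Minimizer. -/
def RSMInstance.encode (I : RSMInstance) : List ℕ :=
  [I.m, I.k, I.d] ++ (List.ofFn fun i => (I.rep i).encode).flatten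

/-- An instance of Anchored Submodular Minimizer. -/
structure ASMInstance extends RSMInstance where
  Y₀ : Finset (Fin m)
  d₀ : ℕ
  d₀_le : d₀ ≤ d

/-- The solutions of an instance of Anchored Submodular Minimizer. -/
def ASMInstance.IsSolution (I : ASMInstance) (X : Finset (Fin I.m)) : Prop :=
  (symmDiff X I.Y₀).card ≤ I.d₀ ∧ I.toRSMInstance.IsSolution X

/-- The input that encodes an instance of Anchored Submodular Minimizer. -/
def ASMInstance.encode (I : ASMInstance) : List ℕ :=
  [I.m, I.k, I.d, I.d₀] ++ List.ofFn (fun v : Fin I.m => if v ∈ I.Y₀ then 1 else 0) ++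
    (List.ofFn fun i => (I.rep i).encode).flatten

end RobustSubmodular

namespace RobustSubmodular

/-! ### A calculus for programs -/

/-! A compact representation is a system of constraints on pairs of elements: members of `U 0` are
required, members of `U ∞` are forbidden, and an element forces the rest of its block and the blocks
to which its edges lead. The minimizers are exactly the sets closed under these constraints
(`RepAt.closed_iff`). If `Z` is not closed, some pair `u`, `w` is violated, and every closed set
differs from `Z` in `u` or in `w`. Hence a binary search tree that starts from `Y`, flips one
element of a violated pair at each node and never flips an element back decides with at most `d`
flips whether a closed set lies within distance `d` of `Y`.

The core is a second use of this tree. Let `X` be a solution, let system `i` have no closed set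
within `d` of `Y`, and let `W` be closed for `i` with `|X ∆ W| ≤ d`. The branch that always flips
towards `W` makes `d + 1` flips, all in `Y ∆ W`, without meeting a closed set. If all of them
avoided `X ∆ Y`, they would be `d + 1` elements of `X ∆ W`. So one of them lies in `X ∆ Y`, and
flipping it in `Y` moves one step towards `X` (`exists_probe_select`). Guessing the branch and the
element costs a factor `4 ^ (d + 1)`, and `r ≤ d` repetitions find a solution if one exists within
`r` of the start (`exists_walk`). Started from `Y₀` with `r = d₀`, this is the anchored algorithm.

Without an anchor, every solution is within `d` of some minimizer of any chosen function, so the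
search is run with `r = d` from each of them. They are enumerated in colexicographic order with
polynomial delay; the successor of a set comes from closing candidate sets under the constraints
(`SatOk.next`). When it is unknown which function has few minimizers, each enumeration is cut off
after more than `q(n)` sets, and the functions are tried in turn (`tryAll_spec`).

The machine has no recursion, so a branch is coded by a number whose base four digits are the
choices, and a tree is traversed by counting. All times are powers of one number `B ≥ 100` that
majorizes the input length and `4 ^ ((d + 1) * (d + 1))`; every program level raises the exponent by
a constant. For the final `B`, a sum of `n` and a function of `d`, `bound_le` splits the power into
a factor in `d` and a power of `n`. -/

/-- `p` may write into the variable `x`. -/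
def Prog.wv : Prog → ℕ → Bool
  | .skip, _ => false
  | .assign y _, x => Nat.beq y x
  | .store _ _ _, _ => false
  | .seq p q, x => p.wv x || q.wv x
  | .ite _ p q, x => p.wv x || q.wv x
  | .while _ p, x => p.wv x

/-- `p` may write into the array `a`. -/
def Prog.wa : Prog → ℕ → Bool
  | .skip, _ => false
  | .assign _ _, _ => false
  | .store b _ _, a => Nat.beq b a
  | .seq p q, a => p.wa a || q.wa a
  | .ite _ p q, a => p.wa a || q.wa a
  | .while _ p, a => p.wa a

/-- The states `s` and `s'` agree on everything that `p` does not write. -/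
def Fr (p : Prog) (s s' : State) : Prop :=
  (∀ x, p.wv x = false → s'.var x = s.var x) ∧ ∀ a, p.wa a = false → s'.arr a = s.arr a

@[simp] theorem State.setVar_var (s : State) (x w y : ℕ) :
    (s.setVar x w).var y = if y = x then w else s.var y := by
  simp [State.setVar, Function.update_apply]

@[simp] theorem State.setVar_arr (s : State) (x w : ℕ) : (s.setVar x w).arr = s.arr := rfl

@[simp] theorem State.setArr_var (s : State) (a i w : ℕ) : (s.setArr a i w).var = s.var := rfl

@[simp] theorem State.setArr_arr (s : State) (a i w b j : ℕ) :
    (s.setArr a i w).arr b j = if b = a ∧ j = i then w else s.arr b j := by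
  by_cases hb : b = a
  · subst hb; simp [State.setArr, Function.update_apply]
  · simp [State.setArr, hb]

@[simp] theorem State.setArr_arr_of_ne (s : State) (a i w b : ℕ) (h : b ≠ a) :
    (s.setArr a i w).arr b = s.arr b := by
  simp [State.setArr, h]

theorem Fr.refl (p : Prog) (s : State) : Fr p s s := ⟨fun _ _ => rfl, fun _ _ => rfl⟩

theorem Fr.trans {p : Prog} {s s' s'' : State} (h : Fr p s s') (h' : Fr p s' s'') : Fr p s s'' :=
  ⟨fun x hx => (h'.1 x hx).trans (h.1 x hx), fun a ha => (h'.2 a ha).trans (h.2 a ha)⟩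

theorem Fr.mono {p q : Prog} {s s' : State} (h : Fr p s s')
    (hv : ∀ x, q.wv x = false → p.wv x = false) (ha : ∀ x, q.wa x = false → p.wa x = false) :
    Fr q s s' :=
  ⟨fun x hx => h.1 x (hv x hx), fun a h' => h.2 a (ha a h')⟩

/-- For a concrete program `Prog.wv` and `Prog.wa` evaluate, so later each fact about an untouched
variable or array is obtained as `hf.1 x rfl` or `hf.2 a rfl`. -/
theorem Exec.frame {p : Prog} {s s' : State} {t : ℕ} (h : Exec p s t s') : Fr p s s' := by
  induction h with
  | skip s => exact Fr.refl _ _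
  | assign x e s =>
    refine ⟨fun y hy => ?_, fun _ _ => rfl⟩
    have : ¬ y = x := by
      rintro rfl
      simp [Prog.wv] at hy
    simp [this]
  | store a e₁ e₂ s =>
    refine ⟨fun y hy => rfl, fun b hb => ?_⟩
    have : ¬ b = a := by
      rintro rfl
      simp [Prog.wa] at hb
    exact State.setArr_arr_of_ne _ _ _ _ _ this
  | seq _ _ ih ih' =>
    exact (ih.mono (by simp +contextual [Prog.wv]) (by simp +contextual [Prog.wa])).trans
      (ih'.mono (by simp +contextual [Prog.wv]) (by simp +contextual [Prog.wa]))
  | ite_true _ _ ih =>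
    exact ih.mono (by simp +contextual [Prog.wv]) (by simp +contextual [Prog.wa])
  | ite_false _ _ ih =>
    exact ih.mono (by simp +contextual [Prog.wv]) (by simp +contextual [Prog.wa])
  | while_true _ _ _ ih ih' =>
    exact (ih.mono (by simp [Prog.wv]) (by simp [Prog.wa])).trans ih'
  | while_false _ => exact Fr.refl _ _

/-- `p`, started in `s` at time `t`, halts in a state and at a time that satisfy `Q`. -/
def wp (p : Prog) (Q : State → ℕ → Prop) (s : State) (t : ℕ) : Prop :=
  ∃ t' s', Exec p s t' s' ∧ Q s' (t + t')

/-- `p`, started in `s`, halts within `T` steps in a state that satisfies `Q`. -/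
def Runs (p : Prog) (s : State) (T : ℕ) (Q : State → Prop) : Prop :=
  ∃ t s', Exec p s t s' ∧ t ≤ T ∧ Q s'

theorem Runs.of_wp {p : Prog} {s : State} {T : ℕ} {Q : State → Prop}
    (h : wp p (fun s' t => Q s' ∧ t ≤ T) s 0) : Runs p s T Q := by
  obtain ⟨t, s', h, h', h''⟩ := h
  exact ⟨t, s', h, by simpa using h'', h'⟩

theorem Runs.mono {p : Prog} {s : State} {T T' : ℕ} {Q Q' : State → Prop}
    (h : Runs p s T Q) (hT : T ≤ T') (hQ : ∀ s', Fr p s s' → Q s' → Q' s') : Runs p s T' Q' := by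
  obtain ⟨t, s', h, h', h''⟩ := h
  exact ⟨t, s', h, h'.trans hT, hQ _ h.frame h''⟩

theorem Runs.to_wp {p : Prog} {s : State} {t T : ℕ} {R : State → Prop} {Q : State → ℕ → Prop}
    (h : Runs p s T R) (hQ : ∀ s' t', Fr p s s' → R s' → t' ≤ t + T → Q s' t') : wp p Q s t := by
  obtain ⟨t', s', h, h', h''⟩ := h
  exact ⟨t', s', h, hQ _ _ h.frame h'' (by omega)⟩

theorem wp_skip (Q : State → ℕ → Prop) (s : State) (t : ℕ) (h : Q s (t + 1)) :
    wp .skip Q s t := ⟨_, _, .skip s, h⟩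

theorem wp_assign (Q : State → ℕ → Prop) (x : ℕ) (e : Expr) (s : State) (t : ℕ)
    (h : Q (s.setVar x (e.eval s)) (t + (e.cost + 1))) : wp (.assign x e) Q s t :=
  ⟨_, _, .assign x e s, h⟩

theorem wp_store (Q : State → ℕ → Prop) (a : ℕ) (e₁ e₂ : Expr) (s : State) (t : ℕ)
    (h : Q (s.setArr a (e₁.eval s) (e₂.eval s)) (t + (e₁.cost + e₂.cost + 1))) :
    wp (.store a e₁ e₂) Q s t :=
  ⟨_, _, .store a e₁ e₂ s, h⟩

theorem wp_seq (Q : State → ℕ → Prop) (p q : Prog) (s : State) (t : ℕ)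
    (h : wp p (wp q Q) s t) : wp (.seq p q) Q s t := by
  obtain ⟨t₁, s₁, h₁, t₂, s₂, h₂, h⟩ := h
  exact ⟨_, _, .seq h₁ h₂, by rwa [← Nat.add_assoc]⟩

theorem wp_ite (Q : State → ℕ → Prop) (e : Expr) (p q : Prog) (s : State) (t : ℕ)
    (h₁ : e.eval s ≠ 0 → wp p Q s (t + (e.cost + 1)))
    (h₂ : e.eval s = 0 → wp q Q s (t + (e.cost + 1))) : wp (.ite e p q) Q s t := by
  by_cases he : e.eval s = 0
  · obtain ⟨t₁, s₁, h, h'⟩ := h₂ he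
    exact ⟨_, _, .ite_false he h, by rwa [← Nat.add_assoc]⟩
  · obtain ⟨t₁, s₁, h, h'⟩ := h₁ he
    exact ⟨_, _, .ite_true he h, by rwa [← Nat.add_assoc]⟩

/-- The measure bounds the number of rounds. The body is examined only in states that agree with
`s₀` off the written locations, so invariants need not mention the data that the loop leaves alone.
-/
theorem Runs.whileLoop {e : Expr} {p : Prog} (I : State → Prop) (μ : State → ℕ) (T : ℕ) {s₀ : State}
    (h : ∀ s, Fr (.while e p) s₀ s → I s → e.eval s ≠ 0 →
      wp p (fun s' t' => (I s' ∧ μ s' < μ s) ∧ t' ≤ T) s 0) (hI : I s₀) :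
    Runs (.while e p) s₀ (μ s₀ * (T + e.cost + 1) + e.cost + 1)
      (fun s' => I s' ∧ e.eval s' = 0) := by
  suffices H : ∀ n s, μ s ≤ n → Fr (.while e p) s₀ s → I s →
      Runs (.while e p) s (n * (T + e.cost + 1) + e.cost + 1)
        (fun s' => I s' ∧ e.eval s' = 0) from H _ _ le_rfl (Fr.refl _ _) hI
  intro n
  induction n with
  | zero =>
    intro s hs hf hI
    by_cases he : e.eval s = 0
    · exact ⟨_, _, .while_false he, by omega, hI, he⟩
    · obtain ⟨t', s', _, ⟨_, h'⟩, _⟩ := h s hf hI he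
      omega
  | succ n ih =>
    intro s hs hf hI
    by_cases he : e.eval s = 0
    · exact ⟨_, _, .while_false he, by omega, hI, he⟩
    · obtain ⟨t', s', hx, ⟨hI', h'⟩, ht⟩ := h s hf hI he
      obtain ⟨t'', s'', hx', ht', hI''⟩ := ih s' (by omega)
        (hf.trans (hx.frame.mono (by simp [Prog.wv]) (by simp [Prog.wa]))) hI'
      refine ⟨_, _, .while_true he hx hx', ?_, hI''⟩
      rw [Nat.add_mul]
      omega

/-- `for x < y do p` -/
def forLoop (x y : ℕ) (p : Prog) : Prog :=
  .seq (.assign x (.lit 0)) (.while (.sub (.var y) (.var x))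
    (.seq p (.assign x (.add (.var x) (.lit 1)))))

/-- A round costs `T`, plus 4 for the increment and 4 for the test; the 6 is the initial assignment
and the last test. The invariant is required after the increment of the counter, hence the `setVar`.
-/
theorem Runs.for_loop {x y : ℕ} {p : Prog} (I : ℕ → State → Prop) (T n : ℕ) {s₀ : State}
    (hn : s₀.var y = n) (hx : p.wv x = false) (hy : p.wv y = false) (hxy : Nat.beq x y = false)
    (h0 : I 0 (s₀.setVar x 0))
    (h : ∀ i < n, ∀ s, Fr (forLoop x y p) s₀ s → s.var x = i → I i s →
      wp p (fun s' t' => I (i + 1) (s'.setVar x (i + 1)) ∧ t' ≤ T) s 0) :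
    Runs (forLoop x y p) s₀ (n * (T + 8) + 6) (fun s' => I n s') := by
  apply Runs.of_wp
  apply wp_seq
  apply wp_assign
  have hxy' : ¬ y = x := by
    rintro rfl
    simp at hxy
  refine (Runs.whileLoop (fun s => ∃ i ≤ n, s.var x = i ∧ s.var y = n ∧ I i s) (fun s => n - s.var x)
    (T + 4) ?_ ⟨0, by omega, by simp, by simp [hn, hxy'], h0⟩).to_wp ?_
  · rintro s hf ⟨i, hi, hxi, hyn, hI⟩ he
    simp only [Expr.eval, hxi, hyn] at he
    apply wp_seq
    have hf' : Fr (forLoop x y p) s₀ s := by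
      refine Fr.trans (s' := s₀.setVar x 0) ⟨fun z hz => ?_, fun _ _ => rfl⟩
        (hf.mono (fun z hz => ?_) (fun z hz => ?_))
      · have : ¬ z = x := by
          rintro rfl
          simp [forLoop, Prog.wv] at hz
        simp [this]
      · simp only [forLoop, Prog.wv, Bool.or_eq_false_iff] at hz ⊢
        exact hz.2
      · simpa [forLoop, Prog.wa] using hz
    obtain ⟨t', s', hx', h', ht⟩ := h i (by omega) s hf' hxi hI
    refine ⟨t', s', hx', ?_⟩
    apply wp_assign
    have e1 := hx'.frame.1 x hx
    have e2 := hx'.frame.1 y hy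
    simp only [Expr.eval, Expr.cost]
    refine ⟨⟨⟨i + 1, by omega, ?_, ?_, ?_⟩, ?_⟩, by omega⟩
    · simp [e1, hxi]
    · simp [hxy', e2, hyn]
    · rw [e1, hxi]; exact h'
    · simp [e1, hxi]; omega
  · rintro s' t' - ⟨⟨i, hi, hxi, hyn, hI⟩, he⟩ ht
    simp only [Expr.eval, hxi, hyn] at he
    obtain rfl : i = n := by omega
    refine ⟨hI, ht.trans ?_⟩
    simp [Expr.cost]
    apply le_of_eq
    ring

/-! ### Systems of implications -/

/-- A system of constraints on a set: elements that must belong to it, elements that must not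
belong to it, and pairs `u`, `w` such that `w` belongs to it if `u` does. -/
structure Cons where
  req : ℕ → Prop
  forb : ℕ → Prop
  imp : ℕ → ℕ → Prop

/-- The pair `u`, `w` violates the constraints on `Y`; a violated constraint on a single element
`u` appears as the pair `u`, `u`. -/
def Cons.Viol (C : Cons) (Y : Finset ℕ) (u w : ℕ) : Prop :=
  (u = w ∧ ((C.req u ∧ u ∉ Y) ∨ (C.forb u ∧ u ∈ Y))) ∨ (u ∈ Y ∧ w ∉ Y ∧ C.imp u w)

/-- The subsets of `{0, …, m - 1}` that satisfy the constraints. -/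
def Cons.Closed (C : Cons) (m : ℕ) (Y : Finset ℕ) : Prop :=
  Y ⊆ Finset.range m ∧ ∀ u < m, ∀ w < m, ¬ C.Viol Y u w

open Classical in
/-- The last pair `(u, w')` with `w' < w` and property `P`, by default `o`. -/
noncomputable def scanRow (P : ℕ → ℕ → Prop) (o : Option (ℕ × ℕ)) (u : ℕ) : ℕ → Option (ℕ × ℕ)
  | 0 => o
  | w + 1 => if P u w then some (u, w) else scanRow P o u w

/-- The last pair `(u', w)` with `u' < u`, `w < m` and property `P`. -/
noncomputable def scan (P : ℕ → ℕ → Prop) (m : ℕ) : ℕ → Option (ℕ × ℕ)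
  | 0 => none
  | u + 1 => scanRow P (scan P m u) u m

/-- Some violated pair. -/
noncomputable def Cons.viol (C : Cons) (m : ℕ) (Y : Finset ℕ) : Option (ℕ × ℕ) :=
  scan (C.Viol Y) m m

theorem scanRow_eq_some {P : ℕ → ℕ → Prop} {o : Option (ℕ × ℕ)} {u n : ℕ} {x : ℕ × ℕ}
    (h : scanRow P o u n = some x) : o = some x ∨ (x.1 = u ∧ x.2 < n ∧ P x.1 x.2) := by
  induction n with
  | zero => exact .inl h
  | succ n ih =>
    simp only [scanRow] at h
    split_ifs at h with h'
    · cases h; exact .inr ⟨rfl, by simp, h'⟩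
    · exact (ih h).imp_right fun ⟨a, b, c⟩ => ⟨a, by omega, c⟩

theorem scanRow_eq_none {P : ℕ → ℕ → Prop} {o : Option (ℕ × ℕ)} {u n : ℕ}
    (h : scanRow P o u n = none) : o = none ∧ ∀ w < n, ¬ P u w := by
  induction n with
  | zero => exact ⟨h, by simp⟩
  | succ n ih =>
    simp only [scanRow] at h
    split_ifs at h with h'
    refine ⟨(ih h).1, fun w hw => ?_⟩
    rcases Nat.lt_succ_iff_lt_or_eq.mp hw with hw | rfl
    exacts [(ih h).2 w hw, h']

theorem scan_eq_some {P : ℕ → ℕ → Prop} {m n : ℕ} {x : ℕ × ℕ} (h : scan P m n = some x) :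
    x.1 < n ∧ x.2 < m ∧ P x.1 x.2 := by
  induction n with
  | zero => simp [scan] at h
  | succ n ih =>
    rcases scanRow_eq_some h with h | ⟨a, b, c⟩
    · have := ih h
      exact ⟨by omega, this.2⟩
    · exact ⟨by omega, b, c⟩

theorem scan_eq_none {P : ℕ → ℕ → Prop} {m n : ℕ} (h : scan P m n = none) :
    ∀ u < n, ∀ w < m, ¬ P u w := by
  induction n with
  | zero => simp
  | succ n ih =>
    obtain ⟨h₁, h₂⟩ := scanRow_eq_none h
    intro u hu
    rcases Nat.lt_succ_iff_lt_or_eq.mp hu with hu | rfl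
    exacts [ih h₁ u hu, h₂]

namespace Cons

variable {C : Cons} {m : ℕ}

theorem viol_eq_some {Y : Finset ℕ} {u w : ℕ} (h : C.viol m Y = some (u, w)) :
    u < m ∧ w < m ∧ C.Viol Y u w := scan_eq_some h

theorem closed_of_viol_eq_none {Y : Finset ℕ} (hY : Y ⊆ Finset.range m)
    (h : C.viol m Y = none) : C.Closed m Y := ⟨hY, scan_eq_none h⟩

/-- Whether the pair is violated depends only on the membership of `u` and `w`. This gives the
branching factor two. -/
theorem Viol.hits {Z W : Finset ℕ} {u w : ℕ} (h : C.Viol Z u w) (hW : C.Closed m W)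
    (hu : u < m) (hw : w < m) : u ∈ symmDiff Z W ∨ w ∈ symmDiff Z W := by
  have := hW.2 u hu w hw
  simp only [Viol, Finset.mem_symmDiff] at *
  grind

/-- Enlarging `Z` can repair the pair only by adding `w`. A forbidden element of `Z` cannot be
repaired at all; in that case the hypotheses are contradictory. -/
theorem Viol.mem_of_subset {Z W : Finset ℕ} {u w : ℕ} (h : C.Viol Z u w) (hW : C.Closed m W)
    (hu : u < m) (hw : w < m) (hZ : Z ⊆ W) : w ∉ Z ∧ w ∈ W := by
  have h1 := hW.2 u hu w hw
  have h2 := @hZ u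
  have h3 := @hZ w
  simp only [Viol] at *
  grind

end Cons

/-! ### The search tree -/

/-- Simulation of a branch of a search for a closed set near `Y`: starting from `Z`, at most `n`
times an element of a violated pair is flipped. The base four digits of `x` tell which element of
the pair to flip, and whether to select it. The result is the success, the selected element and
the rest of the digits. -/
noncomputable def probe (C : Cons) (m : ℕ) (Y : Finset ℕ) :
    ℕ → ℕ → Finset ℕ → ℕ → Bool × ℕ × ℕ
  | 0, x, _, sel => (false, sel, x)
  | n + 1, x, Z, sel =>
    match C.viol m Z with
    | none => (true, sel, x)
    | some (u, w) =>
      let p := if x % 4 < 2 then u else w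
      if p ∈ symmDiff Y Z then (false, sel, x / 4)
      else probe C m Y n (x / 4) (symmDiff Z {p}) (if x % 2 = 1 then p else sel)

section probe

variable {C : Cons} {m : ℕ} {Y : Finset ℕ}

theorem symmDiff_symmDiff_singleton {Y Z : Finset ℕ} {p : ℕ} (hp : p ∉ symmDiff Y Z) :
    symmDiff Y (symmDiff Z {p}) = insert p (symmDiff Y Z) := by
  ext v
  simp only [Finset.mem_symmDiff, Finset.mem_singleton, Finset.mem_insert] at *
  grind

theorem card_symmDiff_symmDiff_singleton {Y Z : Finset ℕ} {p : ℕ} (hp : p ∉ symmDiff Y Z) :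
    (symmDiff Y (symmDiff Z {p})).card = (symmDiff Y Z).card + 1 := by
  rw [symmDiff_symmDiff_singleton hp, Finset.card_insert_of_notMem hp]

theorem symmDiff_singleton_subset_range {Z : Finset ℕ} {p : ℕ} (hZ : Z ⊆ Finset.range m)
    (hp : p < m) : symmDiff Z {p} ⊆ Finset.range m := by
  intro v hv
  simp only [Finset.mem_symmDiff, Finset.mem_singleton] at hv
  rcases hv with h | h
  · exact hZ h.1
  · simpa [h.1] using hp

/-- The `+ 1` appears because success takes one step that finds no violated pair: with `n` steps at
most `n - 1` flips precede it. -/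
theorem probe_sound {n x : ℕ} {Z : Finset ℕ} {sel : ℕ} (hZ : Z ⊆ Finset.range m)
    (h : (probe C m Y n x Z sel).1 = true) :
    ∃ W, C.Closed m W ∧ (symmDiff Y W).card + 1 ≤ (symmDiff Y Z).card + n := by
  induction n generalizing x Z sel with
  | zero => simp [probe] at h
  | succ n ih =>
    simp only [probe] at h
    split at h
    · next h' => exact ⟨Z, Cons.closed_of_viol_eq_none hZ h', by omega⟩
    · next u w h' =>
      obtain ⟨hu, hw, hv⟩ := Cons.viol_eq_some h'
      set p := if x % 4 < 2 then u else w with hp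
      have hpm : p < m := by rw [hp]; split_ifs <;> assumption
      by_cases h'' : p ∈ symmDiff Y Z
      · simp [h''] at h
      · rw [if_neg h''] at h
        obtain ⟨W, hW, hc⟩ := ih (symmDiff_singleton_subset_range hZ hpm) h
        rw [card_symmDiff_symmDiff_singleton h''] at hc
        exact ⟨W, hW, by omega⟩

theorem probe_sel_lt {n x : ℕ} {Z : Finset ℕ} {sel : ℕ} (hs : sel < m) :
    (probe C m Y n x Z sel).2.1 < m := by
  induction n generalizing x Z sel with
  | zero => simpa [probe] using hs
  | succ n ih =>
    simp only [probe]
    split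
    · exact hs
    · next u w h' =>
      obtain ⟨hu, hw, hv⟩ := Cons.viol_eq_some h'
      split_ifs <;> first | exact hs | exact ih (by assumption)

theorem probe_rest_le {n x : ℕ} {Z : Finset ℕ} {sel : ℕ} :
    (probe C m Y n x Z sel).2.2 ≤ x := by
  induction n generalizing x Z sel with
  | zero => simp [probe]
  | succ n ih =>
    simp only [probe]
    split
    · exact le_rfl
    · split_ifs <;> first | exact Nat.div_le_self _ _ | exact ih.trans (Nat.div_le_self _ _)

/-- The inclusion `Y ∆ Z ⊆ Y ∆ W` says that all flips so far went towards `W`. An element of the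
pair in which `Z` and `W` still differ has not been flipped yet, and flipping it keeps the
inclusion. -/
theorem exists_flip {Z W : Finset ℕ} {u w : ℕ} (h : C.viol m Z = some (u, w))
    (hW : C.Closed m W) (hZW : symmDiff Y Z ⊆ symmDiff Y W) :
    ∃ p, (p = u ∨ p = w) ∧ p ∉ symmDiff Y Z ∧ symmDiff Y (symmDiff Z {p}) ⊆ symmDiff Y W := by
  obtain ⟨hu, hw, hv⟩ := Cons.viol_eq_some h
  obtain ⟨p, hp, hpZW⟩ : ∃ p, (p = u ∨ p = w) ∧ p ∈ symmDiff Z W :=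
    (hv.hits hW hu hw).elim (fun h => ⟨u, .inl rfl, h⟩) (fun h => ⟨w, .inr rfl, h⟩)
  have hp' : p ∉ symmDiff Y Z := fun h' => by
    have := hZW h'
    simp only [Finset.mem_symmDiff] at *
    grind
  refine ⟨p, hp, hp', ?_⟩
  rw [symmDiff_symmDiff_singleton hp', Finset.insert_subset_iff]
  refine ⟨?_, hZW⟩
  simp only [Finset.mem_symmDiff] at *
  grind

theorem probe_succ_digit {n x t p u w : ℕ} {Z : Finset ℕ} {sel : ℕ} {b : Prop} [Decidable b]
    (h : C.viol m Z = some (u, w)) (hp : p ∉ symmDiff Y Z)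
    (htp : (if t < 2 then u else w) = p) (ht : t < 4) (hb : t % 2 = 1 ↔ b) :
    probe C m Y (n + 1) (t + 4 * x) Z sel =
      probe C m Y n x (symmDiff Z {p}) (if b then p else sel) := by
  have e1 : (t + 4 * x) % 4 = t := by omega
  have e2 : (t + 4 * x) / 4 = x := by omega
  have e3 : (t + 4 * x) % 2 = t % 2 := by omega
  simp only [probe, h, e1, e2, e3, htp, if_neg hp, hb]

theorem exists_digit {p u w : ℕ} (hp : p = u ∨ p = w) (b : Prop) :
    ∃ t < 4, (if t < 2 then u else w) = p ∧ (t % 2 = 1 ↔ b) := by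
  by_cases hb : b <;> rcases hp with rfl | rfl
  -- The digits 0 and 1 flip `u`, 2 and 3 flip `w`; an odd digit selects the flipped element.
  exacts [⟨1, by simp [hb]⟩, ⟨3, by simp [hb]⟩, ⟨0, by simp [hb]⟩, ⟨2, by simp [hb]⟩]

/-- Follow the flips towards `W`. Running out of steps would mean `d + 1` flipped elements inside `Y
∆ W`, which has at most `d`. -/
theorem exists_probe_eq_true {W : Finset ℕ} {d : ℕ} (hW : C.Closed m W)
    (hYW : (symmDiff Y W).card ≤ d) {n : ℕ} {Z : Finset ℕ} {sel : ℕ}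
    (hn : (symmDiff Y Z).card + n = d + 1) (hZW : symmDiff Y Z ⊆ symmDiff Y W) :
    ∃ x < 4 ^ n, (probe C m Y n x Z sel).1 = true := by
  induction n generalizing Z sel with
  | zero => have := Finset.card_le_card hZW; omega
  | succ n ih =>
    cases h : C.viol m Z with
    | none => exact ⟨0, by positivity, by simp [probe, h]⟩
    | some uw =>
      obtain ⟨p, hp, hp', hpW⟩ := exists_flip h hW hZW
      -- Selection plays no role in deciding nearness, so a digit that selects nothing is taken.
      obtain ⟨t, ht, htp, hb⟩ := exists_digit hp False
      obtain ⟨x, hx, hx'⟩ := ih (Z := symmDiff Z {p})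
        (sel := if False then p else sel)
        (by rw [card_symmDiff_symmDiff_singleton hp']; omega) hpW
      refine ⟨t + 4 * x, by rw [pow_succ]; omega, ?_⟩
      rwa [probe_succ_digit h hp' htp ht hb]

/-- The branch towards `W` makes `d + 1` flips in `Y ∆ W`, and these cannot all lie in `X ∆ W`, so
one of them lies in `X ∆ Y`. The digits select each flip of this kind, and the last one survives.
The number `N` is the untouched rest of the digits, available for later probes. -/
theorem exists_probe_select {W X : Finset ℕ} {d : ℕ} (hW : C.Closed m W)
    (hXW : (symmDiff X W).card ≤ d)
    (hY : ∀ W', C.Closed m W' → d < (symmDiff Y W').card) {n : ℕ} {Z : Finset ℕ} {sel : ℕ}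
    (hZ : Z ⊆ Finset.range m)
    (hn : (symmDiff Y Z).card + n = d + 1) (hZW : symmDiff Y Z ⊆ symmDiff Y W)
    (hsel : ∀ c ∈ symmDiff Y Z, c ∈ symmDiff X Y → sel ∈ symmDiff X Y) :
    ∃ x < 4 ^ n, ∃ v ∈ symmDiff X Y, ∀ N,
      (probe C m Y n (x + 4 ^ n * N) Z sel).2 = (v, N) := by
  induction n generalizing Z sel with
  | zero =>
    refine ⟨0, by simp, sel, ?_, fun N => by simp [probe]⟩
    -- If the selected element is not in `X ∆ Y`, no flipped element is; then all `d + 1` flips lie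
    -- in `X ∆ W`.
    by_contra hs
    have : symmDiff Y Z ⊆ symmDiff X W := fun c hc => by
      have h1 := hZW hc
      have h2 : c ∉ symmDiff X Y := fun h => hs (hsel c hc h)
      simp only [Finset.mem_symmDiff] at *
      grind
    have := Finset.card_le_card this
    omega
  | succ n ih =>
    cases h : C.viol m Z with
    | none =>
      -- A closed `Z` would be within `d` of `Y`, since at least one step is still left.
      have := hY Z (Cons.closed_of_viol_eq_none hZ h)
      omega
    | some uw =>
      obtain ⟨p, hp, hp', hpW⟩ := exists_flip h hW hZW
      have hpm : p < m := by
        obtain ⟨hu, hw, -⟩ := Cons.viol_eq_some h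
        rcases hp with rfl | rfl <;> assumption
      obtain ⟨t, ht, htp, hb⟩ := exists_digit hp (p ∈ symmDiff X Y)
      obtain ⟨x, hx, v, hv, hx'⟩ := ih (Z := symmDiff Z {p})
        (sel := if p ∈ symmDiff X Y then p else sel)
        (symmDiff_singleton_subset_range hZ hpm)
        (by rw [card_symmDiff_symmDiff_singleton hp']; omega) hpW (by
          intro c hc hcX
          rw [symmDiff_symmDiff_singleton hp', Finset.mem_insert] at hc
          split_ifs with hpX
          · exact hpX
          · rcases hc with rfl | hc
            · exact absurd hcX hpX
            · exact hsel c hc hcX)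
      refine ⟨t + 4 * x, by rw [pow_succ]; omega, v, hv, fun N => ?_⟩
      have e : t + 4 * x + 4 ^ (n + 1) * N = t + 4 * (x + 4 ^ n * N) := by ring
      rw [e, probe_succ_digit h hp' htp ht hb, hx']

end probe

/-- An abstract instance: a ground set `{0, …, m - 1}`, a number `k` of systems of constraints,
and a distance `d`. -/
structure Problem where
  m : ℕ
  k : ℕ
  d : ℕ
  C : ℕ → Cons

/-! ### The outer search tree: moving towards a solution. -/

namespace Problem

variable (P : Problem)

/-- There is a closed set of the `i`-th system at distance at most `d` from `Y`. -/
def Near (i : ℕ) (Y : Finset ℕ) : Prop :=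
  ∃ W, (P.C i).Closed P.m W ∧ (symmDiff Y W).card ≤ P.d

/-- The sets that are near to closed sets of all the systems. -/
def Sol (X : Finset ℕ) : Prop := X ⊆ Finset.range P.m ∧ ∀ i < P.k, P.Near i X

open Classical in
/-- The first system that has no closed set near to `Y`. -/
noncomputable def firstBad (Y : Finset ℕ) : ℕ :=
  Nat.find (p := fun i => i = P.k ∨ ¬ P.Near i Y) ⟨P.k, .inl rfl⟩

theorem firstBad_eq {Y : Finset ℕ} {i : ℕ} (h : ∀ i' < i, P.Near i' Y) (hi : i ≤ P.k)
    (h' : i = P.k ∨ ¬ P.Near i Y) : P.firstBad Y = i := by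
  classical
  rw [firstBad, Nat.find_eq_iff]
  refine ⟨h', fun n hn => ?_⟩
  push Not
  exact ⟨by omega, h n hn⟩

theorem firstBad_le (Y : Finset ℕ) : P.firstBad Y ≤ P.k := by
  classical
  exact Nat.find_min' _ (.inl rfl)

theorem near_of_firstBad_eq {Y : Finset ℕ} (h : P.firstBad Y = P.k) : ∀ i < P.k, P.Near i Y := by
  classical
  intro i hi
  by_contra h'
  have := Nat.find_min' (p := fun i => i = P.k ∨ ¬ P.Near i Y) ⟨P.k, .inl rfl⟩ (.inr h')
  rw [← firstBad, h] at this
  omega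

theorem not_near_firstBad {Y : Finset ℕ} (h : P.firstBad Y ≠ P.k) : ¬ P.Near (P.firstBad Y) Y := by
  classical
  exact (Nat.find_spec (p := fun i => i = P.k ∨ ¬ P.Near i Y) ⟨P.k, .inl rfl⟩).resolve_left h

theorem near_iff {i : ℕ} {Y : Finset ℕ} (hY : Y ⊆ Finset.range P.m) :
    P.Near i Y ↔ ∃ x < 4 ^ (P.d + 1), (probe (P.C i) P.m Y (P.d + 1) x Y 0).1 = true := by
  constructor
  · rintro ⟨W, hW, hd⟩
    exact exists_probe_eq_true hW hd (by simp) (by simp)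
  · rintro ⟨x, -, h⟩
    obtain ⟨W, hW, h⟩ := probe_sound hY h
    exact ⟨W, hW, by simpa using h⟩

/-- On the empty ground set `Y` itself is vacuously closed. Positivity of `m` is needed because 0,
the default selection of a probe, has to be an element. -/
theorem pos_of_not_near {i : ℕ} {Y : Finset ℕ} (hY : Y ⊆ Finset.range P.m) (h : ¬ P.Near i Y) :
    0 < P.m := by
  by_contra h'
  obtain h' : P.m = 0 := by omega
  exact h ⟨Y, ⟨hY, fun u hu => by omega⟩, by simp⟩

/-- Simulation of a branch of the search tree: at most `r` elements of `Y` are flipped. -/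
noncomputable def walk : ℕ → Finset ℕ → ℕ → Option (Finset ℕ)
  | 0, Y, _ => if P.firstBad Y = P.k then some Y else none
  | r + 1, Y, x =>
    if P.firstBad Y = P.k then some Y
    else
      let y := (probe (P.C (P.firstBad Y)) P.m Y (P.d + 1) x Y 0).2
      walk r (symmDiff Y {y.1}) y.2

/-- A set is returned only if no system is bad for it, so the digits do not matter for correctness;
each flip increases the distance from the start by at most one. -/
theorem walk_sound {r x : ℕ} {Y Z : Finset ℕ} (hY : Y ⊆ Finset.range P.m)
    (h : P.walk r Y x = some Z) : P.Sol Z ∧ (symmDiff Z Y).card ≤ r := by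
  induction r generalizing Y x with
  | zero =>
    simp only [walk] at h
    split_ifs at h with h'
    cases h
    exact ⟨⟨hY, P.near_of_firstBad_eq h'⟩, by simp⟩
  | succ r ih =>
    simp only [walk] at h
    split_ifs at h with h'
    · cases h
      exact ⟨⟨hY, P.near_of_firstBad_eq h'⟩, by simp⟩
    · set y := (probe (P.C (P.firstBad Y)) P.m Y (P.d + 1) x Y 0).2
      have hy : y.1 < P.m := probe_sel_lt (P.pos_of_not_near hY (P.not_near_firstBad h'))
      obtain ⟨h1, h2⟩ := ih (symmDiff_singleton_subset_range hY hy) h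
      refine ⟨h1, ?_⟩
      have : symmDiff Z Y ⊆ insert y.1 (symmDiff Z (symmDiff Y {y.1})) := fun v hv => by
        simp only [Finset.mem_symmDiff, Finset.mem_singleton, Finset.mem_insert] at *
        grind
      have := (Finset.card_le_card this).trans (Finset.card_insert_le _ _)
      omega

/-- Each bad system lets some probe select an element of `X ∆ Y`; flipping it removes it from `X ∆
Y`. After `r` flips at the latest the walk is at `X`, unless it has already stopped at another
solution. -/
theorem exists_walk {X : Finset ℕ} (hX : P.Sol X) {r : ℕ} {Y : Finset ℕ}
    (hY : Y ⊆ Finset.range P.m) (hXY : (symmDiff X Y).card ≤ r) :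
    ∃ N < 4 ^ ((P.d + 1) * r), P.walk r Y N ≠ none := by
  induction r generalizing Y with
  | zero =>
    have : X = Y := by
      rw [← symmDiff_eq_bot, Finset.bot_eq_empty, ← Finset.card_eq_zero]; omega
    subst this
    refine ⟨0, by simp, ?_⟩
    simp [walk, P.firstBad_eq (Y := X) (i := P.k) hX.2 le_rfl (.inl rfl)]
  | succ r ih =>
    by_cases h : P.firstBad Y = P.k
    · exact ⟨0, by positivity, by simp [walk, h]⟩
    have hi : P.firstBad Y < P.k := lt_of_le_of_ne (P.firstBad_le Y) h
    have hbad := P.not_near_firstBad h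
    obtain ⟨W, hW, hXW⟩ := hX.2 _ hi
    obtain ⟨x, hx, v, hv, hN⟩ := exists_probe_select (sel := 0) hW hXW (Y := Y)
      (fun W' hW' => by by_contra h'; exact hbad ⟨W', hW', by omega⟩) (n := P.d + 1) (Z := Y) hY
      (by simp) (by simp) (by simp)
    have hvm : v < P.m := by
      rw [Finset.mem_symmDiff] at hv
      exact Finset.mem_range.mp (hv.elim (fun h => hX.1 h.1) (fun h => hY h.1))
    obtain ⟨N, hNlt, hN'⟩ := ih (symmDiff_singleton_subset_range hY hvm) (by
      have : symmDiff X (symmDiff Y {v}) = (symmDiff X Y).erase v := by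
        ext c
        simp only [Finset.mem_symmDiff, Finset.mem_singleton, Finset.mem_erase] at *
        grind
      rw [this, Finset.card_erase_of_mem hv]
      omega)
    -- The `d + 1` low digits drive the present probe, and the digits of `N` drive the rest of the
    -- walk.
    refine ⟨x + 4 ^ (P.d + 1) * N, ?_, by simpa [walk, h, hN] using hN'⟩
    rw [Nat.mul_succ, Nat.add_comm ((P.d + 1) * r), pow_add 4 (P.d + 1)]
    calc x + 4 ^ (P.d + 1) * N < 4 ^ (P.d + 1) * (N + 1) := by
          rw [Nat.mul_succ, Nat.add_comm]
          exact Nat.add_lt_add_left hx _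
      _ ≤ _ := Nat.mul_le_mul_left _ hNlt

theorem walk_complete {A : Finset ℕ} {r : ℕ} (hA : A ⊆ Finset.range P.m) (hr : r ≤ P.d)
    (h : ∀ N < 4 ^ ((P.d + 1) * P.d), P.walk r A N = none) :
    ¬ ∃ X, P.Sol X ∧ (symmDiff X A).card ≤ r := by
  rintro ⟨X, hX, hXA⟩
  obtain ⟨N, hN, h'⟩ := P.exists_walk hX hA hXA
  exact h' (h N (hN.trans_le (Nat.pow_le_pow_right (by norm_num) (Nat.mul_le_mul_left _ hr))))

end Problem

/-! ### Closed sets in colexicographic order -/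

-- The witness is the largest element in which the two sets differ.
open Finset Finset.Colex in
theorem toColex_lt_iff_agree {s t : Finset ℕ} :
    toColex s < toColex t ↔ ∃ a ∈ t, a ∉ s ∧ ∀ v, a < v → (v ∈ s ↔ v ∈ t) := by
  rw [toColex_lt_toColex_iff_exists_forall_lt]
  constructor
  · rintro ⟨a, hat, has, h⟩
    have hne : (t \ s).Nonempty := ⟨a, by simp [hat, has]⟩
    have hmem := (t \ s).max'_mem hne
    rw [mem_sdiff] at hmem
    refine ⟨_, hmem.1, hmem.2, fun v hv => ⟨fun hvs => ?_, fun hvt => ?_⟩⟩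
    · by_contra hvt
      have h1 := h v hvs hvt
      have h2 := (t \ s).le_max' a (by simp [hat, has])
      omega
    · by_contra hvs
      have h2 := (t \ s).le_max' v (by simp [hvt, hvs])
      omega
  · rintro ⟨a, hat, has, h⟩
    refine ⟨a, hat, has, fun b hb hb' => ?_⟩
    by_contra hab
    rcases Nat.lt_or_eq_of_le (not_lt.mp hab) with h1 | rfl
    exacts [hb' ((h b h1).mp hb), has hb]

namespace Cons

/-- `Z` is the least closed set that contains `Z₀`, and it contains no other elements from `j`
on. -/
def SatOk (C : Cons) (m : ℕ) (Z₀ : Finset ℕ) (j : ℕ) (Z : Finset ℕ) : Prop :=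
  C.Closed m Z ∧ Z₀ ⊆ Z ∧ (∀ v ∈ Z, v ∈ Z₀ ∨ v < j) ∧ ∀ W, C.Closed m W → Z₀ ⊆ W → Z ⊆ W

/-- No closed set contains `Z₀` and no other elements from `j` on. -/
def SatFail (C : Cons) (m : ℕ) (Z₀ : Finset ℕ) (j : ℕ) : Prop :=
  ∀ W, C.Closed m W → Z₀ ⊆ W → ∃ v ∈ W, v ∉ Z₀ ∧ j ≤ v

/-- The element `j` and the elements of `E` above `j`. -/
def above (E : Finset ℕ) (j : ℕ) : Finset ℕ := insert j (E.filter (j < ·))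

theorem mem_above {E : Finset ℕ} {j v : ℕ} : v ∈ above E j ↔ v = j ∨ (v ∈ E ∧ j < v) := by
  simp [above]

/-- If `i` is in `W` and `W` agrees with `E` above `i`, then `W` contains `above E i` and nothing
else from `i` on, which is what failure at `i` excludes. -/
theorem not_lt_of_satFail {C : Cons} {m i : ℕ} {E W : Finset ℕ} (hW : C.Closed m W)
    (h : C.SatFail m (above E i) i) (hi : i ∈ W) (hEW : ∀ v, i < v → (v ∈ E ↔ v ∈ W)) :
    False := by
  obtain ⟨v, hv, hv', hiv⟩ := h W hW (fun v hv => by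
    rcases mem_above.mp hv with rfl | ⟨hv, h⟩
    exacts [hi, (hEW v h).mp hv])
  rw [mem_above] at hv'
  rcases Nat.lt_or_eq_of_le hiv with h | rfl
  · exact hv' (.inr ⟨(hEW v h).mpr hv, h⟩)
  · exact hv' (.inl rfl)

/-- Let `i` be the largest element in which a closed `W` above `E` differs from `E`. The case `i <
j` is excluded by the failures; for `i = j` minimality gives `Z ⊆ W`; for `i > j` the sets `Z` and
`E` agree from `i` on, so `W` exceeds `Z` at `i`. Thus the first `j` that succeeds yields the
successor of `E`. -/
theorem SatOk.next {C : Cons} {m j : ℕ} {E Z : Finset ℕ} (hjE : j ∉ E)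
    (h : C.SatOk m (above E j) j Z) (hlt : ∀ i < j, i ∉ E → C.SatFail m (above E i) i) :
    toColex E < toColex Z ∧
      ∀ W, C.Closed m W → toColex E < toColex W → toColex Z ≤ toColex W := by
  obtain ⟨h1, h2, h3, h4⟩ := h
  have hjZ : j ∈ Z := h2 (mem_above.mpr (.inl rfl))
  have hEZ : ∀ v, j < v → (v ∈ E ↔ v ∈ Z) := by
    refine fun v hv => ⟨fun h => h2 (mem_above.mpr (.inr ⟨h, hv⟩)), fun h => ?_⟩
    rcases h3 v h with h | h
    · rcases mem_above.mp h with rfl | h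
      · omega
      · exact h.1
    · omega
  refine ⟨toColex_lt_iff_agree.mpr ⟨j, hjZ, hjE, hEZ⟩, fun W hW hEW => ?_⟩
  obtain ⟨i, hiW, hiE, hi⟩ := toColex_lt_iff_agree.mp hEW
  rcases lt_trichotomy i j with hij | rfl | hij
  · exact (not_lt_of_satFail hW (hlt i hij hiE) hiW hi).elim
  · refine Finset.Colex.toColex_le_toColex_of_subset (h4 W hW fun v hv => ?_)
    rcases mem_above.mp hv with rfl | ⟨hv, h⟩
    exacts [hiW, (hi v h).mp hv]
  · refine (toColex_lt_iff_agree.mpr ⟨i, hiW, fun h => hiE ((hEZ i hij).mpr h), fun v hv => ?_⟩).le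
    rw [← hEZ v (hij.trans hv), hi v hv]

theorem not_lt_of_forall_satFail {C : Cons} {m : ℕ} {E : Finset ℕ}
    (hlt : ∀ i < m, i ∉ E → C.SatFail m (above E i) i) (W : Finset ℕ) (hW : C.Closed m W) :
    toColex W ≤ toColex E := by
  by_contra h
  obtain ⟨i, hiW, hiE, hi⟩ := toColex_lt_iff_agree.mp (not_le.mp h)
  exact not_lt_of_satFail hW (hlt i (Finset.mem_range.mp (hW.1 hiW)) hiE) hiW hi

end Cons

/-! ### Variables and arrays of the programs -/

notation "vM" => (1 : ℕ)
notation "vK" => (2 : ℕ)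
notation "vD" => (3 : ℕ)
notation "vR" => (4 : ℕ)
notation "vS" => (5 : ℕ)
notation "vT" => (6 : ℕ)
notation "vCi" => (7 : ℕ)
notation "vO" => (8 : ℕ)
notation "vB" => (9 : ℕ)
notation "vF" => (10 : ℕ)
notation "vU" => (11 : ℕ)
notation "vW" => (12 : ℕ)
notation "vBu" => (13 : ℕ)
notation "vBw" => (14 : ℕ)
notation "vRow" => (15 : ℕ)
notation "vC" => (16 : ℕ)
notation "vX" => (17 : ℕ)
notation "vCnt" => (18 : ℕ)
notation "vGo" => (19 : ℕ)
notation "vRes" => (20 : ℕ)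
notation "vSel" => (21 : ℕ)
notation "vP" => (22 : ℕ)
notation "vQ" => (23 : ℕ)
notation "vDig" => (24 : ℕ)
notation "vXs" => (26 : ℕ)
notation "vRem" => (27 : ℕ)
notation "vAl" => (28 : ℕ)
notation "vFound" => (29 : ℕ)
notation "vN" => (30 : ℕ)
notation "vJ" => (31 : ℕ)
notation "vOk" => (32 : ℕ)
notation "vNx" => (34 : ℕ)
notation "vV" => (35 : ℕ)
notation "vLim" => (36 : ℕ)
notation "vDec" => (37 : ℕ)
notation "vMore" => (38 : ℕ)
notation "vAns" => (39 : ℕ)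
notation "vQq" => (40 : ℕ)
notation "vI" => (41 : ℕ)
notation "vFu" => (42 : ℕ)
notation "vFw" => (43 : ℕ)
notation "vViol" => (44 : ℕ)
notation "vSi" => (45 : ℕ)
notation "aIn" => (0 : ℕ)
notation "aE" => (1 : ℕ)
notation "aY" => (2 : ℕ)
notation "aZ" => (3 : ℕ)
notation "aOff" => (4 : ℕ)

/-- The array `a` holds the characteristic vector of `Y`. -/
def IsVec (m : ℕ) (a : ℕ → ℕ) (Y : Finset ℕ) : Prop := ∀ v < m, a v = if v ∈ Y then 1 else 0

/-- The constraints given by a compact representation that is stored in `A` from the cell `o` on. -/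
def consAt (A : ℕ → ℕ) (m o : ℕ) : Cons where
  req u := A (o + 1 + u) = 0
  forb u := A o < A (o + 1 + u)
  imp u w := A (o + 1 + u) = A (o + 1 + w) ∨ A (o + 1 + u) ≤ A o ∧ A (o + 1 + w) ≤ A o ∧
    A (o + 1 + m + A (o + 1 + u) * (A o + 1) + A (o + 1 + w)) ≠ 0

/-- The memory holds the problem `P`, all relevant numbers being at most `B`. -/
structure Mem (P : Problem) (B : ℕ) (s : State) : Prop where
  hB : 100 ≤ B
  hm : s.var vM = P.m
  hk : s.var vK = P.k
  hd : s.var vD = P.d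
  hS : s.var vS = 4 ^ (P.d + 1)
  hT : s.var vT = 4 ^ ((P.d + 1) * P.d)
  hC : ∀ i < P.k, P.C i = consAt (s.arr aIn) P.m (s.arr aOff i)
  mle : P.m < B
  kle : P.k < B
  dle : P.d < B
  Sle : 4 ^ (P.d + 1) ≤ B
  Tle : 4 ^ ((P.d + 1) * P.d) ≤ B
  ble : ∀ i < P.k, ∀ u < P.m, s.arr aIn (s.arr aOff i + 1 + u) ≤ B

theorem Mem.of_eq {P : Problem} {B : ℕ} {s s' : State} (h : Mem P B s)
    (h' : s'.var vM = s.var vM ∧ s'.var vK = s.var vK ∧ s'.var vD = s.var vD ∧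
      s'.var vS = s.var vS ∧ s'.var vT = s.var vT ∧
      s'.arr aIn = s.arr aIn ∧ s'.arr aOff = s.arr aOff) :
    Mem P B s' := by
  obtain ⟨h1, h2, h3, h4, h5, h6, h7⟩ := h'
  constructor <;> (try rw [h6, h7]) <;> (try simp only [h1, h2, h3, h4, h5])
  exacts [h.hB, h.hm, h.hk, h.hd, h.hS, h.hT, h.hC, h.mle, h.kle, h.dle, h.Sle, h.Tle, h.ble]

/-- `p` does not write into the part of the memory that holds the problem. -/
def Prog.keeps (p : Prog) : Bool :=
  !(p.wv vM || p.wv vK || p.wv vD || p.wv vS || p.wv vT || p.wa aIn || p.wa aOff)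

theorem Mem.frame {P : Problem} {B : ℕ} {p : Prog} {s s' : State} (h : Mem P B s)
    (hf : Fr p s s') (hp : p.keeps = true) : Mem P B s' := by
  simp only [Prog.keeps, Bool.not_eq_true', Bool.or_eq_false_iff] at hp
  obtain ⟨⟨⟨⟨⟨⟨h1, h2⟩, h3⟩, h4⟩, h5⟩, h6⟩, h7⟩ := hp
  exact h.of_eq ⟨hf.1 _ h1, hf.1 _ h2, hf.1 _ h3, hf.1 _ h4, hf.1 _ h5, hf.2 _ h6, hf.2 _ h7⟩

/-- One factor `B` pays for the number of rounds, a second one absorbs all constants because `B ≥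
100`. -/
theorem loop_le {B n T a k : ℕ} (hB : 100 ≤ B) (hn : n ≤ B) (hT : T ≤ 2 * B ^ a) (hk : a + 2 ≤ k) :
    n * T + 100 ≤ B ^ k := by
  have h1 : n * T ≤ B * (2 * B ^ a) := Nat.mul_le_mul hn hT
  have h2 : B * 1 ≤ B * B ^ a := Nat.mul_le_mul_left _ (Nat.one_le_pow _ _ (by omega))
  have h3 : B * B ^ a * 100 ≤ B ^ (a + 2) := by
    rw [pow_add, sq, mul_comm (B ^ a), mul_assoc, mul_assoc]
    refine Nat.mul_le_mul_left _ ?_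
    rw [mul_comm B (B ^ a)]
    exact Nat.mul_le_mul_left _ hB
  have h4 : B ^ (a + 2) ≤ B ^ k := Nat.pow_le_pow_right (by omega) hk
  have h5 : B * (2 * B ^ a) = 2 * (B * B ^ a) := by ring
  omega

theorem loop_le_const {B n T k : ℕ} (hB : 100 ≤ B) (hn : n ≤ B) (hT : T ≤ 200) (hk : 3 ≤ k) :
    n * T + 100 ≤ B ^ k :=
  loop_le hB hn (a := 1) (by rw [pow_one]; omega) hk

theorem hundred_mul_pow_le {B : ℕ} (hB : 100 ≤ B) (a : ℕ) : 100 * B ^ a ≤ B ^ (a + 1) := by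
  rw [pow_succ, mul_comm]
  exact Nat.mul_le_mul_left _ hB

theorem hundred_le_pow {B : ℕ} (hB : 100 ≤ B) (a : ℕ) (ha : a ≠ 0) : 100 ≤ B ^ a :=
  hB.trans (Nat.le_self_pow ha B)

/-! ### Finding a violated pair -/

/-- Compute in `vViol` whether the pair `vU`, `vW` is violated by the set in `aZ`. -/
def testPair : Prog :=
  .seq (.assign vBw (.get aIn (.add (.add (.var vO) (.lit 1)) (.var vW)))) <|
  .seq (.assign vViol (.lit 0)) <|
  .ite (.get aZ (.var vU))
    (.ite (.get aZ (.var vW))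
      (.ite (.add (.sub (.var vU) (.var vW)) (.sub (.var vW) (.var vU))) .skip
        (.assign vViol (.sub (.var vBu) (.var vB))))
      (.ite (.add (.sub (.var vBu) (.var vBw)) (.sub (.var vBw) (.var vBu)))
        (.ite (.add (.sub (.var vBu) (.var vB)) (.sub (.var vBw) (.var vB))) .skip
          (.assign vViol (.get aIn (.add (.var vRow) (.var vBw)))))
        (.assign vViol (.lit 1))))
    (.ite (.add (.sub (.var vU) (.var vW)) (.sub (.var vW) (.var vU))) .skip
      (.assign vViol (.sub (.lit 1) (.var vBu))))

/-- Compute in `vRow` the address of the row of the adjacency matrix with index `vBu`. -/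
def findRow : Prog :=
  .seq (.assign vRow (.add (.add (.var vO) (.lit 1)) (.var vM))) <|
  .seq (.assign vC (.var vBu)) <|
  .while (.var vC) (.seq (.assign vRow (.add (.var vRow) (.add (.var vB) (.lit 1))))
    (.assign vC (.sub (.var vC) (.lit 1))))

/-- Find a pair that violates the constraints number `vCi` on the set in `aZ`. -/
def findViol : Prog :=
  .seq (.assign vO (.get aOff (.var vCi))) <|
  .seq (.assign vB (.get aIn (.var vO))) <|
  .seq (.assign vF (.lit 0)) <|
  forLoop vU vM <|
    .seq (.assign vBu (.get aIn (.add (.add (.var vO) (.lit 1)) (.var vU)))) <|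
    .seq findRow <|
    forLoop vW vM <|
      .seq testPair <|
      .ite (.var vViol)
        (.seq (.assign vF (.lit 1)) (.seq (.assign vFu (.var vU)) (.assign vFw (.var vW)))) .skip

/-- With truncated subtraction, `(x - y) + (y - x)` is nonzero iff `x ≠ y`, `vBu - vB` is nonzero
iff the block of `u` is `U ∞`, and `1 - vBu` is nonzero iff it is `U 0`. -/
theorem testPair_spec {m : ℕ} {s : State} {Z : Finset ℕ} {u w : ℕ} (hu : u < m) (hw : w < m)
    (hZ : IsVec m (s.arr aZ) Z) (hsu : s.var vU = u) (hsw : s.var vW = w)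
    (hb : s.var vB = s.arr aIn (s.var vO))
    (hbu : s.var vBu = s.arr aIn (s.var vO + 1 + u))
    (hr : s.var vRow = s.var vO + 1 + m + s.var vBu * (s.var vB + 1)) :
    Runs testPair s 60 (fun s' => s'.var vViol ≠ 0 ↔
      (consAt (s.arr aIn) m (s.var vO)).Viol Z u w) := by
  apply Runs.of_wp
  have hZu := hZ u hu
  have hZw := hZ w hw
  simp only [Cons.Viol, consAt, ← hbu, ← hb, ← hr]
  refine wp_seq _ _ _ _ _ (wp_assign _ _ _ _ _ (wp_seq _ _ _ _ _ (wp_assign _ _ _ _ _ ?_)))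
  refine wp_ite _ _ _ _ _ _ (fun h1 => ?_) (fun h1 => ?_)
  · refine wp_ite _ _ _ _ _ _ (fun h2 => ?_) (fun h2 => ?_)
    · refine wp_ite _ _ _ _ _ _ (fun h3 => wp_skip _ _ _ ?_) (fun h3 => wp_assign _ _ _ _ _ ?_) <;>
      simp_all [Expr.eval, Expr.cost] <;> grind
    · refine wp_ite _ _ _ _ _ _ (fun h3 => ?_) (fun h3 => wp_assign _ _ _ _ _ ?_)
      · refine wp_ite _ _ _ _ _ _ (fun h4 => wp_skip _ _ _ ?_)
          (fun h4 => wp_assign _ _ _ _ _ ?_) <;>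
        simp_all [Expr.eval, Expr.cost] <;> grind
      · simp_all [Expr.eval, Expr.cost]; grind
  · refine wp_ite _ _ _ _ _ _ (fun h3 => wp_skip _ _ _ ?_) (fun h3 => wp_assign _ _ _ _ _ ?_) <;>
    simp_all [Expr.eval, Expr.cost] <;> grind

theorem findRow_spec {B : ℕ} (hB : 100 ≤ B) {s : State} (h : s.var vBu ≤ B) :
    Runs findRow s (B ^ 3) (fun s' => s'.var vRow =
      s.var vO + 1 + s.var vM + s.var vBu * (s.var vB + 1)) := by
  apply Runs.of_wp
  refine wp_seq _ _ _ _ _ (wp_assign _ _ _ _ _ (wp_seq _ _ _ _ _ (wp_assign _ _ _ _ _ ?_)))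
  refine (Runs.whileLoop (fun s' => s'.var vRow + s'.var vC * (s.var vB + 1) =
      s.var vO + 1 + s.var vM + s.var vBu * (s.var vB + 1)) (fun s' => s'.var vC) 20 ?_ ?_).to_wp ?_
  · intro s₁ hf h1 hne
    have hfB := hf.1 vB rfl
    simp [Expr.eval] at hfB hne
    refine wp_seq _ _ _ _ _ (wp_assign _ _ _ _ _ (wp_assign _ _ _ _ _ ?_))
    obtain ⟨c, hc⟩ := Nat.exists_eq_succ_of_ne_zero hne
    simp only [hc, Nat.succ_mul] at h1
    simp [Expr.eval, Expr.cost, hc, hfB]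
    omega
  · simp [Expr.eval]
  · rintro s' t' - ⟨h1, h2⟩ ht
    simp [Expr.eval, Expr.cost] at h2 ht
    simp [h2] at h1
    have := loop_le_const hB h (T := 22) (k := 3) (by omega) le_rfl
    exact ⟨h1, by omega⟩

/-- The variables `vF`, `vFu`, `vFw` hold an optional pair. -/
def HoldsPair (s : State) : Option (ℕ × ℕ) → Prop
  | none => s.var vF = 0
  | some (u, w) => s.var vF = 1 ∧ s.var vFu = u ∧ s.var vFw = w

theorem HoldsPair.of_eq {s s' : State} {o : Option (ℕ × ℕ)} (h : HoldsPair s o)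
    (h' : s'.var vF = s.var vF ∧ s'.var vFu = s.var vFu ∧ s'.var vFw = s.var vFw) :
    HoldsPair s' o := by
  cases o <;> simp_all [HoldsPair]

/-- The two nested loops never stop early, and a later violated pair overwrites an earlier one;
`scan` and `scanRow` describe exactly this last pair. -/
theorem findViol_spec {P : Problem} {B i : ℕ} {s : State} {Z : Finset ℕ} (hM : Mem P B s)
    (hi : i < P.k) (hci : s.var vCi = i) (hZ : IsVec P.m (s.arr aZ) Z) :
    Runs findViol s (B ^ 6) (fun s' => HoldsPair s' ((P.C i).viol P.m Z)) := by
  have hB := hM.hB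
  apply Runs.of_wp
  refine wp_seq _ _ _ _ _ (wp_assign _ _ _ _ _ (wp_seq _ _ _ _ _ (wp_assign _ _ _ _ _
    (wp_seq _ _ _ _ _ (wp_assign _ _ _ _ _ ?_)))))
  refine (Runs.for_loop (fun u s' => HoldsPair s' (scan ((P.C i).Viol Z) P.m u)) (B ^ 4) P.m
    ?_ rfl rfl rfl ?_ ?_).to_wp ?_
  · simp [hM.hm]
  · simp [HoldsPair, scan, Expr.eval]
  · intro u hu s₁ hf hsu hh
    have hM₁ : Mem P B s₁ := Mem.frame (hM.of_eq (by simp)) hf rfl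
    have hO := hf.1 vO rfl
    have hBb := hf.1 vB rfl
    have hIn := hf.2 aIn rfl
    have hZ₁ := hf.2 aZ rfl
    simp [Expr.eval, hci] at hO hBb hIn hZ₁
    refine wp_seq _ _ _ _ _ (wp_assign _ _ _ _ _ (wp_seq _ _ _ _ _ ?_))
    refine (findRow_spec hB ?_).to_wp ?_
    · simpa [Expr.eval, hsu, hO, hIn] using hM.ble i hi u hu
    · intro s₂ t₂ hf₂ hr ht₂
      have hO₂ := hf₂.1 vO rfl
      have hB₂ := hf₂.1 vB rfl
      have hU₂ := hf₂.1 vU rfl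
      have hBu₂ := hf₂.1 vBu rfl
      have hIn₂ := hf₂.2 aIn rfl
      have hZ₂ := hf₂.2 aZ rfl
      have hM₂ : Mem P B s₂ := Mem.frame (hM₁.of_eq (by simp)) hf₂ rfl
      simp [Expr.eval, Expr.cost, hsu] at hO₂ hB₂ hU₂ hBu₂ hIn₂ hZ₂ hr ht₂
      refine (Runs.for_loop (fun w s' => HoldsPair s'
        (scanRow ((P.C i).Viol Z) (scan ((P.C i).Viol Z) P.m u) u w)) 100 P.m hM₂.hm
          rfl rfl rfl ?_ ?_).to_wp ?_
      · simp only [scanRow]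
        refine hh.of_eq ?_
        have h1 := hf₂.1 vF rfl
        have h2 := hf₂.1 vFu rfl
        have h3 := hf₂.1 vFw rfl
        simpa using ⟨h1, h2, h3⟩
      · intro w hw s₃ hf₃ hsw hh₃
        have hO₃ := hf₃.1 vO rfl
        have hB₃ := hf₃.1 vB rfl
        have hU₃ := hf₃.1 vU rfl
        have hBu₃ := hf₃.1 vBu rfl
        have hR₃ := hf₃.1 vRow rfl
        have hIn₃ := hf₃.2 aIn rfl
        have hZ₃ := hf₃.2 aZ rfl
        refine wp_seq _ _ _ _ _ ((testPair_spec (Z := Z) hu hw ?_ ?_ hsw ?_ ?_ ?_).to_wp ?_)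
        · rwa [hZ₃, hZ₂, hZ₁]
        · rw [hU₃, hU₂]
        · rw [hB₃, hB₂, hO₃, hO₂, hIn₃, hIn₂, hO, hBb, hIn]
        · rw [hBu₃, hBu₂, hIn₃, hIn₂, hO₃, hO₂]
        · rw [hR₃, hr, hBu₃, hBu₂, hO₃, hO₂, hB₃, hB₂, hM₁.hm]
        · intro s₄ t₄ hf₄ hv ht₄
          rw [hIn₃, hIn₂, hIn, hO₃, hO₂, hO, ← hM.hC i hi] at hv
          have hU₄ := hf₄.1 vU rfl
          have hW₄ := hf₄.1 vW rfl
          rw [hsw] at hW₄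
          rw [hU₃, hU₂] at hU₄
          refine wp_ite _ _ _ _ _ _ (fun h => ?_) (fun h => wp_skip _ _ _ ?_)
          · refine wp_seq _ _ _ _ _ (wp_assign _ _ _ _ _ (wp_seq _ _ _ _ _ (wp_assign _ _ _ _ _
              (wp_assign _ _ _ _ _ ?_))))
            simp [Expr.eval] at h
            simp [Expr.eval, Expr.cost, scanRow, hv.mp h, HoldsPair, hU₄, hW₄]
            omega
          · simp [Expr.eval] at h
            rw [h] at hv
            simp at hv
            refine ⟨?_, ?_⟩
            · rw [scanRow, if_neg hv]
              refine hh₃.of_eq ?_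
              have h1 := hf₄.1 vF rfl
              have h2 := hf₄.1 vFu rfl
              have h3 := hf₄.1 vFw rfl
              simpa using ⟨h1, h2, h3⟩
            · simp [Expr.cost]; omega
      · intro s₃ t₃ hf₃ h₃ ht₃
        refine ⟨?_, ?_⟩
        · rw [scan]
          exact h₃.of_eq (by simp)
        · have h1 := loop_le_const hB hM.mle.le (T := 100 + 8) (k := 3) (by omega) le_rfl
          have h2 : 100 * B ^ 3 ≤ B ^ 4 := hundred_mul_pow_le hB 3
          have h3 := hundred_le_pow hB 3 (by omega)
          omega
  · intro s₁ t₁ hf h₁ ht₁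
    have h1 := hundred_le_pow hB 4 (by omega)
    have h2 := loop_le hB hM.mle.le (T := B ^ 4 + 8) (a := 4) (k := 6) (by omega) le_rfl
    simp [Expr.cost] at ht₁
    exact ⟨h₁, by omega⟩

/-! ### The search -/

/-- Copy the array `a` to the array `b`. -/
def copyArr (a b : ℕ) : Prog := forLoop vV vM (.store b (.var vV) (.get a (.var vV)))

theorem copyArr_spec {P : Problem} {B a b : ℕ} {s : State} {Y : Finset ℕ} (hM : Mem P B s)
    (hab : Nat.beq b a = false) (hY : IsVec P.m (s.arr a) Y) :
    Runs (copyArr a b) s (B ^ 3) (fun s' => IsVec P.m (s'.arr b) Y) := by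
  have hB := hM.hB
  refine (Runs.for_loop (fun v s' => ∀ v' < v, s'.arr b v' = if v' ∈ Y then 1 else 0) 4 P.m hM.hm
    rfl rfl rfl (by simp) ?_).mono ?_ (fun s' _ h => h)
  · intro v hv s₁ hf hsv h
    have ha := hf.2 a (by simpa [forLoop, Prog.wa] using hab)
    refine wp_store _ _ _ _ _ _ ⟨fun v' hv' => ?_, by simp [Expr.cost]⟩
    have := hY v hv
    simp [Expr.eval, hsv, ha, this]
    rcases Nat.lt_succ_iff_lt_or_eq.mp hv' with h' | rfl
    · rw [if_neg (by omega), h v' h']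
    · simp
  · have := loop_le_const hB hM.mle.le (T := 4 + 8) (k := 3) (by omega) le_rfl
    omega

/-- Remove the last base four digit of `vX`. -/
def popDigit : Prog :=
  .seq (.assign vQ (.lit 0)) <|
  .seq (.while (.sub (.var vX) (.lit 3))
    (.seq (.assign vX (.sub (.var vX) (.lit 4))) (.assign vQ (.add (.var vQ) (.lit 1))))) <|
  .seq (.assign vDig (.var vX)) (.assign vX (.var vQ))

/-- Division by four is repeated subtraction, which is affordable because branch numbers are at most
`B`. -/
theorem popDigit_spec {B : ℕ} (hB : 100 ≤ B) {s : State} (h : s.var vX ≤ B) :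
    Runs popDigit s (B ^ 4) (fun s' => s'.var vDig = s.var vX % 4 ∧ s'.var vX = s.var vX / 4) := by
  apply Runs.of_wp
  refine wp_seq _ _ _ _ _ (wp_assign _ _ _ _ _ (wp_seq _ _ _ _ _ ?_))
  refine (Runs.whileLoop (fun s' => s'.var vX + 4 * s'.var vQ = s.var vX) (fun s' => s'.var vX)
    20 ?_ ?_).to_wp ?_
  · intro s₁ hf h1 hne
    simp [Expr.eval] at hne
    refine wp_seq _ _ _ _ _ (wp_assign _ _ _ _ _ (wp_assign _ _ _ _ _ ?_))
    simp [Expr.eval, Expr.cost]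
    omega
  · simp [Expr.eval]
  · rintro s' t' - ⟨h1, h2⟩ ht
    refine wp_seq _ _ _ _ _ (wp_assign _ _ _ _ _ (wp_assign _ _ _ _ _ ?_))
    simp [Expr.eval, Expr.cost] at h2 ht
    have := loop_le_const hB h (T := 24) (k := 4) (by omega) (by omega)
    simp [Expr.eval, Expr.cost]
    omega

/-- Simulate a branch of the search for a set near to the one in `aY` that is closed with respect
to the constraints number `vCi`. -/
def probeProg : Prog :=
  .seq (copyArr aY aZ) <|
  .seq (.assign vSel (.lit 0)) <|
  .seq (.assign vRes (.lit 0)) <|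
  .seq (.assign vCnt (.lit 0)) <|
  .while (.sub (.add (.var vD) (.lit 1)) (.var vCnt)) <|
    .seq findViol <|
    .ite (.var vF)
      (.seq popDigit <|
        .seq (.ite (.sub (.var vDig) (.lit 1))
          (.seq (.assign vP (.var vFw)) (.assign vDig (.sub (.var vDig) (.lit 2))))
          (.assign vP (.var vFu))) <|
        .ite (.add (.sub (.get aY (.var vP)) (.get aZ (.var vP)))
            (.sub (.get aZ (.var vP)) (.get aY (.var vP))))
          (.assign vCnt (.add (.var vD) (.lit 1)))
          (.seq (.store aZ (.var vP) (.sub (.lit 1) (.get aZ (.var vP)))) <|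
            .seq (.assign vCnt (.add (.var vCnt) (.lit 1))) <|
            .ite (.var vDig) (.assign vSel (.var vP)) .skip))
      (.seq (.assign vRes (.lit 1)) (.assign vCnt (.add (.var vD) (.lit 1))))

theorem IsVec.flip {m p : ℕ} {a b : ℕ → ℕ} {Z : Finset ℕ} (h : IsVec m a Z)
    (hb : ∀ v, b v = if v = p then 1 - a p else a v) : IsVec m b (symmDiff Z {p}) := by
  intro v hv
  rw [hb v]
  have := h v hv
  simp only [Finset.mem_symmDiff, Finset.mem_singleton]
  by_cases hvp : v = p
  · subst hvp
    by_cases hvZ : v ∈ Z <;> simp_all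
  · simp [hvp, this]

theorem mem_symmDiff_iff_of_isVec {m p : ℕ} {a b : ℕ → ℕ} {Y Z : Finset ℕ} (ha : IsVec m a Y)
    (hb : IsVec m b Z) (hp : p < m) : p ∈ symmDiff Y Z ↔ a p - b p + (b p - a p) ≠ 0 := by
  rw [ha p hp, hb p hp, Finset.mem_symmDiff]
  by_cases h1 : p ∈ Y <;> by_cases h2 : p ∈ Z <;> simp [h1, h2]

/-- The invariant says that probing from the current state with the remaining steps still has the
value `R` of the whole probe, or that `R` has already been written. The loop is left early by
setting the counter to `d + 1`. -/
theorem probeProg_spec {P : Problem} {B i x₀ : ℕ} {s : State} {Y : Finset ℕ} (hM : Mem P B s)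
    (hi : i < P.k) (hci : s.var vCi = i) (hx : s.var vX = x₀) (hxB : x₀ ≤ B)
    (hY : IsVec P.m (s.arr aY) Y) :
    Runs probeProg s (B ^ 10) (fun s' =>
      (s'.var vRes = if (probe (P.C i) P.m Y (P.d + 1) x₀ Y 0).1 = true then 1 else 0) ∧
      s'.var vSel = (probe (P.C i) P.m Y (P.d + 1) x₀ Y 0).2.1 ∧
      s'.var vX = (probe (P.C i) P.m Y (P.d + 1) x₀ Y 0).2.2) := by
  have hB := hM.hB
  generalize hR : probe (P.C i) P.m Y (P.d + 1) x₀ Y 0 = R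
  apply Runs.of_wp
  refine wp_seq _ _ _ _ _ ((copyArr_spec hM rfl hY).to_wp ?_)
  intro s₁ t₁ hf₁ hZ₁ ht₁
  have hM₁ := hM.frame hf₁ rfl
  refine wp_seq _ _ _ _ _ (wp_assign _ _ _ _ _ (wp_seq _ _ _ _ _ (wp_assign _ _ _ _ _
    (wp_seq _ _ _ _ _ (wp_assign _ _ _ _ _ ?_)))))
  have hci₁ := (hf₁.1 vCi rfl).trans hci
  have hx₁ := (hf₁.1 vX rfl).trans hx
  have hY₁ : IsVec P.m (s₁.arr aY) Y := by rwa [hf₁.2 aY rfl]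
  refine (Runs.whileLoop (fun s' => s'.var vX ≤ B ∧
    ((s'.var vCnt = P.d + 1 ∧ s'.var vRes = (if R.1 = true then 1 else 0) ∧ s'.var vSel = R.2.1 ∧
        s'.var vX = R.2.2) ∨
      ∃ n Z, s'.var vCnt + n = P.d + 1 ∧ s'.var vRes = 0 ∧ IsVec P.m (s'.arr aZ) Z ∧
        R = probe (P.C i) P.m Y n (s'.var vX) Z (s'.var vSel)))
    (fun s' => P.d + 1 - s'.var vCnt) (2 * B ^ 6) ?_ ?_).to_wp ?_
  · rintro s₂ hf₂ ⟨hx₂, h₂⟩ he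
    have hM₂ : Mem P B s₂ := Mem.frame (hM₁.of_eq (by simp)) hf₂ rfl
    have hci₂ := hf₂.1 vCi rfl
    have hY₂ := hf₂.2 aY rfl
    simp [Expr.eval, hM₂.hd, hci₁] at he hci₂ hY₂
    rw [← hY₂] at hY₁
    obtain ⟨n, Z, hn, hres, hZ₂, hR₂⟩ := h₂.resolve_left (fun h => by omega)
    obtain ⟨n, rfl⟩ : ∃ n', n = n' + 1 := ⟨n - 1, by omega⟩
    refine wp_seq _ _ _ _ _ ((findViol_spec hM₂ hi hci₂ hZ₂).to_wp ?_)
    intro s₃ t₃ hf₃ hh ht₃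
    have hM₃ := hM₂.frame hf₃ rfl
    have hx₃ := hf₃.1 vX rfl
    have hsel₃ := hf₃.1 vSel rfl
    have hres₃ := hf₃.1 vRes rfl
    have hcnt₃ := hf₃.1 vCnt rfl
    have hZ₃ : IsVec P.m (s₃.arr aZ) Z := by rwa [hf₃.2 aZ rfl]
    have hY₃ : IsVec P.m (s₃.arr aY) Y := by rwa [hf₃.2 aY rfl]
    have hb3 := loop_le_const hB hM.mle.le (T := 0) (k := 3) (by omega) le_rfl
    have hb4 : 100 * B ^ 4 ≤ B ^ 5 := hundred_mul_pow_le hB 4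
    have hb5 : 100 * B ^ 5 ≤ B ^ 6 := hundred_mul_pow_le hB 5
    have hb6 := hundred_le_pow hB 4 (by omega)
    refine wp_ite _ _ _ _ _ _ (fun h => ?_) (fun h => ?_)
    · cases hv : (P.C i).viol P.m Z with
      | none =>
        rw [hv] at hh
        simp [Expr.eval, HoldsPair] at h hh
        omega
      | some uw =>
        obtain ⟨u, w⟩ := uw
        obtain ⟨hu, hw, -⟩ := Cons.viol_eq_some hv
        rw [hv] at hh
        obtain ⟨-, hhu, hhw⟩ := hh
        refine wp_seq _ _ _ _ _ ((popDigit_spec hB (hx₃ ▸ hx₂)).to_wp ?_)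
        rintro s₄ t₄ hf₄ ⟨hdig, hx₄⟩ ht₄
        have hM₄ := hM₃.frame hf₄ rfl
        have hsel₄ := hf₄.1 vSel rfl
        have hres₄ := hf₄.1 vRes rfl
        have hcnt₄ := hf₄.1 vCnt rfl
        have hu₄ := hf₄.1 vFu rfl
        have hw₄ := hf₄.1 vFw rfl
        rw [hx₃] at hdig hx₄
        have hZ₄ : IsVec P.m (s₄.arr aZ) Z := by rwa [hf₄.2 aZ rfl]
        have hY₄ : IsVec P.m (s₄.arr aY) Y := by rwa [hf₄.2 aY rfl]
        rw [probe, hv] at hR₂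
        simp only at hR₂
        -- The common continuation for both halves of the digit range. A digit of at least 2 has
        -- been reduced by 2, so in both cases `vDig` holds the parity, which decides on selection.
        have key : ∀ s₅ : State, ∀ t₅ ≤ t₄ + 20,
            s₅.var vP = (if s₂.var vX % 4 < 2 then u else w) → s₅.var vDig = s₂.var vX % 2 →
            s₅.arr = s₄.arr → s₅.var vX = s₄.var vX → s₅.var vSel = s₄.var vSel →
            s₅.var vRes = s₄.var vRes → s₅.var vCnt = s₄.var vCnt → s₅.var vD = s₄.var vD →
            wp (.ite (.add (.sub (.get aY (.var vP)) (.get aZ (.var vP)))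
                (.sub (.get aZ (.var vP)) (.get aY (.var vP))))
              (.assign vCnt (.add (.var vD) (.lit 1)))
              (.seq (.store aZ (.var vP) (.sub (.lit 1) (.get aZ (.var vP)))) <|
                .seq (.assign vCnt (.add (.var vCnt) (.lit 1))) <|
                .ite (.var vDig) (.assign vSel (.var vP)) .skip))
              (fun s' t' => ((s'.var vX ≤ B ∧
    ((s'.var vCnt = P.d + 1 ∧ s'.var vRes = (if R.1 = true then 1 else 0) ∧ s'.var vSel = R.2.1 ∧
        s'.var vX = R.2.2) ∨
      ∃ n Z, s'.var vCnt + n = P.d + 1 ∧ s'.var vRes = 0 ∧ IsVec P.m (s'.arr aZ) Z ∧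
        R = probe (P.C i) P.m Y n (s'.var vX) Z (s'.var vSel))) ∧
        P.d + 1 - s'.var vCnt < P.d + 1 - s₂.var vCnt) ∧ t' ≤ 2 * B ^ 6) s₅ t₅ := by
          simp only [Expr.cost] at ht₄
          intro s₅ t₅ ht₅ hp hdig₅ harr hx₅ hsel₅ hres₅ hcnt₅ hd₅
          rw [← hp] at hR₂
          have hpm : s₅.var vP < P.m := by rw [hp]; split_ifs <;> assumption
          have hmem := mem_symmDiff_iff_of_isVec hY₄ hZ₄ hpm
          have hxB : s₅.var vX ≤ B := by rw [hx₅, hx₄]; omega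
          have hx₅' : s₅.var vX = s₂.var vX / 4 := by rw [hx₅, hx₄]
          refine wp_ite _ _ _ _ _ _ (fun h => ?_) (fun h => ?_)
          · simp only [Expr.eval, harr] at h
            rw [if_pos (hmem.mpr h)] at hR₂
            refine wp_assign _ _ _ _ _ ⟨⟨?_, ?_⟩, ?_⟩
            · simpa using ⟨hxB, .inl (by simp [Expr.eval, *, hM₄.hd])⟩
            · simp [Expr.eval, hd₅, hM₄.hd]; omega
            · simp [Expr.cost]; omega
          · simp only [Expr.eval, harr] at h
            rw [if_neg (fun h' => hmem.mp h' h)] at hR₂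
            refine wp_seq _ _ _ _ _ (wp_store _ _ _ _ _ _ (wp_seq _ _ _ _ _
              (wp_assign _ _ _ _ _ ?_)))
            have hvec := hZ₄.flip (p := s₅.var vP) (b := (s₅.setArr aZ (s₅.var vP)
              (1 - s₅.arr aZ (s₅.var vP))).arr aZ) (fun v => by simp [harr])
            refine wp_ite _ _ _ _ _ _ (fun h' => wp_assign _ _ _ _ _ ?_)
              (fun h' => wp_skip _ _ _ ?_)
            · simp [Expr.eval, hdig₅] at h'
              rw [if_pos h'] at hR₂
              refine ⟨⟨⟨hxB, .inr ⟨n, _, ?_, ?_, hvec, ?_⟩⟩, ?_⟩, ?_⟩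
              · simp [Expr.eval]; omega
              · simp [*]
              · simp [hR₂, Expr.eval, hx₅']
              · simp [Expr.eval]; omega
              · simp [Expr.cost]; omega
            · simp [Expr.eval, hdig₅] at h'
              rw [if_neg (by omega)] at hR₂
              refine ⟨⟨⟨hxB, .inr ⟨n, _, ?_, ?_, hvec, ?_⟩⟩, ?_⟩, ?_⟩
              · simp [Expr.eval]; omega
              · simp [*]
              · simp [hR₂, hx₅', hsel₅, hsel₄, hsel₃]
              · simp [Expr.eval]; omega
              · simp [Expr.cost]; omega
        refine wp_seq _ _ _ _ _ (wp_ite _ _ _ _ _ _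
          (fun h' => wp_seq _ _ _ _ _ (wp_assign _ _ _ _ _ (wp_assign _ _ _ _ _ ?_)))
          (fun h' => wp_assign _ _ _ _ _ ?_)) <;> simp [Expr.eval, hdig] at h'
        · apply key
          · simp [Expr.cost]
          · rw [if_neg (by omega)]
            simp [Expr.eval, hw₄, hhw]
          · simp [Expr.eval, hdig]; omega
          all_goals simp
        · apply key
          · simp [Expr.cost]
          · rw [if_pos (by omega)]
            simp [Expr.eval, hu₄, hhu]
          · simp [hdig]; omega
          all_goals simp
    · cases hv : (P.C i).viol P.m Z with
      | some uw =>
        rw [hv] at hh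
        simp [Expr.eval] at h
        have := hh.1
        omega
      | none =>
        rw [probe, hv] at hR₂
        refine wp_seq _ _ _ _ _ (wp_assign _ _ _ _ _ (wp_assign _ _ _ _ _ ?_))
        simp [Expr.eval, Expr.cost, hM₃.hd, hR₂, hx₃, hsel₃, hx₂]
        omega
  · refine ⟨by simp [hx₁, hxB], .inr ⟨P.d + 1, Y, ?_, ?_, ?_, ?_⟩⟩
    · simp [Expr.eval]
    · simp [Expr.eval]
    · simpa using hZ₁
    · simp [Expr.eval, hx₁, hR]
  · rintro s₂ t₂ hf₂ ⟨⟨hx₂, h₂⟩, he⟩ ht₂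
    have hd := hf₂.1 vD rfl
    simp [Expr.eval, hM₁.hd] at hd
    simp [Expr.eval, hd] at he
    refine ⟨?_, ?_⟩
    · rcases h₂ with h₂ | ⟨n, Z, hn, hres, hZ₂, hR₂⟩
      · exact h₂.2
      -- The counter ran out with no steps left: the probe fails, matching the initial value 0 of
      -- `vRes`.
      · obtain rfl : n = 0 := by omega
        simp [probe] at hR₂
        simp [hR₂, hres]
    · have h1 : 100 * B ^ 6 ≤ B ^ 7 := hundred_mul_pow_le hB 6
      have h2 := hundred_le_pow hB 6 (by omega)
      have h3 : 100 * B ^ 9 ≤ B ^ 10 := hundred_mul_pow_le hB 9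
      have h4 : B ^ 3 ≤ B ^ 9 := Nat.pow_le_pow_right (by omega) (by omega)
      have h5 := loop_le hB (n := P.d + 1) hM.dle (T := 2 * B ^ 6 + 5 + 1) (a := 7) (k := 9)
        (by omega) le_rfl
      simp [Expr.eval, Expr.cost] at ht₂
      omega

/-- Decide whether the set in `aY` is near to a set that is closed with respect to the constraints
number `vCi`. -/
def checkNear : Prog :=
  .seq (.assign vRes (.lit 0)) <|
  .seq (.assign vSi (.lit 0)) <|
  .while (.sub (.var vS) (.var vSi)) <|
    .seq (.assign vX (.var vSi)) <|
    .seq probeProg <|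
    .ite (.var vRes) (.assign vSi (.var vS)) (.assign vSi (.add (.var vSi) (.lit 1)))

theorem checkNear_spec {P : Problem} {B i : ℕ} {s : State} {Y : Finset ℕ} (hM : Mem P B s)
    (hi : i < P.k) (hci : s.var vCi = i) (hYm : Y ⊆ Finset.range P.m)
    (hY : IsVec P.m (s.arr aY) Y) :
    Runs checkNear s (B ^ 13) (fun s' => s'.var vRes ≠ 0 ↔ P.Near i Y) := by
  have hB := hM.hB
  rw [P.near_iff hYm]
  apply Runs.of_wp
  refine wp_seq _ _ _ _ _ (wp_assign _ _ _ _ _ (wp_seq _ _ _ _ _ (wp_assign _ _ _ _ _ ?_)))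
  have hb : 100 * B ^ 10 ≤ B ^ 11 := hundred_mul_pow_le hB 10
  have hb' := hundred_le_pow hB 10 (by omega)
  refine (Runs.whileLoop (fun s' =>
    (s'.var vSi ≤ 4 ^ (P.d + 1) ∧ s'.var vRes = 0 ∧
      ∀ x < s'.var vSi, (probe (P.C i) P.m Y (P.d + 1) x Y 0).1 ≠ true) ∨
    (s'.var vSi = 4 ^ (P.d + 1) ∧ s'.var vRes = 1 ∧
      ∃ x < 4 ^ (P.d + 1), (probe (P.C i) P.m Y (P.d + 1) x Y 0).1 = true))
    (fun s' => 4 ^ (P.d + 1) - s'.var vSi) (B ^ 10 + 20) ?_ ?_).to_wp ?_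
  · intro s₁ hf₁ h₁ he
    have hM₁ : Mem P B s₁ := Mem.frame (hM.of_eq (by simp)) hf₁ rfl
    have hci₁ := hf₁.1 vCi rfl
    have hY₁ := hf₁.2 aY rfl
    simp [hci] at hci₁ hY₁
    simp [Expr.eval, hM₁.hS, Nat.sub_eq_zero_iff_le] at he
    obtain ⟨-, hres, hx⟩ := h₁.resolve_right (fun h => by omega)
    have hSB := hM.Sle
    refine wp_seq _ _ _ _ _ (wp_assign _ _ _ _ _ (wp_seq _ _ _ _ _
      ((probeProg_spec (Y := Y) (x₀ := s₁.var vSi) (hM₁.of_eq (by simp)) hi (by simp [hci₁])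
        (by simp [Expr.eval]) (by omega) (by simpa [hY₁] using hY)).to_wp ?_)))
    rintro s₂ t₂ hf₂ ⟨hr, -, -⟩ ht₂
    have hsi := hf₂.1 vSi rfl
    have hS := hf₂.1 vS rfl
    simp [hM₁.hS] at hS hsi
    simp only [Expr.cost] at ht₂
    refine wp_ite _ _ _ _ _ _ (fun h => wp_assign _ _ _ _ _ ?_) (fun h => wp_assign _ _ _ _ _ ?_)
    · simp [Expr.eval, hr] at h
      refine ⟨⟨.inr ⟨?_, ?_, _, he, h⟩, ?_⟩, ?_⟩
      · simp [Expr.eval, hS]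
      · simp [hr, h]
      · simp [Expr.eval, hS]; omega
      · simp [Expr.cost]; omega
    · simp [Expr.eval, hr] at h
      refine ⟨⟨.inl ⟨?_, ?_, ?_⟩, ?_⟩, ?_⟩
      · simp [Expr.eval, hsi]; omega
      · simp [hr, h]
      · intro x hx'
        simp [Expr.eval, hsi] at hx'
        rcases Nat.lt_or_eq_of_le hx' with hx' | rfl
        · exact hx x hx'
        · simp [h]
      · simp [Expr.eval, hsi]; omega
      · simp [Expr.cost]; omega
  · left; simp [Expr.eval]
  · rintro s₁ t₁ hf₁ ⟨h₁, he⟩ ht₁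
    have hS := hf₁.1 vS rfl
    simp [hM.hS] at hS
    simp [Expr.eval, hS] at he
    simp [Expr.eval, Expr.cost] at ht₁
    refine ⟨?_, ?_⟩
    · rcases h₁ with ⟨h1, h2, h3⟩ | ⟨h1, h2, h3⟩
      · simp only [h2, ne_eq, not_true, false_iff, not_exists, not_and]
        intro x hx
        exact h3 x (by omega)
      · simp [h2, h3]
    · have := loop_le hB hM.Sle (T := B ^ 10 + 20 + 3 + 1) (a := 11) (k := 13)
        (by omega) le_rfl
      omega

/-- Find the first system of constraints that has no closed set near to the set in `aY`. -/
def findBad : Prog :=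
  .seq (.assign vCi (.lit 0)) <|
  .seq (.assign vGo (.lit 1)) <|
  .while (.var vGo) <|
    .ite (.sub (.var vK) (.var vCi))
      (.seq checkNear <|
        .ite (.var vRes) (.assign vCi (.add (.var vCi) (.lit 1))) (.assign vGo (.lit 0)))
      (.assign vGo (.lit 0))

theorem findBad_spec {P : Problem} {B : ℕ} {s : State} {Y : Finset ℕ} (hM : Mem P B s)
    (hYm : Y ⊆ Finset.range P.m) (hY : IsVec P.m (s.arr aY) Y) :
    Runs findBad s (B ^ 16) (fun s' => s'.var vCi = P.firstBad Y) := by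
  have hB := hM.hB
  apply Runs.of_wp
  refine wp_seq _ _ _ _ _ (wp_assign _ _ _ _ _ (wp_seq _ _ _ _ _ (wp_assign _ _ _ _ _ ?_)))
  have hb : 100 * B ^ 13 ≤ B ^ 14 := hundred_mul_pow_le hB 13
  have hb' := hundred_le_pow hB 13 (by omega)
  refine (Runs.whileLoop (fun s' => s'.var vCi ≤ P.k ∧ s'.var vGo ≤ 1 ∧
    (∀ i < s'.var vCi, P.Near i Y) ∧
    (s'.var vGo = 0 → s'.var vCi = P.k ∨ ¬ P.Near (s'.var vCi) Y))
    (fun s' => P.k - s'.var vCi + s'.var vGo) (B ^ 13 + 20) ?_ ?_).to_wp ?_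
  · rintro s₁ hf₁ ⟨h1, h2, h3, h4⟩ he
    have hM₁ : Mem P B s₁ := Mem.frame (hM.of_eq (by simp)) hf₁ rfl
    have hY₁ := hf₁.2 aY rfl
    simp at hY₁
    simp [Expr.eval] at he
    refine wp_ite _ _ _ _ _ _ (fun h => ?_) (fun h => wp_assign _ _ _ _ _ ?_)
    · simp [Expr.eval, hM₁.hk, Nat.sub_eq_zero_iff_le] at h
      refine wp_seq _ _ _ _ _ ((checkNear_spec hM₁ h rfl hYm (by simpa [hY₁] using hY)).to_wp ?_)
      intro s₂ t₂ hf₂ hr ht₂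
      have hci := hf₂.1 vCi rfl
      have hgo := hf₂.1 vGo rfl
      simp only [Expr.cost] at ht₂
      refine wp_ite _ _ _ _ _ _ (fun h => wp_assign _ _ _ _ _ ?_)
        (fun h => wp_assign _ _ _ _ _ ?_)
      · replace h := hr.mp h
        refine ⟨⟨⟨?_, ?_, ?_, ?_⟩, ?_⟩, ?_⟩
        · simp [Expr.eval, hci]; omega
        · simp [hgo, h2]
        · intro i hi
          simp [Expr.eval, hci] at hi
          rcases Nat.lt_or_eq_of_le hi with hi | rfl
          exacts [h3 i hi, h]
        · simp [hgo, he]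
        · simp [Expr.eval, hci, hgo]; omega
        · simp [Expr.cost]; omega
      · have h' : ¬ P.Near (s₁.var vCi) Y := fun h' => hr.mpr h' h
        simp [Expr.eval, Expr.cost, hci, h', h1]
        exact ⟨⟨h3, by omega⟩, by omega⟩
    · simp [Expr.eval, hM₁.hk] at h
      have : s₁.var vCi = P.k := by omega
      simp [Expr.eval, Expr.cost, this]
      exact ⟨this ▸ h3, by omega⟩
  · simp [Expr.eval]
  · rintro s₁ t₁ hf₁ ⟨⟨h1, h2, h3, h4⟩, he⟩ ht₁
    simp [Expr.eval, Expr.cost] at ht₁ he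
    refine ⟨(P.firstBad_eq h3 h1 (h4 he)).symm, ?_⟩
    have := loop_le hB (n := P.k + 1) hM.kle (T := B ^ 13 + 20 + 1 + 1) (a := 14) (k := 16)
        (by omega) le_rfl
    omega

/-- Simulate the branch number `vN` of the search tree that starts from the set in `aE`. -/
def walkProg : Prog :=
  .seq (copyArr aE aY) <|
  .seq (.assign vXs (.var vN)) <|
  .seq (.assign vRem (.var vR)) <|
  .seq (.assign vAl (.lit 1)) <|
  .seq (.assign vFound (.lit 0)) <|
  .while (.var vAl) <|
    .seq findBad <|
    .ite (.sub (.var vK) (.var vCi))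
      (.ite (.var vRem)
        (.seq (.assign vX (.var vXs)) <|
          .seq probeProg <|
          .seq (.assign vXs (.var vX)) <|
          .seq (.store aY (.var vSel) (.sub (.lit 1) (.get aY (.var vSel)))) <|
          .assign vRem (.sub (.var vRem) (.lit 1)))
        (.assign vAl (.lit 0)))
      (.seq (.assign vFound (.lit 1)) (.assign vAl (.lit 0)))

/-- Here `R` is the value of the whole walk, and the invariant equates it with the walk that
remains. The remaining digits are kept in `vXs`, since the nearness tests inside `findBad` overwrite
`vX`. -/
theorem walkProg_spec {P : Problem} {B r N : ℕ} {s : State} {A : Finset ℕ} (hM : Mem P B s)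
    (hr : s.var vR = r) (hrd : r ≤ P.d) (hN : s.var vN = N) (hNB : N ≤ B)
    (hAm : A ⊆ Finset.range P.m) (hA : IsVec P.m (s.arr aE) A) :
    Runs walkProg s (B ^ 20) (fun s' =>
      (s'.var vFound = 0 ∧ P.walk r A N = none) ∨
      (s'.var vFound = 1 ∧ ∃ Y, P.walk r A N = some Y ∧ IsVec P.m (s'.arr aY) Y)) := by
  have hB := hM.hB
  generalize hR : P.walk r A N = R
  have hb : 100 * B ^ 16 ≤ B ^ 17 := hundred_mul_pow_le hB 16
  have hb' := hundred_le_pow hB 10 (by omega)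
  have hb'' : B ^ 10 ≤ B ^ 16 := Nat.pow_le_pow_right (by omega) (by omega)
  apply Runs.of_wp
  refine wp_seq _ _ _ _ _ ((copyArr_spec hM rfl hA).to_wp ?_)
  intro s₁ t₁ hf₁ hY₁ ht₁
  have hM₁ := hM.frame hf₁ rfl
  have hN₁ := (hf₁.1 vN rfl).trans hN
  have hr₁ := (hf₁.1 vR rfl).trans hr
  refine wp_seq _ _ _ _ _ (wp_assign _ _ _ _ _ (wp_seq _ _ _ _ _ (wp_assign _ _ _ _ _
    (wp_seq _ _ _ _ _ (wp_assign _ _ _ _ _ (wp_seq _ _ _ _ _ (wp_assign _ _ _ _ _ ?_)))))))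
  refine (Runs.whileLoop (fun s' => ∃ Y ⊆ Finset.range P.m, IsVec P.m (s'.arr aY) Y ∧
    s'.var vXs ≤ B ∧
    ((s'.var vAl = 1 ∧ s'.var vFound = 0 ∧ P.walk (s'.var vRem) Y (s'.var vXs) = R) ∨
      (s'.var vAl = 0 ∧ ((s'.var vFound = 1 ∧ R = some Y) ∨ (s'.var vFound = 0 ∧ R = none)))))
    (fun s' => s'.var vRem + s'.var vAl) (2 * B ^ 16 + 40) ?_ ?_).to_wp ?_
  · rintro s₂ hf₂ ⟨Y, hYm, hY, hxB, h₂⟩ he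
    have hM₂ : Mem P B s₂ := Mem.frame (hM₁.of_eq (by simp)) hf₂ rfl
    simp [Expr.eval] at he
    obtain ⟨hal, hfound, hw⟩ := h₂.resolve_right (fun h => he h.1)
    refine wp_seq _ _ _ _ _ ((findBad_spec hM₂ hYm hY).to_wp ?_)
    intro s₃ t₃ hf₃ hci ht₃
    have hM₃ := hM₂.frame hf₃ rfl
    have hal₃ := hf₃.1 vAl rfl
    have hrem₃ := hf₃.1 vRem rfl
    have hfound₃ := hf₃.1 vFound rfl
    have hxs₃ := hf₃.1 vXs rfl
    have hY₃ : IsVec P.m (s₃.arr aY) Y := by rwa [hf₃.2 aY rfl]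
    simp only [Nat.zero_add] at ht₃
    refine wp_ite _ _ _ _ _ _ (fun h => ?_) (fun h => ?_)
    · simp [Expr.eval, hM₃.hk, hci, Nat.sub_eq_zero_iff_le] at h
      refine wp_ite _ _ _ _ _ _ (fun h' => ?_) (fun h' => wp_assign _ _ _ _ _ ?_)
      · simp [Expr.eval, hrem₃] at h'
        obtain ⟨r', hr'⟩ := Nat.exists_eq_succ_of_ne_zero h'
        rw [hr', Problem.walk, if_neg h.ne] at hw
        refine wp_seq _ _ _ _ _ (wp_assign _ _ _ _ _ (wp_seq _ _ _ _ _ ((probeProg_spec (Y := Y)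
          (x₀ := s₂.var vXs) (hM₃.of_eq (by simp)) h (by simp [hci])
          (by simp [Expr.eval, hxs₃]) hxB (by simpa using hY₃)).to_wp ?_)))
        rintro s₄ t₄ hf₄ ⟨-, hsel, hx₄⟩ ht₄
        simp only [Expr.cost] at ht₄
        have hal₄ := hf₄.1 vAl rfl
        have hrem₄ := hf₄.1 vRem rfl
        have hfound₄ := hf₄.1 vFound rfl
        have hY₄ : IsVec P.m (s₄.arr aY) Y := by rw [hf₄.2 aY rfl]; simpa using hY₃
        simp at hal₄ hrem₄ hfound₄
        refine wp_seq _ _ _ _ _ (wp_assign _ _ _ _ _ (wp_seq _ _ _ _ _ (wp_store _ _ _ _ _ _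
          (wp_assign _ _ _ _ _ ?_))))
        have hlt : s₄.var vSel < P.m := by
          rw [hsel]
          exact probe_sel_lt (P.pos_of_not_near hYm (P.not_near_firstBad h.ne))
        refine ⟨⟨⟨symmDiff Y {s₄.var vSel}, symmDiff_singleton_subset_range hYm hlt, ?_, ?_,
          .inl ⟨?_, ?_, ?_⟩⟩, ?_⟩, ?_⟩
        · exact hY₄.flip (fun v => by simp [Expr.eval])
        · simp [Expr.eval, hx₄]
          exact probe_rest_le.trans hxB
        · simp [hal₄, hal₃, hal]
        · simp [hfound₄, hfound₃, hfound]
        · simpa [Expr.eval, hrem₄, hrem₃, hr', hx₄, hsel] using hw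
        · simp [Expr.eval, hrem₄, hrem₃, hr', hal₄, hal₃]
        · simp [Expr.cost]; omega
      · simp [Expr.eval, hrem₃] at h'
        rw [h', Problem.walk, if_neg h.ne] at hw
        refine ⟨⟨⟨Y, hYm, by simpa using hY₃, by simp [hxs₃, hxB], .inr ⟨by simp [Expr.eval],
          .inr ⟨by simp [hfound₃, hfound], hw.symm⟩⟩⟩, ?_⟩, ?_⟩
        · simp [Expr.eval, hrem₃, hal]
        · simp [Expr.cost]; omega
    · simp [Expr.eval, hM₃.hk, hci, Nat.sub_eq_zero_iff_le] at h
      have h' : P.firstBad Y = P.k := le_antisymm (P.firstBad_le Y) h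
      refine wp_seq _ _ _ _ _ (wp_assign _ _ _ _ _ (wp_assign _ _ _ _ _ ?_))
      refine ⟨⟨⟨Y, hYm, by simpa using hY₃, by simp [hxs₃, hxB], .inr ⟨by simp [Expr.eval],
          .inl ⟨by simp [Expr.eval], ?_⟩⟩⟩, ?_⟩, ?_⟩
      · rw [← hw]
        cases s₂.var vRem <;> simp [Problem.walk, h']
      · simp [Expr.eval, hrem₃, hal]
      · simp [Expr.cost]; omega
  · exact ⟨A, hAm, by simpa using hY₁, by simp [Expr.eval, hN₁, hNB], .inl (by
      simp [Expr.eval, hN₁, hr₁, hR])⟩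
  · rintro s₂ t₂ hf₂ ⟨⟨Y, hYm, hY, -, h₂⟩, he⟩ ht₂
    simp [Expr.eval] at he
    refine ⟨?_, ?_⟩
    · rcases h₂ with h | ⟨-, h | h⟩
      · omega
      · exact .inr ⟨h.1, Y, h.2, hY⟩
      · exact .inl h
    · have h1 := loop_le hB (n := r + 1) (by have := hM.dle; omega) (T := 2 * B ^ 16 + 40 + 1 + 1)
        (a := 17) (k := 19) (by omega) le_rfl
      have h2 : 100 * B ^ 19 ≤ B ^ 20 := hundred_mul_pow_le hB 19
      have h3 : B ^ 3 ≤ B ^ 19 := Nat.pow_le_pow_right (by omega) (by omega)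
      simp [Expr.eval, Expr.cost, hr₁] at ht₂
      omega

/-- Search for a solution at distance at most `vR` from the set in `aE`. -/
def searchProg : Prog :=
  .seq (.assign vN (.lit 0)) <|
  .seq (.assign vFound (.lit 0)) <|
  .while (.sub (.var vT) (.var vN)) <|
    .seq walkProg <|
    .ite (.var vFound) (.assign vN (.var vT)) (.assign vN (.add (.var vN) (.lit 1)))

theorem searchProg_spec {P : Problem} {B r : ℕ} {s : State} {A : Finset ℕ} (hM : Mem P B s)
    (hr : s.var vR = r) (hrd : r ≤ P.d)
    (hAm : A ⊆ Finset.range P.m) (hA : IsVec P.m (s.arr aE) A) :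
    Runs searchProg s (B ^ 23) (fun s' =>
      (s'.var vFound = 0 ∧ ¬ ∃ X, P.Sol X ∧ (symmDiff X A).card ≤ r) ∨
      (s'.var vFound = 1 ∧
        ∃ X, P.Sol X ∧ (symmDiff X A).card ≤ r ∧ IsVec P.m (s'.arr aY) X)) := by
  have hB := hM.hB
  have hb : 100 * B ^ 20 ≤ B ^ 21 := hundred_mul_pow_le hB 20
  have hb' := hundred_le_pow hB 20 (by omega)
  have hTB := hM.Tle
  apply Runs.of_wp
  refine wp_seq _ _ _ _ _ (wp_assign _ _ _ _ _ (wp_seq _ _ _ _ _ (wp_assign _ _ _ _ _ ?_)))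
  refine (Runs.whileLoop (fun s' =>
    (s'.var vFound = 0 ∧ s'.var vN ≤ 4 ^ ((P.d + 1) * P.d) ∧
      ∀ N < s'.var vN, P.walk r A N = none) ∨
    (s'.var vFound = 1 ∧ s'.var vN = 4 ^ ((P.d + 1) * P.d) ∧
        ∃ X, P.Sol X ∧ (symmDiff X A).card ≤ r ∧ IsVec P.m (s'.arr aY) X))
    (fun s' => 4 ^ ((P.d + 1) * P.d) - s'.var vN) (B ^ 20 + 20) ?_ ?_).to_wp ?_
  · intro s₁ hf₁ h₁ he
    have hM₁ : Mem P B s₁ := Mem.frame (hM.of_eq (by simp)) hf₁ rfl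
    have hr₁ := hf₁.1 vR rfl
    have hA₁ := hf₁.2 aE rfl
    simp [hr] at hr₁ hA₁
    simp [Expr.eval, hM₁.hT] at he
    obtain ⟨hfound, -, hx⟩ := h₁.resolve_right (fun h => by omega)
    refine wp_seq _ _ _ _ _ ((walkProg_spec hM₁ hr₁ hrd rfl (by omega) hAm (hA₁ ▸ hA)).to_wp ?_)
    intro s₂ t₂ hf₂ h₂ ht₂
    have hN := hf₂.1 vN rfl
    have hT := hf₂.1 vT rfl
    rw [hM₁.hT] at hT
    refine wp_ite _ _ _ _ _ _ (fun h => wp_assign _ _ _ _ _ ?_) (fun h => wp_assign _ _ _ _ _ ?_)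
    · obtain ⟨hf, Y, hY, hYv⟩ := h₂.resolve_left (fun h' => h h'.1)
      obtain ⟨h3, h4⟩ := P.walk_sound hAm hY
      refine ⟨⟨.inr ⟨by simpa using hf, by simp [Expr.eval, hT], Y, h3, h4, by simpa using hYv⟩,
        ?_⟩, ?_⟩
      · simp [Expr.eval, hT]; omega
      · simp [Expr.cost]; omega
    · simp only [Expr.eval] at h
      obtain ⟨hf, hw⟩ := h₂.resolve_right (fun h' => by omega)
      refine ⟨⟨.inl ⟨by simpa using hf, ?_, ?_⟩, ?_⟩, ?_⟩
      · simp [Expr.eval, hN]; omega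
      · intro N hN'
        simp [Expr.eval, hN] at hN'
        rcases Nat.lt_or_eq_of_le hN' with hN' | rfl
        exacts [hx N hN', hw]
      · simp [Expr.eval, hN]; omega
      · simp [Expr.cost]; omega
  · left; simp [Expr.eval]
  · rintro s₁ t₁ hf₁ ⟨h₁, he⟩ ht₁
    have hT := hf₁.1 vT rfl
    simp [hM.hT] at hT
    simp [Expr.eval, hT] at he
    simp [Expr.eval, Expr.cost] at ht₁
    refine ⟨?_, ?_⟩
    · rcases h₁ with ⟨h1, h2, h3⟩ | ⟨h1, h2, h3⟩
      · exact .inl ⟨h1, P.walk_complete hAm hrd fun N hN => h3 N (by omega)⟩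
      · exact .inr ⟨h1, h3⟩
    · have := loop_le hB hM.Tle (T := B ^ 20 + 20 + 3 + 1) (a := 21) (k := 23)
        (by omega) le_rfl
      omega

/-! ### Enumeration of closed sets -/

theorem IsVec.insert {m p : ℕ} {a b : ℕ → ℕ} {Z : Finset ℕ} (h : IsVec m a Z)
    (hb : ∀ v, b v = if v = p then 1 else a v) : IsVec m b (insert p Z) := by
  intro v hv
  rw [hb v]
  by_cases hvp : v = p
  · simp [hvp]
  · simp [hvp, h v hv]

/-- The set with characteristic vector `a`. -/
def vecSet (m : ℕ) (a : ℕ → ℕ) : Finset ℕ := (Finset.range m).filter (fun v => a v ≠ 0)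

theorem IsVec.vecSet_eq {m : ℕ} {a : ℕ → ℕ} {Z : Finset ℕ} (h : IsVec m a Z)
    (hZ : Z ⊆ Finset.range m) : vecSet m a = Z := by
  ext v
  simp only [vecSet, Finset.mem_filter, Finset.mem_range]
  refine ⟨fun ⟨h1, h2⟩ => ?_, fun h' => ?_⟩
  · rw [h v h1] at h2
    simpa using h2
  · have := Finset.mem_range.mp (hZ h')
    exact ⟨this, by simp [h v this, h']⟩

/-- Extend the set in `aZ` to the least set that is closed with respect to the constraints number
`vCi`, as long as this adds no elements from `vJ` on. -/
def satProg : Prog :=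
  .seq (.assign vOk (.lit 1)) <|
  .seq (.assign vGo (.lit 1)) <|
  .while (.var vGo) <|
    .seq findViol <|
    .ite (.var vF)
      (.ite (.add (.get aZ (.var vFw)) (.sub (.add (.var vFw) (.lit 1)) (.var vJ)))
        (.seq (.assign vOk (.lit 0)) (.assign vGo (.lit 0)))
        (.store aZ (.var vFw) (.lit 1)))
      (.assign vGo (.lit 0))

/-- Only forced elements are added, so `Z` stays inside every closed superset of `Z₀`. The program
gives up if `w ∈ Z`, when a forbidden element is present and no closed superset exists, or if `w + 1
- j` is nonzero, that is `j ≤ w`. -/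
theorem satProg_spec {P : Problem} {B i j : ℕ} {s : State} {Z₀ : Finset ℕ} (hM : Mem P B s)
    (hi : i < P.k) (hci : s.var vCi = i) (hj : s.var vJ = j) (hZ₀m : Z₀ ⊆ Finset.range P.m)
    (hZ₀ : IsVec P.m (s.arr aZ) Z₀) :
    Runs satProg s (B ^ 9) (fun s' =>
      (s'.var vOk = 1 ∧ ∃ Z, (P.C i).SatOk P.m Z₀ j Z ∧ IsVec P.m (s'.arr aZ) Z) ∨
      (s'.var vOk = 0 ∧ (P.C i).SatFail P.m Z₀ j)) := by
  have hB := hM.hB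
  have hb : 100 * B ^ 6 ≤ B ^ 7 := hundred_mul_pow_le hB 6
  have hb' := hundred_le_pow hB 6 (by omega)
  apply Runs.of_wp
  refine wp_seq _ _ _ _ _ (wp_assign _ _ _ _ _ (wp_seq _ _ _ _ _ (wp_assign _ _ _ _ _ ?_)))
  refine (Runs.whileLoop (fun s' => ∃ Z ⊆ Finset.range P.m, IsVec P.m (s'.arr aZ) Z ∧ Z₀ ⊆ Z ∧
    (∀ v ∈ Z, v ∈ Z₀ ∨ v < j) ∧ (∀ W, (P.C i).Closed P.m W → Z₀ ⊆ W → Z ⊆ W) ∧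
    ((s'.var vGo = 1 ∧ s'.var vOk = 1) ∨
      (s'.var vGo = 0 ∧ s'.var vOk = 1 ∧ (P.C i).Closed P.m Z) ∨
      (s'.var vGo = 0 ∧ s'.var vOk = 0 ∧ (P.C i).SatFail P.m Z₀ j)))
    -- The measure must be a function of the state, so the set is read off the array; in the
    -- invariant it is only quantified existentially.
    (fun s' => (Finset.range P.m \ vecSet P.m (s'.arr aZ)).card + s'.var vGo)
    (B ^ 6 + 40) ?_ ?_).to_wp ?_
  · rintro s₁ hf₁ ⟨Z, hZm, hZ, hZ₀Z, hZj, hmin, h₁⟩ he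
    have hM₁ : Mem P B s₁ := Mem.frame (hM.of_eq (by simp)) hf₁ rfl
    have hci₁ := hf₁.1 vCi rfl
    have hj₁ := hf₁.1 vJ rfl
    simp [Expr.eval, hci, hj] at he hci₁ hj₁
    obtain ⟨hgo, hok⟩ := h₁.resolve_right (fun h => by omega)
    refine wp_seq _ _ _ _ _ ((findViol_spec hM₁ hi hci₁ hZ).to_wp ?_)
    intro s₂ t₂ hf₂ hh ht₂
    have hM₂ := hM₁.frame hf₂ rfl
    have hgo₂ := (hf₂.1 vGo rfl).trans hgo
    have hok₂ := (hf₂.1 vOk rfl).trans hok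
    have hj₂ := (hf₂.1 vJ rfl).trans hj₁
    have hZ₂ : IsVec P.m (s₂.arr aZ) Z := by rwa [hf₂.2 aZ rfl]
    have hvec := hZ.vecSet_eq hZm
    have hvec₂ := hZ₂.vecSet_eq hZm
    refine wp_ite _ _ _ _ _ _ (fun h => ?_) (fun h => wp_assign _ _ _ _ _ ?_)
    · cases hv : (P.C i).viol P.m Z with
      | none =>
        rw [hv] at hh
        exact absurd hh h
      | some uw =>
        obtain ⟨u, w⟩ := uw
        rw [hv] at hh
        obtain ⟨-, -, hw⟩ := hh
        obtain ⟨hum, hwm, hviol⟩ := Cons.viol_eq_some hv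
        refine wp_ite _ _ _ _ _ _ (fun h' => wp_seq _ _ _ _ _ (wp_assign _ _ _ _ _
          (wp_assign _ _ _ _ _ ?_))) (fun h' => wp_store _ _ _ _ _ _ ?_)
        · refine ⟨⟨⟨Z, hZm, by simpa using hZ₂, hZ₀Z, hZj, hmin, .inr (.inr ⟨by simp [Expr.eval],
            by simp [Expr.eval], ?_⟩)⟩, ?_⟩, ?_⟩
          · intro W hW hZW
            obtain ⟨h1, h2⟩ := hviol.mem_of_subset hW hum hwm (hmin W hW hZW)
            simp [Expr.eval, hw, hj₂, hZ₂ w hwm, h1] at h'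
            exact ⟨w, h2, fun h => h1 (hZ₀Z h), by omega⟩
          · simp [Expr.eval, hvec, hvec₂, hgo]
          · simp [Expr.cost] at ht₂ ⊢; omega
        · simp [Expr.eval, hw, hj₂, hZ₂ w hwm] at h'
          have hins := hZ₂.insert (p := w) (b := (s₂.setArr aZ w 1).arr aZ) (fun v => by simp)
          have hsub : insert w Z ⊆ Finset.range P.m :=
            Finset.insert_subset (Finset.mem_range.mpr hwm) hZm
          simp only [Expr.eval, hw]
          refine ⟨⟨⟨insert w Z, hsub, hins, hZ₀Z.trans (Finset.subset_insert _ _), ?_, ?_,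
            .inl ⟨hgo₂, hok₂⟩⟩, ?_⟩, ?_⟩
          · intro v hv
            rcases Finset.mem_insert.mp hv with rfl | hv
            · exact .inr (by omega)
            · exact hZj v hv
          · intro W hW hZW
            have := hmin W hW hZW
            exact Finset.insert_subset (hviol.mem_of_subset hW hum hwm this).2 this
          · rw [hins.vecSet_eq hsub, hvec]
            simp only [State.setArr_var, hgo₂, hgo]
            refine Nat.add_lt_add_right (Finset.card_lt_card ?_) 1
            rw [Finset.ssubset_iff_of_subset
              (Finset.sdiff_subset_sdiff le_rfl (Finset.subset_insert _ _))]
            exact ⟨w, by simp [hwm, h'.1], by simp⟩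
          · simp [Expr.cost] at ht₂ ⊢; omega
    · cases hv : (P.C i).viol P.m Z with
      | some uw =>
        rw [hv] at hh
        simp [Expr.eval] at h
        have := hh.1
        omega
      | none =>
        refine ⟨⟨⟨Z, hZm, by simpa using hZ₂, hZ₀Z, hZj, hmin, .inr (.inl ⟨by simp [Expr.eval],
            by simpa using hok₂, Cons.closed_of_viol_eq_none hZm hv⟩)⟩, ?_⟩, ?_⟩
        · simp [Expr.eval, hvec, hvec₂, hgo]
        · simp [Expr.cost] at ht₂ ⊢; omega
  · exact ⟨Z₀, hZ₀m, by simpa using hZ₀, le_rfl, fun v hv => .inl hv, fun W _ h => h,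
      .inl (by simp [Expr.eval])⟩
  · rintro s₁ t₁ hf₁ ⟨⟨Z, hZm, hZ, hZ₀Z, hZj, hmin, h₁⟩, he⟩ ht₁
    simp [Expr.eval] at he
    refine ⟨?_, ?_⟩
    · rcases h₁ with h₁ | h₁ | h₁
      · omega
      · exact .inl ⟨h₁.2.1, Z, ⟨h₁.2.2, hZ₀Z, hZj, hmin⟩, hZ⟩
      · exact .inr h₁.2
    · have hc : (Finset.range P.m \ vecSet P.m (s.arr aZ)).card ≤ P.m :=
        (Finset.card_le_card Finset.sdiff_subset).trans (by simp)
      have hmB := hM.mle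
      have := loop_le hB (n := (Finset.range P.m \ vecSet P.m (s.arr aZ)).card + 1)
        (T := B ^ 6 + 40 + 1 + 1) (a := 7) (k := 9) (by omega) (by omega) le_rfl
      simp [Expr.cost, Expr.eval] at ht₁
      omega

/-- Write the element `vJ` and the elements above it of the set in `aE` into `aZ`. -/
def aboveProg : Prog :=
  forLoop vV vM <|
    .ite (.sub (.var vJ) (.var vV)) (.store aZ (.var vV) (.lit 0)) <|
    .ite (.sub (.var vV) (.var vJ)) (.store aZ (.var vV) (.get aE (.var vV)))
      (.store aZ (.var vV) (.lit 1))

theorem aboveProg_spec {P : Problem} {B j : ℕ} {s : State} {E : Finset ℕ} (hM : Mem P B s)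
    (hj : s.var vJ = j) (hE : IsVec P.m (s.arr aE) E) :
    Runs aboveProg s (B ^ 3) (fun s' => IsVec P.m (s'.arr aZ) (Cons.above E j)) := by
  have hB := hM.hB
  refine (Runs.for_loop (fun v s' => ∀ v' < v, s'.arr aZ v' = if v' ∈ Cons.above E j then 1 else 0)
    40 P.m hM.hm rfl rfl rfl (by simp) ?_).mono ?_ (fun s' _ h => h)
  · intro v hv s₁ hf hsv h
    have hE₁ := hf.2 aE rfl
    have hj₁ := (hf.1 vJ rfl).trans hj
    have hEv := hE v hv
    refine wp_ite _ _ _ _ _ _ (fun h1 => wp_store _ _ _ _ _ _ ⟨fun v' hv' => ?_, ?_⟩)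
      (fun h1 => wp_ite _ _ _ _ _ _ (fun h2 => wp_store _ _ _ _ _ _ ⟨fun v' hv' => ?_, ?_⟩)
        (fun h2 => wp_store _ _ _ _ _ _ ⟨fun v' hv' => ?_, ?_⟩))
    any_goals simp [Expr.cost]
    all_goals
      simp [Expr.eval, hsv, hj₁] at h1
      try simp [Expr.eval, hsv, hj₁] at h2
      rcases Nat.lt_succ_iff_lt_or_eq.mp hv' with h' | rfl
      · simp [Expr.eval, hsv]
        rw [if_neg (by omega), h v' h']
      · simp [Expr.eval, hsv, hE₁, hEv, Cons.mem_above]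
        try grind
  · have := loop_le_const hB hM.mle.le (T := 40 + 8) (k := 3) (by omega) le_rfl
    omega

/-- Replace the set in `aE` by the next set, in colexicographic order, that is closed with respect
to the constraints number `vCi`. -/
def nextProg : Prog :=
  .seq (.assign vNx (.lit 0)) <|
  .seq (.assign vJ (.lit 0)) <|
  .while (.sub (.var vM) (.var vJ)) <|
    .ite (.get aE (.var vJ))
      (.assign vJ (.add (.var vJ) (.lit 1)))
      (.seq aboveProg <|
        .seq satProg <|
        .ite (.var vOk)
          (.seq (copyArr aZ aE) <| .seq (.assign vNx (.lit 1)) (.assign vJ (.var vM)))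
          (.assign vJ (.add (.var vJ) (.lit 1))))

theorem nextProg_spec {P : Problem} {B i : ℕ} {s : State} {E : Finset ℕ} (hM : Mem P B s)
    (hi : i < P.k) (hci : s.var vCi = i) (hEm : E ⊆ Finset.range P.m)
    (hE : IsVec P.m (s.arr aE) E) :
    Runs nextProg s (B ^ 12) (fun s' =>
      (s'.var vNx = 1 ∧ ∃ Z, (P.C i).Closed P.m Z ∧ IsVec P.m (s'.arr aE) Z ∧
        toColex E < toColex Z ∧
        ∀ W, (P.C i).Closed P.m W → toColex E < toColex W → toColex Z ≤ toColex W) ∨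
      (s'.var vNx = 0 ∧ ∀ W, (P.C i).Closed P.m W → toColex W ≤ toColex E)) := by
  have hB := hM.hB
  have hb : 100 * B ^ 9 ≤ B ^ 10 := hundred_mul_pow_le hB 9
  have hb' := hundred_le_pow hB 9 (by omega)
  have hb'' : B ^ 3 ≤ B ^ 9 := Nat.pow_le_pow_right (by omega) (by omega)
  apply Runs.of_wp
  refine wp_seq _ _ _ _ _ (wp_assign _ _ _ _ _ (wp_seq _ _ _ _ _ (wp_assign _ _ _ _ _ ?_)))
  refine (Runs.whileLoop (fun s' =>
    (s'.var vNx = 1 ∧ s'.var vJ = P.m ∧ ∃ Z, (P.C i).Closed P.m Z ∧ IsVec P.m (s'.arr aE) Z ∧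
        toColex E < toColex Z ∧
        ∀ W, (P.C i).Closed P.m W → toColex E < toColex W → toColex Z ≤ toColex W) ∨
    (s'.var vNx = 0 ∧ IsVec P.m (s'.arr aE) E ∧ s'.var vJ ≤ P.m ∧
      ∀ j < s'.var vJ, j ∉ E → (P.C i).SatFail P.m (Cons.above E j) j))
    (fun s' => P.m - s'.var vJ) (4 * B ^ 9) ?_ ?_).to_wp ?_
  · intro s₁ hf₁ h₁ he
    have hM₁ : Mem P B s₁ := Mem.frame (hM.of_eq (by simp)) hf₁ rfl
    have hci₁ := hf₁.1 vCi rfl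
    simp [Expr.eval, hci, hM₁.hm, Nat.sub_eq_zero_iff_le] at he hci₁
    obtain ⟨hnx, hE₁, -, hfail⟩ := h₁.resolve_left (fun h => by omega)
    have hEj := hE₁ _ he
    refine wp_ite _ _ _ _ _ _ (fun h => wp_assign _ _ _ _ _ ?_) (fun h => ?_)
    · simp [Expr.eval, hEj] at h
      refine ⟨⟨.inr ⟨by simpa using hnx, by simpa using hE₁, ?_, ?_⟩, ?_⟩, ?_⟩
      · simp [Expr.eval]; omega
      · intro j hj hjE
        simp [Expr.eval] at hj
        rcases Nat.lt_or_eq_of_le hj with hj | rfl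
        exacts [hfail j hj hjE, absurd h hjE]
      · simp [Expr.eval]; omega
      · simp [Expr.cost]; omega
    · simp [Expr.eval, hEj] at h
      have hab : Cons.above E (s₁.var vJ) ⊆ Finset.range P.m := fun v hv => by
        rcases Cons.mem_above.mp hv with rfl | hv
        exacts [Finset.mem_range.mpr he, hEm hv.1]
      refine wp_seq _ _ _ _ _ ((aboveProg_spec hM₁ rfl hE₁).to_wp ?_)
      intro s₂ t₂ hf₂ hZ₂ ht₂
      have hM₂ := hM₁.frame hf₂ rfl
      refine wp_seq _ _ _ _ _ ((satProg_spec hM₂ hi ((hf₂.1 vCi rfl).trans hci₁)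
        (hf₂.1 vJ rfl) hab hZ₂).to_wp ?_)
      intro s₃ t₃ hf₃ h₃ ht₃
      have hM₃ := hM₂.frame hf₃ rfl
      have hj₃ := (hf₃.1 vJ rfl).trans (hf₂.1 vJ rfl)
      have hnx₃ := (hf₃.1 vNx rfl).trans (hf₂.1 vNx rfl)
      have hE₃ := (hf₃.2 aE rfl).trans (hf₂.2 aE rfl)
      simp only [Expr.cost] at ht₂
      refine wp_ite _ _ _ _ _ _ (fun h' => ?_) (fun h' => wp_assign _ _ _ _ _ ?_)
      · obtain ⟨-, Z, hZ, hZv⟩ := h₃.resolve_right (fun h'' => h' h''.1)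
        refine wp_seq _ _ _ _ _ ((copyArr_spec hM₃ rfl hZv).to_wp ?_)
        intro s₄ t₄ hf₄ hE₄ ht₄
        have hM₄ := hM₃.frame hf₄ rfl
        simp only [Expr.cost] at ht₄
        refine wp_seq _ _ _ _ _ (wp_assign _ _ _ _ _ (wp_assign _ _ _ _ _ ?_))
        refine ⟨⟨.inl ⟨by simp [Expr.eval], by simp [Expr.eval, hM₄.hm], Z, hZ.1, by simpa using hE₄,
          hZ.next h hfail⟩, ?_⟩, ?_⟩
        · simp [Expr.eval, hM₄.hm]; omega
        · simp [Expr.cost]; omega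
      · have h'' := (h₃.resolve_left (fun h'' => by simp [Expr.eval] at h'; omega)).2
        refine ⟨⟨.inr ⟨by simpa [hnx₃] using hnx, by simpa [hE₃] using hE₁, ?_, ?_⟩, ?_⟩, ?_⟩
        · simp [Expr.eval, hj₃]; omega
        · intro j hj hjE
          simp [Expr.eval, hj₃] at hj
          rcases Nat.lt_or_eq_of_le hj with hj | rfl
          exacts [hfail j hj hjE, h'']
        · simp [Expr.eval, hj₃]; omega
        · simp [Expr.cost]; omega
  · exact .inr ⟨by simp [Expr.eval], by simpa using hE, by simp [Expr.eval], by simp [Expr.eval]⟩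
  · rintro s₁ t₁ hf₁ ⟨h₁, he⟩ ht₁
    have hm := hf₁.1 vM rfl
    simp [hM.hm] at hm
    simp [Expr.eval, hm, Nat.sub_eq_zero_iff_le] at he
    refine ⟨?_, ?_⟩
    · rcases h₁ with h₁ | h₁
      · exact .inl ⟨h₁.1, h₁.2.2⟩
      · exact .inr ⟨h₁.1, Cons.not_lt_of_forall_satFail fun j hj => h₁.2.2.2 j (by omega)⟩
    · have := loop_le hB hM.mle.le (T := 4 * B ^ 9 + 3 + 1) (a := 10) (k := 12) (by omega) le_rfl
      simp [Expr.cost, Expr.eval] at ht₁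
      omega

open Classical in
/-- The family of the closed sets. -/
noncomputable def Cons.closedSets (C : Cons) (m : ℕ) : Finset (Finset ℕ) :=
  (Finset.range m).powerset.filter (C.Closed m)

theorem Cons.mem_closedSets {C : Cons} {m : ℕ} {W : Finset ℕ} :
    W ∈ C.closedSets m ↔ C.Closed m W := by
  simp only [closedSets, Finset.mem_filter, Finset.mem_powerset, and_iff_right_iff_imp]
  exact fun h => h.1

/-- Write the least set that is closed with respect to the constraints number `vI` into `aE`. -/
def firstProg : Prog :=
  .seq (forLoop vV vM (.store aZ (.var vV) (.lit 0))) <|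
  .seq (.assign vCi (.var vI)) <|
  .seq (.assign vJ (.var vM)) <|
  .seq satProg <|
  copyArr aZ aE

/-- Closing the empty set with `j = m` puts no limit on the added elements, so it fails only if
there is no closed set. The closure is the least closed set for inclusion, hence also in
colexicographic order. -/
theorem firstProg_spec {P : Problem} {B i : ℕ} {s : State} (hM : Mem P B s)
    (hi : i < P.k) (hI : s.var vI = i) (hne : ∃ W, (P.C i).Closed P.m W) :
    Runs firstProg s (B ^ 10) (fun s' => ∃ Z, (P.C i).Closed P.m Z ∧ IsVec P.m (s'.arr aE) Z ∧
      ∀ W, (P.C i).Closed P.m W → toColex Z ≤ toColex W) := by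
  have hB := hM.hB
  have hb : 100 * B ^ 9 ≤ B ^ 10 := hundred_mul_pow_le hB 9
  have hb' := hundred_le_pow hB 9 (by omega)
  have hb'' : B ^ 3 ≤ B ^ 9 := Nat.pow_le_pow_right (by omega) (by omega)
  apply Runs.of_wp
  refine wp_seq _ _ _ _ _ ((Runs.for_loop (fun v s' => ∀ v' < v, s'.arr aZ v' = 0) 3 P.m hM.hm
    rfl rfl rfl (by simp) ?_).to_wp ?_)
  · intro v hv s₁ hf hsv h
    refine wp_store _ _ _ _ _ _ ⟨fun v' hv' => ?_, by simp [Expr.cost]⟩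
    simp [Expr.eval, hsv]
    rcases Nat.lt_succ_iff_lt_or_eq.mp hv' with h' | rfl
    · exact fun _ => h v' h'
    · simp
  · intro s₁ t₁ hf₁ hz ht₁
    have hM₁ := hM.frame hf₁ rfl
    have hI₁ := (hf₁.1 vI rfl).trans hI
    refine wp_seq _ _ _ _ _ (wp_assign _ _ _ _ _ (wp_seq _ _ _ _ _ (wp_assign _ _ _ _ _ ?_)))
    refine wp_seq _ _ _ _ _ ((satProg_spec (hM₁.of_eq (by simp)) hi (by simp [Expr.eval, hI₁])
      (j := P.m) (by simp [Expr.eval, hM₁.hm]) (Z₀ := ∅) (by simp)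
      (fun v hv => by simp [hz v hv])).to_wp ?_)
    intro s₂ t₂ hf₂ h₂ ht₂
    have hM₂ : Mem P B s₂ := Mem.frame (hM₁.of_eq (by simp)) hf₂ rfl
    rcases h₂ with ⟨-, Z, hZ, hZv⟩ | ⟨-, h⟩
    · refine (copyArr_spec hM₂ rfl hZv).to_wp ?_
      intro s₃ t₃ hf₃ hE ht₃
      refine ⟨⟨Z, hZ.1, hE, fun W hW => Finset.Colex.toColex_le_toColex_of_subset
        (hZ.2.2.2 W hW (by simp))⟩, ?_⟩
      have := loop_le_const hB hM.mle.le (T := 3 + 8) (k := 9) (by omega) (by omega)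
      simp [Expr.cost] at ht₂
      omega
    · obtain ⟨W, hW⟩ := hne
      obtain ⟨v, hv, -, h'⟩ := h W hW (by simp)
      have := Finset.mem_range.mp (hW.1 hv)
      omega

/-- Search for a solution near to a set that is closed with respect to the constraints number
`vI`. If `vDec` is not zero, give up after `vQq` such sets. -/
def enumProg : Prog :=
  .seq firstProg <|
  .seq (.assign vLim (.var vQq)) <|
  .seq (.assign vMore (.lit 1)) <|
  .seq (.assign vAns (.lit 2)) <|
  .while (.var vMore) <|
    .seq searchProg <|
    .ite (.var vFound)
      (.seq (.assign vAns (.lit 1)) (.assign vMore (.lit 0)))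
      (.seq (.assign vLim (.sub (.var vLim) (.var vDec))) <|
        .ite (.var vLim)
          (.seq (.assign vCi (.var vI)) <|
            .seq nextProg <|
            .ite (.var vNx) .skip (.seq (.assign vAns (.lit 0)) (.assign vMore (.lit 0))))
          (.assign vMore (.lit 0)))

/-- Every solution is within `d` of a closed set of system `i`, so failing to find one near any of
these sets refutes all solutions. The answer 2 means that the enumeration was cut off, which
certifies at least `Q` closed sets. If `dec = 0` the positive limit never decreases, so no cut-off
happens. -/
theorem enumProg_spec {P : Problem} {B i M Q dec : ℕ} {s : State} (hM : Mem P B s)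
    (hi : i < P.k) (hI : s.var vI = i) (hr : s.var vR = P.d)
    (hne : ∃ W, (P.C i).Closed P.m W) (hQ : s.var vQq = Q) (hQ0 : 0 < Q)
    (hdec : s.var vDec = dec) (hdec1 : dec ≤ 1) (hM0 : 0 < M)
    (hMM : ((P.C i).closedSets P.m).card ≤ M ∨ (dec = 1 ∧ Q ≤ M)) :
    Runs enumProg s (M * B ^ 25) (fun s' =>
      (s'.var vAns = 1 ∧ ∃ X, P.Sol X ∧ IsVec P.m (s'.arr aY) X) ∨
      (s'.var vAns = 0 ∧ ¬ ∃ X, P.Sol X) ∨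
      (s'.var vAns = 2 ∧ dec = 1 ∧ Q ≤ ((P.C i).closedSets P.m).card)) := by
  have hB := hM.hB
  set cs := (P.C i).closedSets P.m with hcs
  have hmem : ∀ W, W ∈ cs ↔ (P.C i).Closed P.m W := fun W => Cons.mem_closedSets
  let rest (E : Finset ℕ) : Finset (Finset ℕ) := cs.filter (fun W => toColex E ≤ toColex W)
  let done (E : Finset ℕ) : Finset (Finset ℕ) := cs.filter (fun W => toColex W < toColex E)
  let num (s' : State) : ℕ := (rest (vecSet P.m (s'.arr aE))).card
  let μ (s' : State) : ℕ := if s'.var vMore = 0 then 0 else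
    min (num s') (if dec = 1 then s'.var vLim else num s')
  let Inv (s' : State) : Prop :=
    (s'.var vMore = 1 ∧ s'.var vAns = 2 ∧ 0 < s'.var vLim ∧ ∃ E, (P.C i).Closed P.m E ∧
      IsVec P.m (s'.arr aE) E ∧ s'.var vLim + dec * (done E).card = Q ∧
      ∀ W ∈ done E, ¬ ∃ X, P.Sol X ∧ (symmDiff X W).card ≤ P.d) ∨
    (s'.var vMore = 0 ∧ (
      (s'.var vAns = 1 ∧ ∃ X, P.Sol X ∧ IsVec P.m (s'.arr aY) X) ∨
      (s'.var vAns = 0 ∧ ¬ ∃ X, P.Sol X) ∨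
      (s'.var vAns = 2 ∧ dec = 1 ∧ Q ≤ cs.card)))
  have hb : 100 * B ^ 23 ≤ B ^ 24 := hundred_mul_pow_le hB 23
  have hb1 : 100 * B ^ 24 ≤ B ^ 25 := hundred_mul_pow_le hB 24
  have hb' := hundred_le_pow hB 23 (by omega)
  have hb'' : B ^ 12 ≤ B ^ 23 := Nat.pow_le_pow_right (by omega) (by omega)
  have hb3 : B ^ 10 ≤ B ^ 23 := Nat.pow_le_pow_right (by omega) (by omega)
  apply Runs.of_wp
  refine wp_seq _ _ _ _ _ ((firstProg_spec hM hi hI hne).to_wp ?_)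
  rintro s₁ t₁ hf₁ ⟨E₀, hE₀, hE₀v, hE₀min⟩ ht₁
  have hM₁ := hM.frame hf₁ rfl
  have hI₁ := (hf₁.1 vI rfl).trans hI
  have hr₁ := (hf₁.1 vR rfl).trans hr
  have hQ₁ := (hf₁.1 vQq rfl).trans hQ
  have hdec₁ := (hf₁.1 vDec rfl).trans hdec
  refine wp_seq _ _ _ _ _ (wp_assign _ _ _ _ _ (wp_seq _ _ _ _ _ (wp_assign _ _ _ _ _
    (wp_seq _ _ _ _ _ (wp_assign _ _ _ _ _ ?_)))))
  refine (Runs.whileLoop Inv μ (4 * B ^ 23) ?_ ?_).to_wp ?_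
  · intro s₂ hf₂ h₂ he
    have hM₂ : Mem P B s₂ := Mem.frame (hM₁.of_eq (by simp)) hf₂ rfl
    have hI₂ := hf₂.1 vI rfl
    have hr₂ := hf₂.1 vR rfl
    have hdec₂ := hf₂.1 vDec rfl
    simp [hI₁, hr₁, hdec₁] at hI₂ hr₂ hdec₂
    simp [Expr.eval] at he
    obtain ⟨hmore, hans, hlim, E, hE, hEv, hcount, hfail⟩ := h₂.resolve_right (fun h => he h.1)
    have hEself : E ∈ rest E := Finset.mem_filter.mpr ⟨(hmem E).mpr hE, le_rfl⟩
    have hnum : num s₂ = (rest E).card := by simp only [num, hEv.vecSet_eq hE.1]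
    have hnum_pos : 0 < (rest E).card := Finset.card_pos.mpr ⟨E, hEself⟩
    have hμpos : 0 < μ s₂ := by
      simp only [μ, hmore, hnum]
      rw [if_neg (by omega)]
      refine lt_min hnum_pos ?_
      split_ifs <;> assumption
    refine wp_seq _ _ _ _ _ ((searchProg_spec hM₂ hr₂ le_rfl hE.1 hEv).to_wp ?_)
    intro s₃ t₃ hf₃ h₃ ht₃
    have hM₃ := hM₂.frame hf₃ rfl
    have hI₃ := (hf₃.1 vI rfl).trans hI₂
    have hdec₃ := (hf₃.1 vDec rfl).trans hdec₂
    have hlim₃ := hf₃.1 vLim rfl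
    have hmore₃ := (hf₃.1 vMore rfl).trans hmore
    have hans₃ := (hf₃.1 vAns rfl).trans hans
    have hE₃ : IsVec P.m (s₃.arr aE) E := by rwa [hf₃.2 aE rfl]
    refine wp_ite _ _ _ _ _ _ (fun h => ?_) (fun h => ?_)
    · obtain ⟨-, X, hX, -, hXv⟩ := h₃.resolve_left (fun h' => h h'.1)
      refine wp_seq _ _ _ _ _ (wp_assign _ _ _ _ _ (wp_assign _ _ _ _ _ ?_))
      refine ⟨⟨.inr ⟨by simp [Expr.eval], .inl ⟨by simp [Expr.eval], X, hX, by simpa using hXv⟩⟩,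
        ?_⟩, ?_⟩
      · simpa [μ, Expr.eval] using hμpos
      · simp [Expr.cost]; omega
    · simp only [Expr.eval] at h
      obtain ⟨-, hno⟩ := h₃.resolve_right (fun h' => by omega)
      refine wp_seq _ _ _ _ _ (wp_assign _ _ _ _ _ ?_)
      refine wp_ite _ _ _ _ _ _ (fun h' => wp_seq _ _ _ _ _ (wp_assign _ _ _ _ _ ?_))
        (fun h' => wp_assign _ _ _ _ _ ?_)
      · simp [Expr.eval, hlim₃, hdec₃, Nat.sub_eq_zero_iff_le] at h'
        refine wp_seq _ _ _ _ _ ((nextProg_spec (hM₃.of_eq (by simp)) hi (by simp [Expr.eval, hI₃])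
          hE.1 (by simpa using hE₃)).to_wp ?_)
        intro s₄ t₄ hf₄ h₄ ht₄
        have hlim₄ := hf₄.1 vLim rfl
        have hmore₄ := hf₄.1 vMore rfl
        have hans₄ := hf₄.1 vAns rfl
        simp [Expr.eval, hlim₃, hdec₃, hmore₃, hans₃] at hlim₄ hmore₄ hans₄
        simp only [Expr.cost] at ht₄
        refine wp_ite _ _ _ _ _ _ (fun h5 => wp_skip _ _ _ ?_)
          (fun h5 => wp_seq _ _ _ _ _ (wp_assign _ _ _ _ _ (wp_assign _ _ _ _ _ ?_)))
        · obtain ⟨-, Z, hZ, hZv, hEZ, hmin⟩ := h₄.resolve_right (fun h6 => h5 h6.1)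
          have hdone : done Z = insert E (done E) := by
            ext W
            simp only [done, Finset.mem_filter, Finset.mem_insert]
            constructor
            · rintro ⟨h6, h7⟩
              rcases lt_trichotomy (toColex W) (toColex E) with h8 | h8 | h8
              · exact .inr ⟨h6, h8⟩
              · exact .inl (by simpa using h8)
              · exact absurd h7 (not_lt.mpr (hmin W ((hmem W).mp h6) h8))
            · rintro (rfl | h6)
              · exact ⟨(hmem _).mpr hE, hEZ⟩
              · exact ⟨h6.1, h6.2.trans hEZ⟩
          have hEdone : E ∉ done E := by simp [done]
          have hlt : (rest Z).card < (rest E).card := by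
            refine Finset.card_lt_card ((Finset.ssubset_iff_of_subset ?_).mpr ⟨E, hEself, ?_⟩)
            · intro W hW
              simp only [rest, Finset.mem_filter] at hW ⊢
              exact ⟨hW.1, hEZ.le.trans hW.2⟩
            · simp [rest, hEZ]
          refine ⟨⟨.inl ⟨hmore₄, hans₄, by omega, Z, hZ, hZv, ?_, ?_⟩, ?_⟩, ?_⟩
          · rw [hdone, Finset.card_insert_of_notMem hEdone, hlim₄, Nat.mul_succ]
            omega
          · rw [hdone]
            intro W hW
            rcases Finset.mem_insert.mp hW with rfl | hW
            exacts [hno, hfail W hW]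
          · simp only [μ, hmore₄, hmore, hnum, hlim₄]
            have hnum₄ : num s₄ = (rest Z).card := by simp only [num, hZv.vecSet_eq hZ.1]
            rw [hnum₄]
            by_cases hd : dec = 1
            · simp only [hd, if_true]; simp; omega
            · simp only [hd, if_false]; simp; omega
          · simp [Expr.cost]; omega
        · simp only [Expr.eval] at h5
          obtain ⟨-, hlast⟩ := h₄.resolve_left (fun h6 => by omega)
          refine ⟨⟨.inr ⟨by simp [Expr.eval], .inr (.inl ⟨by simp [Expr.eval], ?_⟩)⟩, ?_⟩, ?_⟩
          · rintro ⟨X, hX⟩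
            obtain ⟨W, hW, hXW⟩ := hX.2 i hi
            rcases (hlast W hW).lt_or_eq with h6 | h6
            · exact hfail W (Finset.mem_filter.mpr ⟨(hmem W).mpr hW, h6⟩) ⟨X, hX, hXW⟩
            · obtain rfl : W = E := by simpa using h6
              exact hno ⟨X, hX, hXW⟩
          · simpa [μ, Expr.eval] using hμpos
          · simp [Expr.cost]; omega
      · simp [Expr.eval, hlim₃, hdec₃, Nat.sub_eq_zero_iff_le] at h'
        have hd : dec = 1 := by omega
        refine ⟨⟨.inr ⟨by simp [Expr.eval], .inr (.inr ⟨by simpa using hans₃, hd, ?_⟩)⟩, ?_⟩, ?_⟩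
        -- At the cut-off `Q - 1` sets precede `E`, and `E` itself makes `Q`.
        · have h6 : (done E).card + (rest E).card = cs.card := by
            have := Finset.card_filter_add_card_filter_not (s := cs)
              (fun W => toColex W < toColex E)
            simpa only [done, rest, not_lt] using this
          rw [hd, one_mul] at hcount
          omega
        · simpa [μ, Expr.eval] using hμpos
        · simp [Expr.cost]; omega
  · refine .inl ⟨by simp [Expr.eval], by simp [Expr.eval], by simpa [Expr.eval, hQ₁] using hQ0,
      E₀, hE₀, by simpa using hE₀v, ?_, ?_⟩
    · have : done E₀ = ∅ := by
        rw [Finset.filter_eq_empty_iff]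
        exact fun W hW => not_lt.mpr (hE₀min W ((hmem W).mp hW))
      simp [Expr.eval, hQ₁, this]
    · intro W hW
      rw [Finset.mem_filter] at hW
      exact absurd hW.2 (not_lt.mpr (hE₀min W ((hmem W).mp hW.1)))
  · rintro s₂ t₂ hf₂ ⟨h₂, he⟩ ht₂
    simp only [Expr.eval] at he
    refine ⟨(h₂.resolve_left (fun h => by omega)).2, ?_⟩
    generalize hs : ((s₁.setVar vLim ((Expr.var vQq).eval s₁)).setVar vMore _).setVar vAns _ = s₃
      at ht₂
    have hμM : μ s₃ ≤ M := by
      simp only [μ]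
      split_ifs with h1 h2
      · omega
      · rcases hMM with h | h
        · exact (min_le_left _ _).trans ((Finset.card_filter_le _ _).trans h)
        · refine (min_le_right _ _).trans ?_
          rw [← hs]
          simpa [Expr.eval, hQ₁] using h.2
      · rcases hMM with h | h
        · exact (min_le_left _ _).trans ((Finset.card_filter_le _ _).trans h)
        · omega
    have h1 : μ s₃ * (4 * B ^ 23 + 1 + 1) ≤ M * B ^ 24 := Nat.mul_le_mul hμM (by omega)
    have h2 : M * (100 * B ^ 24) ≤ M * B ^ 25 := Nat.mul_le_mul_left _ hb1
    have h3 : 1 * B ^ 24 ≤ M * B ^ 24 := Nat.mul_le_mul_right _ hM0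
    have h4 : M * (100 * B ^ 24) = 100 * (M * B ^ 24) := by ring
    simp only [Expr.cost] at ht₂
    omega

/-- Try the systems of constraints one after the other, until the question is decided. -/
def tryAll : Prog :=
  .seq (.assign vI (.lit 0)) <|
  .seq (.assign vAns (.lit 2)) <|
  .while (.sub (.var vK) (.var vI)) <|
    .seq enumProg <|
    .ite (.sub (.lit 2) (.var vAns)) (.assign vI (.var vK)) (.assign vI (.add (.var vI) (.lit 1)))

/-- A cut-off at system `i` would give it at least `Q` closed sets. So `vI` never passes `i`
undecided, although the program does not know `i`. Without cut-off the first system decides, hence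
`i = 0` there. -/
theorem tryAll_spec {P : Problem} {B i M Q dec : ℕ} {s : State} (hM : Mem P B s)
    (hi : i < P.k) (hr : s.var vR = P.d)
    (hne : ∀ i < P.k, ∃ W, (P.C i).Closed P.m W) (hQ : s.var vQq = Q) (hQ0 : 0 < Q)
    (hdec : s.var vDec = dec) (hM0 : 0 < M)
    (hMM : (dec = 0 ∧ i = 0 ∧ ((P.C i).closedSets P.m).card ≤ M) ∨
      (dec = 1 ∧ Q ≤ M ∧ ((P.C i).closedSets P.m).card < Q)) :
    Runs tryAll s (M * B ^ 28) (fun s' =>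
      (s'.var vAns = 1 ∧ ∃ X, P.Sol X ∧ IsVec P.m (s'.arr aY) X) ∨
      (s'.var vAns = 0 ∧ ¬ ∃ X, P.Sol X)) := by
  have hB := hM.hB
  have hb : 100 * B ^ 25 ≤ B ^ 26 := hundred_mul_pow_le hB 25
  have hb' := hundred_le_pow hB 25 (by omega)
  have hMB : 100 * (M * B ^ 25) ≤ M * B ^ 26 :=
    le_trans (le_of_eq (by ring)) (Nat.mul_le_mul_left M hb)
  have hMB' : 1 * B ^ 25 ≤ M * B ^ 25 := Nat.mul_le_mul_right _ hM0
  apply Runs.of_wp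
  refine wp_seq _ _ _ _ _ (wp_assign _ _ _ _ _ (wp_seq _ _ _ _ _ (wp_assign _ _ _ _ _ ?_)))
  refine (Runs.whileLoop (fun s' => (s'.var vAns = 2 ∧ s'.var vI ≤ i) ∨
      (s'.var vI = P.k ∧ ((s'.var vAns = 1 ∧ ∃ X, P.Sol X ∧ IsVec P.m (s'.arr aY) X) ∨
        (s'.var vAns = 0 ∧ ¬ ∃ X, P.Sol X)))) (fun s' => P.k - s'.var vI)
        (M * B ^ 25 + 40) ?_ ?_).to_wp ?_
  · intro s₁ hf₁ h₁ he
    have hM₁ : Mem P B s₁ := Mem.frame (hM.of_eq (by simp)) hf₁ rfl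
    have hr₁ := hf₁.1 vR rfl
    have hdec₁ := hf₁.1 vDec rfl
    have hQ₁ := hf₁.1 vQq rfl
    simp [hr, hdec, hQ] at hr₁ hdec₁ hQ₁
    simp [Expr.eval, hM₁.hk, Nat.sub_eq_zero_iff_le] at he
    obtain ⟨hans, hIi⟩ := h₁.resolve_right (fun h => by omega)
    refine wp_seq _ _ _ _ _ ((enumProg_spec (M := M) hM₁ he rfl hr₁ (hne _ he) hQ₁ hQ0 hdec₁
      (by omega) hM0 ?_).to_wp ?_)
    · rcases hMM with ⟨-, h1, h2⟩ | ⟨h1, h2, h3⟩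
      · left
        rwa [show s₁.var vI = i by omega]
      · exact .inr ⟨h1, h2⟩
    intro s₂ t₂ hf₂ h₂ ht₂
    have hM₂ := hM₁.frame hf₂ rfl
    have hI₂ := hf₂.1 vI rfl
    refine wp_ite _ _ _ _ _ _ (fun h => wp_assign _ _ _ _ _ ?_) (fun h => wp_assign _ _ _ _ _ ?_)
    · simp [Expr.eval, Nat.sub_eq_zero_iff_le] at h
      refine ⟨⟨.inr ⟨by simp [Expr.eval, hM₂.hk], ?_⟩, ?_⟩, ?_⟩
      · rcases h₂ with h₂ | h₂ | h₂
        · exact .inl (by simpa using h₂)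
        · exact .inr (by simpa using h₂)
        · omega
      · simp [Expr.eval, hM₂.hk]; omega
      · simp [Expr.cost]; omega
    · simp [Expr.eval, Nat.sub_eq_zero_iff_le] at h
      obtain ⟨h1, h2, h3⟩ : s₂.var vAns = 2 ∧ dec = 1 ∧
          Q ≤ ((P.C (s₁.var vI)).closedSets P.m).card := by
        rcases h₂ with h₂ | h₂ | h₂
        · omega
        · omega
        · exact h₂
      have hne' : s₁.var vI ≠ i := by
        rintro h'
        rw [h'] at h3
        omega
      refine ⟨⟨.inl ⟨by simpa using h1, ?_⟩, ?_⟩, ?_⟩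
      · simp [Expr.eval, hI₂]; omega
      · simp [Expr.eval, hI₂]; omega
      · simp [Expr.cost]; omega
  · left; simp [Expr.eval]
  · rintro s₁ t₁ hf₁ ⟨h₁, he⟩ ht₁
    have hk := hf₁.1 vK rfl
    simp [hM.hk] at hk
    simp [Expr.eval, hk, Nat.sub_eq_zero_iff_le] at he
    refine ⟨(h₁.resolve_left (fun h => by omega)).2, ?_⟩
    simp [Expr.cost, Expr.eval] at ht₁
    have h1 : P.k * (M * B ^ 25 + 40 + 3 + 1) ≤ B * (M * B ^ 26) :=
      Nat.mul_le_mul hM.kle.le (by omega)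
    have h2 : B * (M * B ^ 26) = M * B ^ 27 := by ring
    have h3 : 100 * (M * B ^ 27) ≤ M * B ^ 28 :=
      le_trans (le_of_eq (by ring)) (Nat.mul_le_mul_left M (hundred_mul_pow_le hB 27))
    have h4 : M * B ^ 26 ≤ M * B ^ 27 :=
      Nat.mul_le_mul_left M (Nat.pow_le_pow_right (by omega) (by omega))
    omega

/-! ### Reading the input -/

/-- The address of the representation number `i`, if the first one is at the address `o`. -/
def offAt (A : ℕ → ℕ) (m o : ℕ) : ℕ → ℕ
  | 0 => o
  | i + 1 => offAt A m o i + 1 + m + (A (offAt A m o i) + 1) * (A (offAt A m o i) + 1)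

/-- Compute the addresses of the representations; the address of the first one is in `vO`. -/
def offsetsProg : Prog :=
  forLoop vI vK <|
    .seq (.store aOff (.var vI) (.var vO)) <|
    .seq (.assign vB (.add (.get aIn (.var vO)) (.lit 1))) <|
    .seq (.assign vO (.add (.add (.var vO) (.lit 1)) (.var vM))) <|
    forLoop vV vB (.assign vO (.add (.var vO) (.var vB)))

/-- Skipping a representation requires the square of `b + 1`, the size of its matrix; the inner loop
adds `b + 1` that many times. -/
theorem offsetsProg_spec {B m k o : ℕ} {s : State} {A : ℕ → ℕ} (hB : 100 ≤ B) (hk : s.var vK = k)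
    (hkB : k ≤ B) (hm : s.var vM = m) (hA : s.arr aIn = A) (ho : s.var vO = o)
    (hb : ∀ i < k, A (offAt A m o i) + 1 ≤ B) :
    Runs offsetsProg s (B ^ 6) (fun s' => ∀ i < k, s'.arr aOff i = offAt A m o i) := by
  have hb1 := hundred_le_pow hB 3 (by omega)
  have hb2 : 100 * B ^ 3 ≤ B ^ 4 := hundred_mul_pow_le hB 3
  refine (Runs.for_loop (fun i s' => s'.var vO = offAt A m o i ∧
    ∀ i' < i, s'.arr aOff i' = offAt A m o i') (2 * B ^ 3) k hk rfl rfl rfl ?_ ?_).mono ?_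
    (fun s' _ h => h.2)
  · simp [offAt, ho]
  · rintro i hi s₁ hf₁ hsi ⟨hO, hoff⟩
    have hA₁ := (hf₁.2 aIn rfl).trans hA
    have hm₁ := (hf₁.1 vM rfl).trans hm
    refine wp_seq _ _ _ _ _ (wp_store _ _ _ _ _ _ (wp_seq _ _ _ _ _ (wp_assign _ _ _ _ _
      (wp_seq _ _ _ _ _ (wp_assign _ _ _ _ _ ?_)))))
    set b := A (offAt A m o i) + 1 with hbdef
    refine (Runs.for_loop (fun v s' => s'.var vO = offAt A m o i + 1 + m + v * b) 5 b
      (by simp [Expr.eval, hO, hA₁, hbdef]) rfl rfl rfl ?_ ?_).to_wp ?_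
    · simp [Expr.eval, hO, hm₁]
    · intro v hv s₂ hf₂ hsv h
      have hb₂ := hf₂.1 vB rfl
      simp [Expr.eval, hO, hA₁] at hb₂
      refine wp_assign _ _ _ _ _ ⟨?_, by simp [Expr.cost]⟩
      simp [Expr.eval, h, hb₂, hbdef]
      ring
    · intro s₂ t₂ hf₂ h₂ ht₂
      have ha := hf₂.2 aOff rfl
      refine ⟨⟨by simp [h₂, offAt, hbdef], fun i' hi' => ?_⟩, ?_⟩
      · simp [ha, Expr.eval, hsi, hO]
        rcases Nat.lt_succ_iff_lt_or_eq.mp hi' with h | rfl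
        · rw [if_neg (by omega), hoff i' h]
        · simp
      · have := loop_le_const hB (hb i hi) (T := 5 + 8) (k := 3) (by omega) le_rfl
        simp [Expr.cost] at ht₂
        omega
  · have := loop_le hB hkB (T := 2 * B ^ 3 + 8) (a := 4) (k := 6) (by omega) le_rfl
    omega

/-- Compute the numbers of branches of the search trees. -/
def tablesProg : Prog :=
  .seq (.assign vN (.add (.var vD) (.lit 1))) <|
  .seq (.assign vS (.lit 1)) <|
  .seq (forLoop vV vN
    (.assign vS (.add (.add (.var vS) (.var vS)) (.add (.var vS) (.var vS))))) <|
  .seq (.assign vT (.lit 1)) <|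
  forLoop vI vD <| forLoop vV vN <|
    .assign vT (.add (.add (.var vT) (.var vT)) (.add (.var vT) (.var vT)))

theorem tablesProg_spec {B d : ℕ} {s : State} (hB : 100 ≤ B) (hd : s.var vD = d) (hdB : d < B) :
    Runs tablesProg s (B ^ 6) (fun s' => s'.var vS = 4 ^ (d + 1) ∧
      s'.var vT = 4 ^ ((d + 1) * d)) := by
  have hb1 := hundred_le_pow hB 3 (by omega)
  have hb2 : 100 * B ^ 3 ≤ B ^ 4 := hundred_mul_pow_le hB 3
  have hb3 := loop_le_const hB (n := d + 1) hdB (T := 8 + 8) (k := 3) (by omega) le_rfl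
  apply Runs.of_wp
  refine wp_seq _ _ _ _ _ (wp_assign _ _ _ _ _ (wp_seq _ _ _ _ _ (wp_assign _ _ _ _ _ ?_)))
  refine wp_seq _ _ _ _ _ ((Runs.for_loop (fun v s' => s'.var vS = 4 ^ v) 8 (d + 1)
    (by simp [Expr.eval, hd]) rfl rfl rfl (by simp [Expr.eval]) ?_).to_wp ?_)
  · intro v hv s₁ hf₁ hsv h
    refine wp_assign _ _ _ _ _ ⟨?_, by simp [Expr.cost]⟩
    simp [Expr.eval, h]
    ring
  · intro s₁ t₁ hf₁ hS ht₁
    have hN₁ := hf₁.1 vN rfl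
    have hd₁ := hf₁.1 vD rfl
    simp [Expr.eval, hd] at hN₁ hd₁
    simp only [Expr.cost] at ht₁
    refine wp_seq _ _ _ _ _ (wp_assign _ _ _ _ _ ?_)
    refine (Runs.for_loop (fun i s' => s'.var vT = 4 ^ ((d + 1) * i)) (B ^ 3) d
      (by simp [hd₁]) rfl rfl rfl (by simp [Expr.eval]) ?_).to_wp ?_
    · intro i hi s₂ hf₂ hsi h₂
      have hN₂ := hf₂.1 vN rfl
      simp [hN₁] at hN₂
      refine (Runs.for_loop (fun v s' => s'.var vT = 4 ^ ((d + 1) * i + v)) 8 (d + 1)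
        hN₂ rfl rfl rfl (by simp [h₂]) ?_).to_wp ?_
      · intro v hv s₃ hf₃ hsv h
        refine wp_assign _ _ _ _ _ ⟨?_, by simp [Expr.cost]⟩
        simp [Expr.eval, h]
        ring
      · intro s₃ t₃ hf₃ h₃ ht₃
        exact ⟨by simp [h₃, Nat.mul_succ], by omega⟩
    · intro s₂ t₂ hf₂ h₂ ht₂
      refine ⟨⟨by simpa [hS] using hf₂.1 vS rfl, h₂⟩, ?_⟩
      have h4 := loop_le hB hdB.le (T := B ^ 3 + 8) (a := 3) (k := 5) (by omega) le_rfl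
      have h5 : B ^ 3 ≤ B ^ 5 := Nat.pow_le_pow_right (by omega) (by omega)
      have h6 : 100 * B ^ 5 ≤ B ^ 6 := hundred_mul_pow_le hB 5
      simp only [Expr.cost] at ht₂
      omega

/-- The problem that is stored in `A`. -/
def memProblem (A : ℕ → ℕ) (m k d o : ℕ) : Problem where
  m := m
  k := k
  d := d
  C i := consAt A m (offAt A m o i)

/-- Prepare the memory for the search. -/
def prepProg : Prog := .seq offsetsProg tablesProg

/-- The one bound on `4 ^ ((d + 1) * (d + 1))` covers both tree sizes and `d` itself, which need not
be bounded by the input length. -/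
theorem prepProg_spec {B m k d o : ℕ} {s : State} {A : ℕ → ℕ} (hB : 100 ≤ B) (hk : s.var vK = k)
    (hkB : k < B) (hm : s.var vM = m) (hmB : m < B) (hd : s.var vD = d)
    (hdB : 4 ^ ((d + 1) * (d + 1)) ≤ B) (hA : s.arr aIn = A) (ho : s.var vO = o)
    (hb : ∀ i < k, A (offAt A m o i) + 1 ≤ B)
    (hb' : ∀ i < k, ∀ u < m, A (offAt A m o i + 1 + u) ≤ B) :
    Runs prepProg s (B ^ 7) (Mem (memProblem A m k d o) B) := by
  have hd1 : 4 ^ (d + 1) ≤ B :=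
    (Nat.pow_le_pow_right (by norm_num) (Nat.le_mul_self _)).trans hdB
  have hd2 : 4 ^ ((d + 1) * d) ≤ B :=
    (Nat.pow_le_pow_right (by norm_num) (Nat.mul_le_mul_left _ (by omega))).trans hdB
  have hd3 : d < B := (Nat.lt_pow_self (by norm_num : 1 < 4)).trans_le
    ((Nat.pow_le_pow_right (by norm_num) (Nat.le_succ d)).trans hd1)
  apply Runs.of_wp
  refine wp_seq _ _ _ _ _ ((offsetsProg_spec hB hk hkB.le hm hA ho hb).to_wp ?_)
  intro s₁ t₁ hf₁ hoff ht₁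
  refine (tablesProg_spec hB ((hf₁.1 vD rfl).trans hd) hd3).to_wp ?_
  rintro s₂ t₂ hf₂ ⟨hS, hT⟩ ht₂
  have hA₂ : s₂.arr aIn = A := (hf₂.2 aIn rfl).trans ((hf₁.2 aIn rfl).trans hA)
  have hoff₂ : s₂.arr aOff = s₁.arr aOff := hf₂.2 aOff rfl
  refine ⟨⟨hB, (hf₂.1 vM rfl).trans ((hf₁.1 vM rfl).trans hm),
    (hf₂.1 vK rfl).trans ((hf₁.1 vK rfl).trans hk),
    (hf₂.1 vD rfl).trans ((hf₁.1 vD rfl).trans hd), hS, hT, ?_, hmB, hkB, hd3, hd1, hd2, ?_⟩, ?_⟩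
  · intro i hi
    rw [hA₂, hoff₂, hoff i hi]
    rfl
  · intro i hi
    rw [hA₂, hoff₂, hoff i hi]
    exact hb' i hi
  · simp only [Nat.zero_add] at ht₁
    have : 100 * B ^ 6 ≤ B ^ 7 := hundred_mul_pow_le hB 6
    omega

/-! ### The encoding of the input -/

/-- The positions are an arbitrary solution of the recurrence, because two are needed: `j * (b + 1)`
for the rows of a matrix, and `RSMInstance.pos` for representations of varying length. -/
theorem getD_flatten_ofFn {n : ℕ} (f : Fin n → List ℕ) (pos : ℕ → ℕ) (h0 : pos 0 = 0)
    (hpos : ∀ i : Fin n, pos (i + 1) = pos i + (f i).length) (i : Fin n) (t : ℕ)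
    (ht : t < (f i).length) :
    (List.ofFn f).flatten.getD (pos i + t) 0 = (f i).getD t 0 ∧
      pos i + (f i).length ≤ (List.ofFn f).flatten.length := by
  induction n generalizing pos with
  | zero => exact i.elim0
  | succ n ih =>
    rw [List.ofFn_succ, List.flatten_cons, List.length_append]
    induction i using Fin.cases with
    | zero =>
      simp only [Fin.val_zero, h0, Nat.zero_add]
      exact ⟨List.getD_append _ _ _ _ ht, by omega⟩
    | succ i =>
      have h1 : pos 1 = (f 0).length := by simpa [h0] using hpos 0
      have hmono : ∀ j ≤ n, pos 1 ≤ pos (j + 1) := by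
        intro j hj
        induction j with
        | zero => exact le_rfl
        | succ j ihj =>
          have : pos (j + 1 + 1) = pos (j + 1) + (f ⟨j + 1, by omega⟩).length :=
            hpos ⟨j + 1, by omega⟩
          have := ihj (by omega)
          omega
      have := ih (fun j => f j.succ) (fun j => pos (j + 1) - pos 1) (by simp) (fun j => by
        have := hpos j.succ
        have := hmono j (by omega)
        simp only [Fin.val_succ] at *
        omega) i ht
      have h2 := hmono i (by omega)
      rw [Fin.val_succ]
      refine ⟨?_, by omega⟩
      rw [List.getD_append_right _ _ _ _ (by omega), ← this.1]
      congr 1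
      omega

section encode

variable {m : ℕ} {L : Set (Finset (Fin m))} (R : CompactRep L)

/-- The list of numbers `R.encode` is stored in `A` from the cell `o` on. -/
structure RepAt (A : ℕ → ℕ) (o : ℕ) : Prop where
  b : A o = R.b
  block : ∀ v : Fin m, A (o + 1 + v) = R.block v
  edge : ∀ j j' : Fin (R.b + 1),
    A (o + 1 + m + j * (R.b + 1) + j') = if R.edge j j' = true then 1 else 0

theorem length_encode : R.encode.length = 1 + m + (R.b + 1) * (R.b + 1) := by
  simp [CompactRep.encode, List.length_flatten, List.map_ofFn, Function.comp_def]
  ring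

theorem repAt_of_getD {A : ℕ → ℕ} {o : ℕ}
    (h : ∀ t < R.encode.length, A (o + t) = R.encode.getD t 0) : RepAt R A o := by
  have hlen := length_encode R
  refine ⟨?_, fun v => ?_, fun j j' => ?_⟩
  · rw [← Nat.add_zero o, h 0 (by omega)]
    rfl
  · have hv := v.2
    rw [Nat.add_assoc, h _ (by rw [hlen]; omega), Nat.add_comm 1, CompactRep.encode,
      List.getD_cons_succ, List.getD_append _ _ _ _ (by simp)]
    simp
  · have hj := j.2
    have hj' := j'.2
    have hjj : (j : ℕ) * (R.b + 1) + j' < (R.b + 1) * (R.b + 1) := by nlinarith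
    have e : o + 1 + m + j * (R.b + 1) + j' = o + ((m + (j * (R.b + 1) + j')) + 1) := by ring
    rw [e, h _ (by rw [hlen]; omega), CompactRep.encode, List.getD_cons_succ,
      List.getD_append_right _ _ _ _ (by simp)]
    have := (getD_flatten_ofFn (fun j : Fin (R.b + 1) =>
      List.ofFn fun j' : Fin (R.b + 1) => if R.edge j j' = true then 1 else 0)
      (fun j => j * (R.b + 1)) (by simp) (fun j => by simp; ring) j j' (by rw [List.length_ofFn]; exact hj')).1
    simp only [List.length_ofFn, Nat.add_sub_cancel_left]
    rw [this, List.getD_eq_getElem _ _ (by rw [List.length_ofFn]; exact hj'), List.getElem_ofFn]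

end encode

/-- A subset of `{0, …, m - 1}` as a set of numbers. -/
def toNat {m : ℕ} (X : Finset (Fin m)) : Finset ℕ := X.map Fin.valEmbedding

theorem mem_toNat {m : ℕ} {X : Finset (Fin m)} {v : ℕ} :
    v ∈ toNat X ↔ ∃ h : v < m, (⟨v, h⟩ : Fin m) ∈ X := by
  simp only [toNat, Finset.mem_map, Fin.valEmbedding_apply]
  constructor
  · rintro ⟨w, hw, rfl⟩
    exact ⟨w.2, hw⟩
  · rintro ⟨h, hv⟩
    exact ⟨_, hv, rfl⟩

theorem val_mem_toNat {m : ℕ} {X : Finset (Fin m)} {v : Fin m} : (v : ℕ) ∈ toNat X ↔ v ∈ X :=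
  mem_toNat.trans ⟨fun ⟨_, h⟩ => h, fun h => ⟨v.2, h⟩⟩

theorem toNat_subset {m : ℕ} (X : Finset (Fin m)) : toNat X ⊆ Finset.range m := fun v hv => by
  obtain ⟨h, -⟩ := mem_toNat.mp hv
  exact Finset.mem_range.mpr h

theorem exists_toNat {m : ℕ} {W : Finset ℕ} (hW : W ⊆ Finset.range m) :
    ∃ X : Finset (Fin m), toNat X = W := by
  refine ⟨Finset.univ.filter (fun v => (v : ℕ) ∈ W), ?_⟩
  ext v
  simp only [mem_toNat, Finset.mem_filter, Finset.mem_univ, true_and]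
  exact ⟨fun ⟨_, h⟩ => h, fun h => ⟨Finset.mem_range.mp (hW h), h⟩⟩

theorem card_symmDiff_toNat {m : ℕ} (X Y : Finset (Fin m)) :
    (symmDiff (toNat X) (toNat Y)).card = (symmDiff X Y).card := by
  rw [← Finset.card_map Fin.valEmbedding (s := symmDiff X Y)]
  change _ = (toNat _).card
  congr 1
  ext v
  simp only [Finset.mem_symmDiff, mem_toNat]
  grind

/-- Constraints on elements are equivalent to the graph condition on blocks: within a block
membership is constant, and since all blocks other than `U 0` in the graph are nonempty, an edge to
such a block is seen by elements. -/
theorem RepAt.closed_iff {m : ℕ} {L : Set (Finset (Fin m))} {R : CompactRep L} {A : ℕ → ℕ} {o : ℕ}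
    (h : RepAt R A o) (Y : Finset (Fin m)) : (consAt A m o).Closed m (toNat Y) ↔ Y ∈ L := by
  have himp : ∀ u w : Fin m, (consAt A m o).imp u w ↔ R.block u = R.block w ∨
      ∃ j j', R.block u = j.castSucc ∧ R.block w = j'.castSucc ∧ R.edge j j' = true := by
    intro u w
    simp only [consAt, h.block, h.b, Fin.val_inj]
    refine or_congr_right ⟨?_, ?_⟩
    · rintro ⟨h1, h2, h3⟩
      have := h.edge ⟨R.block u, by omega⟩ ⟨R.block w, by omega⟩
      simp only at this
      rw [this] at h3
      refine ⟨⟨R.block u, by omega⟩, ⟨R.block w, by omega⟩, rfl, rfl, ?_⟩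
      by_contra h4
      simp [h4] at h3
    · rintro ⟨j, j', hj, hj', he⟩
      have := h.edge j j'
      rw [if_pos he] at this
      rw [hj, hj']
      simp only [Fin.val_castSucc]
      exact ⟨by omega, by omega, by omega⟩
  have hviol : (consAt A m o).Closed m (toNat Y) ↔
      (∀ v, R.block v = 0 → v ∈ Y) ∧ (∀ v, R.block v = Fin.last _ → v ∉ Y) ∧
        ∀ u w : Fin m, (consAt A m o).imp u w → u ∈ Y → w ∈ Y := by
    have hreq : ∀ v : Fin m, (consAt A m o).req v ↔ R.block v = 0 := fun v => by
      change A (o + 1 + v) = 0 ↔ _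
      rw [h.block, Fin.ext_iff]
      rfl
    have hforb : ∀ v : Fin m, (consAt A m o).forb v ↔ R.block v = Fin.last _ := fun v => by
      change A o < A (o + 1 + v) ↔ _
      rw [h.block, h.b, Fin.ext_iff, Fin.val_last]
      have := (R.block v).2
      omega
    constructor
    · rintro ⟨-, hc⟩
      refine ⟨fun v hv => ?_, fun v hv hvY => ?_, fun u w huw hu => ?_⟩
      · by_contra hvY
        exact hc v v.2 v v.2 (.inl ⟨rfl, .inl ⟨(hreq v).mpr hv, by rwa [val_mem_toNat]⟩⟩)
      · exact hc v v.2 v v.2 (.inl ⟨rfl, .inr ⟨(hforb v).mpr hv, by rwa [val_mem_toNat]⟩⟩)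
      · by_contra hw
        exact hc u u.2 w w.2 (.inr ⟨by rwa [val_mem_toNat], by rwa [val_mem_toNat], huw⟩)
    · rintro ⟨h1, h2, h3⟩
      refine ⟨toNat_subset Y, fun u hu w hw => ?_⟩
      lift u to Fin m using hu
      lift w to Fin m using hw
      rintro (⟨-, ⟨h4, h5⟩ | ⟨h4, h5⟩⟩ | ⟨h4, h5, h6⟩)
      · exact h5 (val_mem_toNat.mpr (h1 u ((hreq u).mp h4)))
      · exact h2 u ((hforb u).mp h4) (val_mem_toNat.mp h5)
      · exact h5 (val_mem_toNat.mpr (h3 u w h6 (val_mem_toNat.mp h4)))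
  rw [hviol]
  constructor
  · rintro ⟨h1, h2, h3⟩
    -- The index 0 is put in separately, since `U 0` may be empty and then no element represents it.
    -- This adds no outgoing edge because `U 0` is a sink.
    set Z : Finset (Fin (R.b + 1)) :=
      Finset.univ.filter (fun j => j = 0 ∨ ∃ v ∈ Y, R.block v = j.castSucc) with hZ
    have hYZ : Finset.univ.filter (fun v => ∃ j ∈ Z, R.block v = j.castSucc) = Y := by
      ext v
      simp only [hZ, Finset.mem_filter, Finset.mem_univ, true_and]
      constructor
      · rintro ⟨j, rfl | ⟨u, hu, huj⟩, hj⟩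
        · exact h1 v (by simpa using hj)
        · exact h3 u v ((himp u v).mpr (.inl (huj.trans hj.symm))) hu
      · intro hv
        obtain ⟨j, hj⟩ := Fin.exists_castSucc_eq.mpr (fun h' => h2 v h' hv)
        exact ⟨j, .inr ⟨v, hv, hj.symm⟩, hj.symm⟩
    rw [← hYZ]
    refine (R.closed_iff Z (by simp [hZ])).mp fun j hj j' hjj' => ?_
    simp only [hZ, Finset.mem_filter, Finset.mem_univ, true_and] at hj ⊢
    rcases hj with rfl | ⟨u, hu, huj⟩
    · have := (R.sink_iff 0).mpr rfl j'
      simp [this] at hjj'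
    · by_cases hj' : j' = 0
      · exact .inl hj'
      · obtain ⟨w, hw⟩ := R.block_nonempty j' hj'
        exact .inr ⟨w, h3 u w ((himp u w).mpr (.inr ⟨j, j', huj, hw, hjj'⟩)) hu, hw⟩
  · intro hY
    refine ⟨R.mem_of_zero Y hY, R.notMem_of_last Y hY, fun u w huw hu => ?_⟩
    obtain ⟨J, hJ0, hJ⟩ := R.eq_union Y hY
    have hcl := (R.closed_iff J hJ0).mpr (hJ ▸ hY)
    rw [hJ] at hu ⊢
    simp only [Finset.mem_filter, Finset.mem_univ, true_and] at hu ⊢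
    obtain ⟨j, hj, huj⟩ := hu
    rcases (himp u w).mp huw with h1 | ⟨j₁, j', h1, h2, h3⟩
    · exact ⟨j, hj, h1 ▸ huj⟩
    · obtain rfl : j₁ = j := Fin.castSucc_injective _ (h1.symm.trans huj)
      exact ⟨j', hcl j₁ hj j' h3, h2⟩

/-! ### From instances to abstract problems. -/

section instances

variable (I : RSMInstance) (pre : List ℕ)

/-- The encodings of the representations of an instance. -/
def RSMInstance.reps : List ℕ := (List.ofFn fun i => (I.rep i).encode).flatten

/-- The content of the input array. -/
def RSMInstance.mem (i : ℕ) : ℕ := (pre ++ I.reps).getD i 0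

/-- The problem that is stored in the input array. -/
def RSMInstance.problem : Problem := memProblem (I.mem pre) I.m I.k I.d pre.length

/-- The position of the representation number `i`. -/
def RSMInstance.pos (I : RSMInstance) : ℕ → ℕ
  | 0 => 0
  | i + 1 => I.pos i + if h : i < I.k then (I.rep ⟨i, h⟩).encode.length else 0

/-- The summand `i` in the length estimate counts one cell for each earlier representation; it is
what bounds `k` by the input length. -/
theorem RSMInstance.mem_spec (i : Fin I.k) :
    RepAt (I.rep i) (I.mem pre) (offAt (I.mem pre) I.m pre.length i) ∧
      pre.length + i + (I.rep i).encode.length ≤ (pre ++ I.reps).length := by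
  have key : ∀ i : Fin I.k, RepAt (I.rep i) (I.mem pre) (pre.length + I.pos i) ∧
      I.pos i + (I.rep i).encode.length ≤ I.reps.length := by
    intro i
    have h := getD_flatten_ofFn (fun i => (I.rep i).encode) I.pos rfl
      (fun j => by simp [RSMInstance.pos]) i
    refine ⟨repAt_of_getD _ fun t ht => ?_, (h 0 (by rw [length_encode]; omega)).2⟩
    rw [RSMInstance.mem, List.getD_append_right _ _ _ _ (by omega), ← (h t ht).1]
    congr 1
    omega
  have hoff : ∀ i ≤ I.k, offAt (I.mem pre) I.m pre.length i = pre.length + I.pos i ∧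
      i ≤ I.pos i := by
    intro i hi
    induction i with
    | zero => exact ⟨rfl, le_rfl⟩
    | succ i ih =>
      obtain ⟨h1, h2⟩ := ih (by omega)
      have hb := (key ⟨i, hi⟩).1.b
      simp only at hb
      rw [offAt, h1, hb, RSMInstance.pos, dif_pos (Nat.lt_of_succ_le hi), length_encode]
      constructor <;> omega
  obtain ⟨h1, h2⟩ := hoff i i.2.le
  refine ⟨h1 ▸ (key i).1, ?_⟩
  rw [List.length_append]
  have := (key i).2
  omega

theorem RSMInstance.k_le : I.k ≤ (pre ++ I.reps).length := by
  rcases Nat.eq_zero_or_pos I.k with h | h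
  · omega
  · have := (I.mem_spec pre ⟨I.k - 1, by omega⟩).2
    rw [length_encode] at this
    simp only at this
    omega

theorem RSMInstance.block_le (i : Fin I.k) :
    I.mem pre (offAt (I.mem pre) I.m pre.length i) + 1 ≤ (pre ++ I.reps).length ∧
    ∀ u < I.m, I.mem pre (offAt (I.mem pre) I.m pre.length i + 1 + u) ≤ (pre ++ I.reps).length := by
  obtain ⟨h, hl⟩ := I.mem_spec pre i
  rw [length_encode] at hl
  have : (I.rep i).b + 1 ≤ ((I.rep i).b + 1) * ((I.rep i).b + 1) := Nat.le_mul_self _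
  rw [h.b]
  refine ⟨by omega, fun u hu => ?_⟩
  rw [h.block ⟨u, hu⟩]
  have := ((I.rep i).block ⟨u, hu⟩).2
  omega

theorem RSMInstance.closed_iff (i : Fin I.k) (Y : Finset (Fin I.m)) :
    ((I.problem pre).C i).Closed (I.problem pre).m (toNat Y) ↔ Y ∈ minimizers (I.f i) :=
  (I.mem_spec pre i).1.closed_iff Y

theorem RSMInstance.sol_iff (X : Finset (Fin I.m)) :
    (I.problem pre).Sol (toNat X) ↔ I.IsSolution X := by
  constructor
  · rintro ⟨-, h⟩ i
    obtain ⟨W, hW, hXW⟩ := h i i.2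
    obtain ⟨Y, rfl⟩ := exists_toNat hW.1
    exact ⟨Y, (I.closed_iff pre i Y).mp hW, (card_symmDiff_toNat (m := I.m) X Y).symm.le.trans hXW⟩
  · refine fun h => ⟨toNat_subset X, fun i hi => ?_⟩
    obtain ⟨Y, hY, hXY⟩ := h ⟨i, hi⟩
    exact ⟨toNat Y, (I.closed_iff pre ⟨i, hi⟩ Y).mpr hY, (card_symmDiff_toNat X Y).le.trans hXY⟩

theorem minimizers_nonempty {V : Type*} [Fintype V] (f : Finset V → ℝ) :
    (minimizers f).Nonempty := by
  obtain ⟨Y, -, hY⟩ := Finset.exists_min_image (Finset.univ : Finset (Finset V)) f ⟨∅, by simp⟩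
  exact ⟨Y, fun Y' => hY Y' (Finset.mem_univ _)⟩

theorem RSMInstance.exists_closed {i : ℕ} (hi : i < (I.problem pre).k) :
    ∃ W, ((I.problem pre).C i).Closed (I.problem pre).m W := by
  obtain ⟨Y, hY⟩ := minimizers_nonempty (I.f ⟨i, hi⟩)
  exact ⟨toNat Y, (I.closed_iff pre ⟨i, hi⟩ Y).mpr hY⟩

theorem RSMInstance.card_closedSets (i : Fin I.k) :
    (((I.problem pre).C i).closedSets (I.problem pre).m).card = (minimizers (I.f i)).ncard := by
  rw [← Set.ncard_image_of_injective _ (Finset.map_injective (Fin.valEmbedding (n := I.m))),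
    ← Set.ncard_coe_finset]
  congr 1
  ext W
  rw [Finset.mem_coe, Cons.mem_closedSets, Set.mem_image]
  constructor
  · intro hW
    obtain ⟨Y, rfl⟩ := exists_toNat hW.1
    exact ⟨Y, (I.closed_iff pre i Y).mp hW, rfl⟩
  · rintro ⟨Y, hY, rfl⟩
    exact (I.closed_iff pre i Y).mpr hY

end instances

/-! ### The algorithms -/

notation "vLen" => (0 : ℕ)

/-- Compute `a * n ^ e` in `vQq`, where `n` is the value of `vLen`. -/
def powProg (a : ℕ) : ℕ → Prog
  | 0 => .assign vQq (.lit a)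
  | e + 1 => .seq (powProg a e) <| .seq (.assign vQ (.lit 0)) <|
      .seq (forLoop vV vLen (.assign vQ (.add (.var vQ) (.var vQq)))) (.assign vQq (.var vQ))

/-- The exponent is a variable, so the written locations do not evaluate by `rfl` and are found by
induction. -/
theorem powProg_fr {a e : ℕ} {s s' : State} (h : Fr (powProg a e) s s') :
    (∀ x, (Nat.beq vQq x || Nat.beq vQ x || Nat.beq vV x) = false → s'.var x = s.var x) ∧
      s'.arr = s.arr := by
  refine ⟨fun x hx => h.1 x ?_, funext fun b => h.2 b ?_⟩
  · simp only [Bool.or_eq_false_iff] at hx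
    clear h
    induction e <;> simp_all [powProg, Prog.wv, forLoop]
  · clear h
    induction e <;> simp_all [powProg, Prog.wa, forLoop]

theorem powProg_spec {a e n B : ℕ} {s : State} (hB : 100 ≤ B) (hn : s.var vLen = n) (hnB : n ≤ B) :
    Runs (powProg a e) s ((e + 1) * B ^ 4) (fun s' => s'.var vQq = a * n ^ e) := by
  have hb := hundred_le_pow hB 4 (by omega)
  induction e with
  | zero =>
    apply Runs.of_wp
    refine wp_assign _ _ _ _ _ ?_
    simp [Expr.eval, Expr.cost]
    omega
  | succ e ih =>
    apply Runs.of_wp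
    refine wp_seq _ _ _ _ _ (ih.to_wp ?_)
    intro s₁ t₁ hf₁ h₁ ht₁
    have hn₁ := ((powProg_fr hf₁).1 vLen rfl).trans hn
    refine wp_seq _ _ _ _ _ (wp_assign _ _ _ _ _ (wp_seq _ _ _ _ _ ?_))
    refine (Runs.for_loop (fun v s' => s'.var vQ = v * (a * n ^ e)) 4 n (by simp [hn₁])
      rfl rfl rfl (by simp [Expr.eval]) ?_).to_wp ?_
    · intro v hv s₂ hf₂ hsv h
      have hq := hf₂.1 vQq rfl
      simp [h₁] at hq
      refine wp_assign _ _ _ _ _ ⟨?_, by simp [Expr.cost]⟩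
      simp [Expr.eval, h, hq]
      ring
    · intro s₂ t₂ hf₂ h₂ ht₂
      refine wp_assign _ _ _ _ _ ⟨?_, ?_⟩
      · simp [Expr.eval, h₂]
        ring
      · have := loop_le_const hB hnB (T := 4 + 8) (k := 3) (by omega) le_rfl
        have h3 : 100 * B ^ 3 ≤ B ^ 4 := hundred_mul_pow_le hB 3
        have h4 : (e + 1 + 1) * B ^ 4 = (e + 1) * B ^ 4 + B ^ 4 := by ring
        simp only [Expr.cost] at ht₂ ⊢
        omega

/-- Write the result: the set in `aY` if the variable `x` is not zero. -/
def outProg (x : ℕ) : Prog :=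
  .ite (.var x) (.seq (copyArr aY aIn) (.assign vLen (.lit 1))) (.assign vLen (.lit 0))

theorem outProg_spec {P : Problem} {B x : ℕ} {s : State} (hM : Mem P B s)
    {S : Finset ℕ → Prop} (h : (s.var x = 1 ∧ ∃ X, S X ∧ IsVec P.m (s.arr aY) X) ∨
      (s.var x = 0 ∧ ¬ ∃ X, S X)) :
    Runs (outProg x) s (B ^ 4) (fun s' =>
      (s'.var vLen = 1 ∧ ∃ X, S X ∧ IsVec P.m (s'.arr aIn) X) ∨
      (s'.var vLen = 0 ∧ ¬ ∃ X, S X)) := by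
  have hb3 := hundred_le_pow hM.hB 3 (by omega)
  have hb4 : 100 * B ^ 3 ≤ B ^ 4 := hundred_mul_pow_le hM.hB 3
  apply Runs.of_wp
  refine wp_ite _ _ _ _ _ _ (fun h' => ?_) (fun h' => wp_assign _ _ _ _ _ ?_)
  · obtain ⟨-, X, hX, hXv⟩ := h.resolve_right (fun h'' => h' h''.1)
    refine wp_seq _ _ _ _ _ ((copyArr_spec hM rfl hXv).to_wp ?_)
    intro s₁ t₁ hf₁ h₁ ht₁
    simp only [Expr.cost] at ht₁
    refine wp_assign _ _ _ _ _ ⟨.inl ⟨by simp [Expr.eval], X, hX, by simpa using h₁⟩, ?_⟩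
    simp [Expr.cost]
    omega
  · simp only [Expr.eval] at h'
    refine ⟨.inr ⟨by simp [Expr.eval], (h.resolve_left (fun h'' => by omega)).2⟩, ?_⟩
    simp [Expr.cost]
    omega

/-- The algorithm for Robust Submodular Minimizer. If `dec` is not zero, the enumeration of the
minimizers of each function is aborted after `a * n ^ e` sets. -/
def robustProg (dec a e : ℕ) : Prog :=
  .seq (powProg a e) <|
  .seq (.assign vDec (.lit dec)) <|
  .seq (.assign vM (.get aIn (.lit 0))) <|
  .seq (.assign vK (.get aIn (.lit 1))) <|
  .seq (.assign vD (.get aIn (.lit 2))) <|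
  .seq (.assign vR (.var vD)) <|
  .seq (.assign vO (.lit 3)) <|
  .seq prepProg <|
  .seq tryAll (outProg vAns)

/-- The algorithm for Anchored Submodular Minimizer. -/
def anchoredProg : Prog :=
  .seq (.assign vM (.get aIn (.lit 0))) <|
  .seq (.assign vK (.get aIn (.lit 1))) <|
  .seq (.assign vD (.get aIn (.lit 2))) <|
  .seq (.assign vR (.get aIn (.lit 3))) <|
  .seq (forLoop vV vM (.store aE (.var vV) (.get aIn (.add (.lit 4) (.var vV))))) <|
  .seq (.assign vO (.add (.lit 4) (.var vM))) <|
  .seq prepProg <|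
  .seq searchProg (outProg vFound)

theorem solvesWithin_of_runs {p : Prog} {input : List ℕ} {m T : ℕ} {Sol : Finset (Fin m) → Prop}
    {S : Finset ℕ → Prop} (hS : ∀ X, Sol X ↔ S (toNat X)) (hSm : ∀ X, S X → X ⊆ Finset.range m)
    (h : Runs p (initState input) T (fun s' =>
      (s'.var vLen = 1 ∧ ∃ X, S X ∧ IsVec m (s'.arr aIn) X) ∨
      (s'.var vLen = 0 ∧ ¬ ∃ X, S X))) : SolvesWithin p input Sol T := by
  obtain ⟨t, s, hx, ht, h⟩ := h
  refine ⟨t, s, hx, ht, h.imp ?_ ?_⟩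
  · rintro ⟨h0, X, hX, hv⟩
    obtain ⟨X, rfl⟩ := exists_toNat (hSm X hX)
    refine ⟨h0, X, (hS X).mpr hX, fun v => ?_⟩
    simp only [hv v v.2, val_mem_toNat]
  · rintro ⟨h0, h⟩
    exact ⟨h0, fun ⟨X, hX⟩ => h ⟨_, (hS X).mp hX⟩⟩

/-- The two alternatives of `hM` are the full enumeration for the first function, and the
enumeration cut off at `a * n ^ e` with some function strictly below this limit. `M` bounds the
number of sets enumerated for one function. -/
theorem robustProg_spec (I : RSMInstance) {B M dec a e : ℕ} (hB : 100 ≤ B)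
    (hn : I.encode.length < B) (hd : 4 ^ ((I.d + 1) * (I.d + 1)) ≤ B) (he : e < B) (ha : 0 < a)
    (hM0 : 0 < M) (i : Fin I.k)
    (hM : (dec = 0 ∧ (i : ℕ) = 0 ∧ (minimizers (I.f i)).ncard ≤ M) ∨
      (dec = 1 ∧ a * I.encode.length ^ e ≤ M ∧
        (minimizers (I.f i)).ncard < a * I.encode.length ^ e)) :
    SolvesWithin (robustProg dec a e) I.encode I.IsSolution (M * B ^ 29) := by
  set pre := [I.m, I.k, I.d] with hpre
  have henc : I.encode = pre ++ I.reps := rfl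
  have hmem : (initState I.encode).arr aIn = I.mem pre := by
    funext j
    simp [initState, henc, RSMInstance.mem]
  have hlen : 3 ≤ I.encode.length := by simp [henc, hpre]
  have hmB : I.m < B := by
    have := (I.mem_spec pre i).2
    rw [length_encode, ← henc] at this
    omega
  have hkB : I.k < B := by
    have := I.k_le pre
    rw [← henc] at this
    omega
  refine solvesWithin_of_runs (S := (I.problem pre).Sol) (fun X => (I.sol_iff pre X).symm)
    (fun X hX => hX.1) ?_
  apply Runs.of_wp
  refine wp_seq _ _ _ _ _ ((powProg_spec hB (n := I.encode.length) (by simp [initState])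
    hn.le).to_wp ?_)
  intro s₁ t₁ hf₁ hq₁ ht₁
  have harr := (powProg_fr hf₁).2
  have hIn : s₁.arr aIn = I.mem pre := by rw [harr, hmem]
  have h0 : I.mem pre 0 = I.m := rfl
  have h1 : I.mem pre 1 = I.k := rfl
  have h2 : I.mem pre 2 = I.d := rfl
  refine wp_seq _ _ _ _ _ (wp_assign _ _ _ _ _ (wp_seq _ _ _ _ _ (wp_assign _ _ _ _ _
    (wp_seq _ _ _ _ _ (wp_assign _ _ _ _ _ (wp_seq _ _ _ _ _ (wp_assign _ _ _ _ _
    (wp_seq _ _ _ _ _ (wp_assign _ _ _ _ _ (wp_seq _ _ _ _ _ (wp_assign _ _ _ _ _ ?_)))))))))))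
  refine wp_seq _ _ _ _ _ ((prepProg_spec (A := I.mem pre) (o := pre.length) (m := I.m) (k := I.k)
    (d := I.d) hB (by simp [Expr.eval, hIn, h1]) hkB (by simp [Expr.eval, hIn, h0]) hmB
    (by simp [Expr.eval, hIn, h2]) hd (by simp [hIn]) (by simp [Expr.eval, hpre])
    (fun i hi => (I.block_le pre ⟨i, hi⟩).1.trans hn.le)
    (fun i hi u hu => ((I.block_le pre ⟨i, hi⟩).2 u hu).trans hn.le)).to_wp ?_)
  intro s₂ t₂ hf₂ hM₂ ht₂
  have hr₂ := hf₂.1 vR rfl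
  have hq₂ := hf₂.1 vQq rfl
  have hdec₂ := hf₂.1 vDec rfl
  simp [Expr.eval, hIn, h2, hq₁] at hr₂ hq₂ hdec₂
  refine wp_seq _ _ _ _ _ ((tryAll_spec (P := I.problem pre) (M := M) hM₂ i.2 hr₂
    (fun i hi => I.exists_closed pre hi) hq₂ ?_ hdec₂ hM0 ?_).to_wp ?_)
  · exact Nat.mul_pos ha (Nat.pow_pos (by omega))
  · rwa [I.card_closedSets pre i]
  intro s₃ t₃ hf₃ h₃ ht₃
  refine (outProg_spec (P := I.problem pre) (hM₂.frame hf₃ rfl) h₃).to_wp ?_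
  intro s₄ t₄ hf₄ h₄ ht₄
  refine ⟨h₄, ?_⟩
  have e1 : (e + 1) * B ^ 4 ≤ B * B ^ 4 := Nat.mul_le_mul_right _ he
  have e2 : B * B ^ 4 = B ^ 5 := by ring
  have e3 : B ^ 5 ≤ B ^ 28 := Nat.pow_le_pow_right (by omega) (by omega)
  have e4 : B ^ 7 ≤ B ^ 28 := Nat.pow_le_pow_right (by omega) (by omega)
  have e5 : B ^ 4 ≤ B ^ 28 := Nat.pow_le_pow_right (by omega) (by omega)
  have e6 : 1 * B ^ 28 ≤ M * B ^ 28 := Nat.mul_le_mul_right _ hM0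
  have e7 : M * (100 * B ^ 28) ≤ M * B ^ 29 := Nat.mul_le_mul_left _ (hundred_mul_pow_le hB 28)
  have e8 : M * (100 * B ^ 28) = 100 * (M * B ^ 28) := by ring
  have e9 := hundred_le_pow hB 28 (by omega)
  simp only [Expr.cost] at ht₂
  omega

theorem anchoredProg_spec (I : ASMInstance) {B : ℕ} (hB : 100 ≤ B)
    (hn : I.encode.length < B) (hd : 4 ^ ((I.d + 1) * (I.d + 1)) ≤ B) :
    SolvesWithin anchoredProg I.encode I.IsSolution (B ^ 24) := by
  set pre := [I.m, I.k, I.d, I.d₀] ++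
    List.ofFn (fun v : Fin I.m => if v ∈ I.Y₀ then 1 else 0) with hpre
  have henc : I.encode = pre ++ I.reps := rfl
  have hmem : (initState I.encode).arr aIn = I.mem pre := by
    funext j
    simp [initState, henc, RSMInstance.mem]
  have hlen : pre.length = 4 + I.m := by simp [hpre]; omega
  have hmB : I.m < B := by
    rw [henc, List.length_append, hlen] at hn
    omega
  have hkB : I.k < B := by
    have := I.k_le pre
    rw [← henc] at this
    omega
  refine solvesWithin_of_runs (S := fun X => (I.problem pre).Sol X ∧
    (symmDiff X (toNat I.Y₀)).card ≤ I.d₀) (fun X => ?_) (fun X hX => hX.1.1) ?_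
  · rw [card_symmDiff_toNat, I.sol_iff pre X, and_comm]
    rfl
  have h0 : I.mem pre 0 = I.m := rfl
  have h1 : I.mem pre 1 = I.k := rfl
  have h2 : I.mem pre 2 = I.d := rfl
  have h3 : I.mem pre 3 = I.d₀ := rfl
  have h4 : ∀ v < I.m, I.mem pre (4 + v) = if v ∈ toNat I.Y₀ then 1 else 0 := by
    intro v hv
    rw [RSMInstance.mem, List.getD_append _ _ _ _ (by omega), hpre,
      List.getD_append_right _ _ _ _ (by simp), List.getD_eq_getElem _ _ (by simpa using hv)]
    simp [mem_toNat, hv]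
  apply Runs.of_wp
  refine wp_seq _ _ _ _ _ (wp_assign _ _ _ _ _ (wp_seq _ _ _ _ _ (wp_assign _ _ _ _ _
    (wp_seq _ _ _ _ _ (wp_assign _ _ _ _ _ (wp_seq _ _ _ _ _ (wp_assign _ _ _ _ _ ?_)))))))
  refine wp_seq _ _ _ _ _ ((Runs.for_loop (fun v s' => ∀ v' < v,
    s'.arr aE v' = if v' ∈ toNat I.Y₀ then 1 else 0) 8 I.m (by simp [Expr.eval, hmem, h0])
    rfl rfl rfl (by simp) ?_).to_wp ?_)
  · intro v hv s₁ hf hsv h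
    have hIn := hf.2 aIn rfl
    simp [hmem] at hIn
    refine wp_store _ _ _ _ _ _ ⟨fun v' hv' => ?_, by simp [Expr.cost]⟩
    have := h4 v hv
    simp [Expr.eval, hsv, hIn, this]
    rcases Nat.lt_succ_iff_lt_or_eq.mp hv' with h' | rfl
    · rw [if_neg (by omega), h v' h']
    · simp
  intro s₁ t₁ hf₁ hE₁ ht₁
  have hIn := hf₁.2 aIn rfl
  have hm₁ := hf₁.1 vM rfl
  have hk₁ := hf₁.1 vK rfl
  have hd₁ := hf₁.1 vD rfl
  have hr₁ := hf₁.1 vR rfl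
  simp [Expr.eval, hmem, h0, h1, h2, h3] at hIn hm₁ hk₁ hd₁ hr₁
  refine wp_seq _ _ _ _ _ (wp_assign _ _ _ _ _ ?_)
  refine wp_seq _ _ _ _ _ ((prepProg_spec (A := I.mem pre) (o := pre.length) (m := I.m) (k := I.k)
    (d := I.d) hB (by simp [hk₁]) hkB (by simp [hm₁]) hmB
    (by simp [hd₁]) hd (by simp [hIn]) (by simp [Expr.eval, hlen, hm₁])
    (fun i hi => (I.block_le pre ⟨i, hi⟩).1.trans hn.le)
    (fun i hi u hu => ((I.block_le pre ⟨i, hi⟩).2 u hu).trans hn.le)).to_wp ?_)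
  intro s₂ t₂ hf₂ hM₂ ht₂
  have hr₂ := hf₂.1 vR rfl
  have hE₂ := hf₂.2 aE rfl
  simp [hr₁] at hr₂ hE₂
  refine wp_seq _ _ _ _ _ ((searchProg_spec (P := I.problem pre) (A := toNat I.Y₀) hM₂ hr₂ I.d₀_le
    (toNat_subset _) (fun v hv => by rw [hE₂]; exact hE₁ v hv)).to_wp ?_)
  intro s₃ t₃ hf₃ h₃ ht₃
  refine (outProg_spec (P := I.problem pre) (S := fun X => (I.problem pre).Sol X ∧
    (symmDiff X (toNat I.Y₀)).card ≤ I.d₀) (hM₂.frame hf₃ rfl) ?_).to_wp ?_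
  · rcases h₃ with h₃ | ⟨h5, X, h6, h7, h8⟩
    exacts [.inr h₃, .inl ⟨h5, X, ⟨h6, h7⟩, h8⟩]
  intro s₄ t₄ hf₄ h₄ ht₄
  refine ⟨h₄, ?_⟩
  have e0 := loop_le_const hB hmB.le (T := 8 + 8) (k := 23) (by omega) (by omega)
  have e4 : B ^ 7 ≤ B ^ 23 := Nat.pow_le_pow_right (by omega) (by omega)
  have e5 : B ^ 4 ≤ B ^ 23 := Nat.pow_le_pow_right (by omega) (by omega)
  have e7 : 100 * B ^ 23 ≤ B ^ 24 := hundred_mul_pow_le hB 23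
  have e9 := hundred_le_pow hB 23 (by omega)
  simp only [Expr.cost] at ht₁ ht₂
  omega

/-! ### Time bounds -/

/-- The factor of the running time that depends on `d`. -/
def paramFactor (c e d : ℕ) : ℕ := (4 ^ ((d + 1) * (d + 1)) + c + 1) ^ e

theorem computable_paramFactor (c e : ℕ) : Computable (paramFactor c e) := by
  have hpow : Primrec₂ (fun a b : ℕ => a ^ b) := Primrec₂.unpaired'.mp Nat.Primrec.pow
  have hd : Primrec (fun d : ℕ => d + 1) := Primrec.succ
  exact (hpow.comp (Primrec.nat_add.comp (Primrec.nat_add.comp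
    (hpow.comp (Primrec.const 4) (Primrec.nat_mul.comp hd hd)) (Primrec.const c))
    (Primrec.const 1)) (Primrec.const e)).to_comp

/-- For `n ≥ 1` a sum `n + x + c` is at most `(x + c + 1) * n`, which turns an additive bound into a
product of a function of `d` and a power of `n`. -/
theorem bound_le {n : ℕ} (hn : 0 < n) (c e d : ℕ) :
    (n + 4 ^ ((d + 1) * (d + 1)) + c) ^ e ≤ paramFactor c e d * n ^ e := by
  rw [paramFactor, ← mul_pow]
  refine Nat.pow_le_pow_left ?_ e
  generalize 4 ^ ((d + 1) * (d + 1)) = x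
  have : 1 * (x + c) ≤ n * (x + c) := Nat.mul_le_mul_right _ hn
  have e : (x + c + 1) * n = n * (x + c) + n := by ring
  omega

theorem SolvesWithin.mono {p : Prog} {input : List ℕ} {m T T' : ℕ} {Sol : Finset (Fin m) → Prop}
    (h : SolvesWithin p input Sol T) (hT : T ≤ T') : SolvesWithin p input Sol T' := by
  obtain ⟨t, s, hx, ht, h⟩ := h
  exact ⟨t, s, hx, ht.trans hT, h⟩

theorem RSMInstance.length_pos (I : RSMInstance) : 0 < I.encode.length := by
  simp [RSMInstance.encode]

theorem ASMInstance.length_pos (I : ASMInstance) : 0 < I.encode.length := by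
  simp [ASMInstance.encode]

theorem robust_time :
    ∃ (p : Prog) (g : ℕ → ℕ) (c : ℕ), Computable g ∧
      ∀ (I : RSMInstance) (hk : 0 < I.k), SolvesWithin p I.encode I.IsSolution
        ((minimizers (I.f ⟨0, hk⟩)).ncard * g I.d * I.encode.length ^ c) := by
  -- Without cut-off the limit only has to be positive; here it is `1 * n ^ 0 = 1`.
  refine ⟨robustProg 0 1 0, paramFactor 100 29, 29, computable_paramFactor _ _, fun I hk => ?_⟩
  have hpos : 0 < 4 ^ ((I.d + 1) * (I.d + 1)) := by positivity
  refine (robustProg_spec I (B := I.encode.length + 4 ^ ((I.d + 1) * (I.d + 1)) + 100)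
    (M := (minimizers (I.f ⟨0, hk⟩)).ncard) (by omega) (by omega) (by omega) (by omega)
    Nat.one_pos ?_ ⟨0, hk⟩ (.inl ⟨rfl, rfl, le_rfl⟩)).mono ?_
  · exact (Set.ncard_pos (Set.toFinite _)).mpr (minimizers_nonempty _)
  · rw [mul_assoc]
    exact Nat.mul_le_mul_left _ (bound_le I.length_pos _ _ _)

/-- The sum of the coefficients is `q.eval 1`. Strictness, from the added 1, ensures that the
enumeration of a function with at most `q(n)` minimizers is not cut off. -/
theorem eval_lt_pow (q : Polynomial ℕ) {n : ℕ} (hn : 0 < n) :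
    q.eval n < (q.eval 1 + 1) * n ^ q.natDegree := by
  have h1 : q.eval n ≤ q.eval 1 * n ^ q.natDegree := by
    rw [Polynomial.eval_eq_sum_range, Polynomial.eval_eq_sum_range, Finset.sum_mul]
    refine Finset.sum_le_sum fun i hi => ?_
    rw [one_pow, mul_one]
    exact Nat.mul_le_mul_left _ (Nat.pow_le_pow_right hn (Finset.mem_range_succ_iff.mp hi))
  have h2 : 0 < n ^ q.natDegree := Nat.pow_pos hn
  rw [Nat.add_mul]
  omega

theorem robust_fpt (q : Polynomial ℕ) :
    ∃ (p : Prog) (g : ℕ → ℕ) (c : ℕ), Computable g ∧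
      ∀ I : RSMInstance, (∃ i, (minimizers (I.f i)).ncard ≤ q.eval I.encode.length) →
        SolvesWithin p I.encode I.IsSolution (g I.d * I.encode.length ^ c) := by
  set a := q.eval 1 + 1 with ha
  set e := q.natDegree with he
  refine ⟨robustProg 1 a e, paramFactor (100 + a + e) (1 + e + 29), 1 + e + 29,
    computable_paramFactor _ _, fun I ⟨i, hi⟩ => ?_⟩
  have hpos : 0 < 4 ^ ((I.d + 1) * (I.d + 1)) := by positivity
  have hlt := eval_lt_pow q I.length_pos
  refine (robustProg_spec I (B := I.encode.length + 4 ^ ((I.d + 1) * (I.d + 1)) + (100 + a + e))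
    (M := a * I.encode.length ^ e) (by omega) (by omega) (by omega) (by omega)
    (by omega) ?_ i (.inr ⟨rfl, le_rfl, hi.trans_lt hlt⟩)).mono (le_trans ?_ (bound_le I.length_pos
      (100 + a + e) _ _))
  · exact (Nat.zero_le _).trans_lt hlt
  · rw [pow_add, pow_add, pow_one]
    -- Since `B` also majorizes `a` and `n`, the factor `a * n ^ e` is absorbed by `B ^ (1 + e)`.
    exact Nat.mul_le_mul_right _ (Nat.mul_le_mul (by omega) (Nat.pow_le_pow_left (by omega) _))

theorem anchored_fpt :
    ∃ (p : Prog) (g : ℕ → ℕ) (c : ℕ), Computable g ∧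
      ∀ I : ASMInstance, SolvesWithin p I.encode I.IsSolution (g I.d * I.encode.length ^ c) := by
  refine ⟨anchoredProg, paramFactor 100 24, 24, computable_paramFactor _ _, fun I => ?_⟩
  have hpos : 0 < 4 ^ ((I.d + 1) * (I.d + 1)) := by positivity
  exact (anchoredProg_spec I (B := I.encode.length + 4 ^ ((I.d + 1) * (I.d + 1)) + 100)
    (by omega) (by omega) (by omega)).mono (bound_le I.length_pos _ _ _)

end RobustSubmodular

theorem mainTheorem6 :
    -- Robust Submodular Minimizer in time `|L₁| * g d * n ^ c`
    (∃ (p : RobustSubmodular.Prog) (g : ℕ → ℕ) (c : ℕ), Computable g ∧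
      ∀ (I : RobustSubmodular.RSMInstance) (hk : 0 < I.k),
        RobustSubmodular.SolvesWithin p I.encode I.IsSolution
          ((RobustSubmodular.minimizers (I.f ⟨0, hk⟩)).ncard * g I.d * I.encode.length ^ c)) ∧
    -- fixed-parameter tractability in `d` if some function has polynomially many minimizers
    (∀ q : Polynomial ℕ, ∃ (p : RobustSubmodular.Prog) (g : ℕ → ℕ) (c : ℕ), Computable g ∧
      ∀ I : RobustSubmodular.RSMInstance,
        (∃ i, (RobustSubmodular.minimizers (I.f i)).ncard ≤ q.eval I.encode.length) →
        RobustSubmodular.SolvesWithin p I.encode I.IsSolution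
          (g I.d * I.encode.length ^ c)) ∧
    -- Anchored Submodular Minimizer is fixed-parameter tractable in `d`
    (∃ (p : RobustSubmodular.Prog) (g : ℕ → ℕ) (c : ℕ), Computable g ∧
      ∀ I : RobustSubmodular.ASMInstance,
        RobustSubmodular.SolvesWithin p I.encode I.IsSolution
          (g I.d * I.encode.length ^ c)) :=
  ⟨RobustSubmodular.robust_time, RobustSubmodular.robust_fpt, RobustSubmodular.anchored_fpt⟩
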